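/- Let $p$ be a probability distribution on $\mathbb{R}$ with mean $0$, variance $1$ and finite moments of all orders. For each $N\ge 1$ let $A_N$ be a random $N\times N$ symmetric palindromic Toeplitz matrix, that is, a symmetric Toeplitz matrix whose first row $(x_0,x_1,x_2,\dots,x_2,x_1,x_0)$ is a palindrome, and let $B_N$ be a random $N\times N$ real symmetric matrix, where the $\lceil N/2\rceil$ free entries $x_0,x_1,\dots$ of $A_N$ and the $N(N+1)/2$ entries of $B_N$ on and above the diagonal are, for each $N$, all independent with distribution $p$. Let $$\mathcal{D}_N=\begin{bmatrix}A_N&B_N\\B_N&A_N\end{bmatrix},\qquad \mu_N=\frac1{2N}\sum_{i=1}^{2N}\delta_{\lambda_i(\mathcal{D}_N)/\sqrt{2N}},$$ where $\lambda_1(\mathcal{D}_N),\dots,\lambda_{2N}(\mathcal{D}_N)$ are the eigenvalues of $\mathcal{D}_N$ with multiplicity. Then there is a probability measure $\mu$ on $\mathbb{R}$ with unbounded support, which does not depend on $p$, such that the random measures $\mu_N$ converge weakly to $\mu$ as $N\to\infty$, both in probability and almost surely. That is, for every bounded continuous $f:\mathbb{R}\to\mathbb{R}$, $\int f\,d\mu_N\to\int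 f\,d\mu$ in probability; and if the matrices for all $N$ are defined on a common probability space (with any dependence between different $N$), then almost surely $\int f\,d\mu_N\to\int f\,d\mu$ for all bounded continuous $f$. -/

import Mathlib

open MeasureTheory ProbabilityTheory Filter Topology
open scoped ENNReal BoundedContinuousFunction

noncomputable section

/-- The distance of the diagonal through `(i, j)` to the nearer of the main diagonal and the
corner diagonal: with `d = |i - j|` this is `min d (N - 1 - d)`. -/
def pstDiag {N : ℕ} (i j : Fin N) : Fin ((N + 1) / 2) :=
  ⟨min (((i : ℕ) - j) + (j - i)) (N - 1 - (((i : ℕ) - j) + (j - i))), by omega⟩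

/-- The symmetric palindromic Toeplitz matrix with free parameters `x 0, x 1, …`: its first row is
the palindrome `x 0, x 1, x 2, …, x 2, x 1, x 0`, and its `(i, j)` entry depends only on
`|i - j|`. -/
def pstMatrix {N : ℕ} (x : Fin ((N + 1) / 2) → ℝ) : Matrix (Fin N) (Fin N) ℝ :=
  Matrix.of fun i j => x (pstDiag i j)

/-- The real symmetric matrix with prescribed entries on and above the diagonal. -/
def symMatrix {N : ℕ} (y : {q : Fin N × Fin N // q.1 ≤ q.2} → ℝ) : Matrix (Fin N) (Fin N) ℝ :=
  Matrix.of fun i j => y ⟨(min i j, max i j), min_le_max⟩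

/-- The disco of `A` and `B`, the block matrix `[[A, B], [B, A]]`. -/
def disco {N : ℕ} (A B : Matrix (Fin N) (Fin N) ℝ) :
    Matrix (Fin N ⊕ Fin N) (Fin N ⊕ Fin N) ℝ :=
  Matrix.fromBlocks A B B A

/-- The degrees of freedom of the ensemble: those of the palindromic Toeplitz block and those of
the real symmetric block. -/
abbrev DiscoIndex (N : ℕ) : Type :=
  Fin ((N + 1) / 2) ⊕ {q : Fin N × Fin N // q.1 ≤ q.2}

/-- The `2N × 2N` matrix of the ensemble with free entries `z`. -/
def discoOfEntries {N : ℕ} (z : DiscoIndex N → ℝ) : Matrix (Fin N ⊕ Fin N) (Fin N ⊕ Fin N) ℝ :=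
  disco (pstMatrix fun k => z (Sum.inl k)) (symMatrix fun q => z (Sum.inr q))

theorem pstMatrix_isHermitian {N : ℕ} (x : Fin ((N + 1) / 2) → ℝ) :
    (pstMatrix x).IsHermitian := by
  ext i j
  simp only [Matrix.conjTranspose_apply, pstMatrix, Matrix.of_apply, star_trivial, pstDiag]
  congr 2
  omega

theorem symMatrix_isHermitian {N : ℕ} (y : {q : Fin N × Fin N // q.1 ≤ q.2} → ℝ) :
    (symMatrix y).IsHermitian := by
  ext i j
  simp only [Matrix.conjTranspose_apply, symMatrix, Matrix.of_apply, star_trivial, min_comm,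
    max_comm]

theorem discoOfEntries_isHermitian {N : ℕ} (z : DiscoIndex N → ℝ) :
    (discoOfEntries z).IsHermitian :=
  (pstMatrix_isHermitian _).fromBlocks (symMatrix_isHermitian _) (pstMatrix_isHermitian _)

/-- The normalized spectral measure of an `n × n` real symmetric matrix: a point mass of size
`1 / n` at `λ / √n` for each eigenvalue `λ`, counted with multiplicity. -/
def normalizedSpectralMeasure {n : Type*} [Fintype n] [DecidableEq n] {M : Matrix n n ℝ}
    (hM : M.IsHermitian) : Measure ℝ :=
  (Fintype.card n : ℝ≥0∞)⁻¹ •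
    ∑ i, Measure.dirac (hM.eigenvalues i / Real.sqrt (Fintype.card n))

/-- The normalized spectral measure of the disco matrix with free entries `z`. -/
def discoSpectralMeasure {N : ℕ} (z : DiscoIndex N → ℝ) : Measure ℝ :=
  normalizedSpectralMeasure (discoOfEntries_isHermitian z)

/-- A probability distribution on `ℝ` with mean `0`, variance `1` and finite moments of all
orders. -/
structure IsEntryLaw (p : Measure ℝ) : Prop where
  isProbabilityMeasure : IsProbabilityMeasure p
  integrable_pow : ∀ k : ℕ, Integrable (fun x : ℝ => x ^ k) p
  mean_eq_zero : ∫ x, x ∂p = 0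
  variance_eq_one : ∫ x, x ^ 2 ∂p = 1

end

/-! The orthogonal change of basis (u, v) ↦ (u + v, u - v)/√2 splits the block matrix into (A + B) ⊕
(A - B). Hence the Stieltjes transform of the normalized spectral measure is the average of those of
(A + e B)/√(2N) for e = 1 and e = -1 (`stieltjes_discoSpectralMeasure`). In `blockSum e` the value e
= 0 gives the Toeplitz part alone. For e = ±1 the transform is controlled in three steps.

Fluctuations. The matrix is linear in independent entries, and resampling one entry moves the
normalized trace of the resolvent only slightly. A fourth moment Efron–Stein inequality
(`efronStein_four`) then bounds the fourth central moment by C/N^(3/2). This is summable, so the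
random transforms approach their means almost surely, whatever the dependence between different N.
Lipschitz bounds away from the real axis pass from a countable dense set to the whole upper
half-plane.

Mean. Write m for the mean transform of (A + e B)/√(2N) and m₀ for that of A/√(2N). Approximate
Gaussian integration by parts in the entries of B gives m(ζ) ≈ m₀(ζ + m(ζ)/2)
(`norm_meanTr_sub_meanTr_zero_le`). The Toeplitz part has a Gaussian limit. Without its last row and
column it is a circulant, whose eigenvalues are linear forms in the entries, and for all but at most
two frequencies these have variance close to 1/2. The central limit theorem, in terms of
characteristic functions, gives m₀ → S, the Stieltjes transform of N(0, 1/2)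
(`tendsto_meanTr_zero`).

Limit. Every limit s of m(w) therefore solves s = S(w + s/2), an equation free of p; it describes
the free convolution of N(0, 1/2) with a semicircle law of variance 1/2. A solution that is the
transform of a probability measure μ comes from tightness and compactness along one realization with
Gaussian entries. For Im w ≥ 2 the equation is a contraction, so m(w) converges to the transform of
μ for every p. Those w suffice for weak convergence: the kernels 1/(x - w) with |Im w| ≥ 2 and the
constants span a subspace whose closure is a point-separating star algebra, and tightness is read
off from the imaginary axis.

Unbounded support. If the support were bounded, then just to its right Im s would vanish as w
approaches the real axis. But s = S(w + s/2), and the positivity of the Gaussian density bounds Im S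
below near every real point. -/

set_option linter.unusedSectionVars false

/-! ### Efron–Stein inequalities for independent resampling -/

noncomputable section

variable {ι : Type*} [Fintype ι] [DecidableEq ι]

/-- Exchange the coordinates in `T` between the two components. -/
def swapOn (T : Finset ι) (x : (ι → ℝ) × (ι → ℝ)) : (ι → ℝ) × (ι → ℝ) :=
  (fun i => if i ∈ T then x.2 i else x.1 i, fun i => if i ∈ T then x.1 i else x.2 i)

variable (p : Measure ℝ) [IsProbabilityMeasure p]

/-- The law of a family of independent variables with law `p`. -/
abbrev iidLaw (ι : Type*) [Fintype ι] (p : Measure ℝ) : Measure (ι → ℝ) :=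
  Measure.pi fun _ : ι => p

/-- Viewed as a product over coordinates of pairs, the map acts on each pair by the flip or by the
identity, and both preserve p ⊗ p. -/
theorem measurePreserving_swapOn (T : Finset ι) :
    MeasurePreserving (swapOn T) ((iidLaw ι p).prod (iidLaw ι p))
      ((iidLaw ι p).prod (iidLaw ι p)) := by
  have h := measurePreserving_arrowProdEquivProdArrow ℝ ℝ ι (fun _ => p) (fun _ => p)
  have hs : MeasurePreserving (fun (x : ι → ℝ × ℝ) i => (if i ∈ T then Prod.swap else id) (x i))
      (Measure.pi fun _ => p.prod p) (Measure.pi fun _ => p.prod p) := by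
    refine measurePreserving_pi (fun _ => p.prod p) (fun _ => p.prod p)
      (f := fun i => if i ∈ T then Prod.swap else id) fun i => ?_
    split_ifs
    · exact Measure.measurePreserving_swap
    · exact MeasurePreserving.id _
  have := (h.comp hs).comp (MeasurePreserving.symm _ h)
  convert this using 1
  ext x i <;> by_cases hi : i ∈ T <;>
    simp [swapOn, hi, MeasurableEquiv.arrowProdEquivProdArrow, Equiv.arrowProdEquivProdArrow]

/-- Replace coordinate `i` of the first component by that of the second. -/
def resample (i : ι) (x : (ι → ℝ) × (ι → ℝ)) : ι → ℝ := Function.update x.1 i (x.2 i)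

theorem swapOn_singleton_fst (i : ι) (x : (ι → ℝ) × (ι → ℝ)) :
    (swapOn {i} x).1 = resample i x := by
  ext j
  by_cases h : j = i
  · subst h; simp [swapOn, resample]
  · simp [swapOn, resample, h]

theorem resample_swapOn_singleton (i : ι) (x : (ι → ℝ) × (ι → ℝ)) :
    resample i (swapOn {i} x) = x.1 := by
  ext j
  by_cases h : j = i
  · subst h; simp [swapOn, resample]
  · simp [swapOn, resample, h]

theorem measurePreserving_resample (i : ι) :
    MeasurePreserving (resample i) ((iidLaw ι p).prod (iidLaw ι p)) (iidLaw ι p) := by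
  have h := (measurePreserving_fst (μ := iidLaw ι p) (ν := iidLaw ι p)).comp
    (measurePreserving_swapOn p {i})
  convert h using 1
  ext x : 1
  exact (swapOn_singleton_fst i x).symm

theorem integrable_of_bounded {Ω E : Type*} [MeasurableSpace Ω] [NormedAddCommGroup E]
    {μ : Measure Ω} [IsFiniteMeasure μ] {f : Ω → E} (hf : AEStronglyMeasurable f μ) {C : ℝ}
    (hC : ∀ x, ‖f x‖ ≤ C) : Integrable f μ :=
  Integrable.of_bound hf C (Eventually.of_forall hC)

theorem MeasureTheory.MeasurePreserving.integral_comp_aestronglyMeasurable {α β E : Type*}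
    [MeasurableSpace α] [MeasurableSpace β] [NormedAddCommGroup E] [NormedSpace ℝ E]
    {μ : Measure α} {ν : Measure β} {T : α → β} (hT : MeasurePreserving T μ ν) {f : β → E}
    (hf : AEStronglyMeasurable f ν) : ∫ x, f (T x) ∂μ = ∫ y, f y ∂ν := by
  rw [← hT.map_eq, integral_map hT.aemeasurable (by rwa [hT.map_eq])]

/-- A function of coordinate `i` is independent of a function that ignores coordinate `i`. -/
theorem integral_coord_mul (i : ι) {g : ℝ → ℂ} (hg : Measurable g) {F : (ι → ℝ) → ℂ}
    (hF : Measurable F) (hFi : ∀ z u, F (Function.update z i u) = F z) :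
    ∫ z, g (z i) * F z ∂(iidLaw ι p) = (∫ x, g x ∂p) * ∫ z, F z ∂(iidLaw ι p) := by
  have hm : Measurable fun z : ι → ℝ => g (z i) * F z :=
    (hg.comp (measurable_pi_apply i)).mul hF
  -- Resampling coordinate i makes the first factor a function of the second component and leaves
  -- the other a function of the first, so the integral over the product space factors.
  rw [← (measurePreserving_resample p i).integral_comp_aestronglyMeasurable
    hm.aestronglyMeasurable]
  simp only [resample, Function.update_self, hFi]
  rw [← (measurePreserving_eval (fun _ : ι => p) i).integral_comp_aestronglyMeasurable
    hg.aestronglyMeasurable, mul_comm, ← integral_prod_mul]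
  exact integral_congr_ae (Eventually.of_forall fun x => mul_comm _ _)

variable {f : (ι → ℝ) → ℝ} {C : ℝ}

theorem measurable_resample (i : ι) : Measurable (resample (ι := ι) i) := by
  refine measurable_pi_iff.2 fun j => ?_
  by_cases h : j = i
  · subst h; simp only [resample, Function.update_self]; fun_prop
  · simp only [resample, Function.update_of_ne h]; fun_prop

theorem measurable_swapOn (T : Finset ι) : Measurable (swapOn (ι := ι) T) := by
  refine Measurable.prodMk ?_ ?_ <;> refine measurable_pi_iff.2 fun j => ?_ <;>
    split_ifs <;> fun_prop

/-- The correlation of `f` with its value after the coordinates in `S` are resampled. -/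
theorem efronStein_telescope (hf : Measurable f) (hC : ∀ z, |f z| ≤ C) (S : Finset ι) {i : ι}
    (hi : i ∉ S) :
    ∫ x, f x.1 * f (swapOn S x).1 ∂((iidLaw ι p).prod (iidLaw ι p)) -
      ∫ x, f x.1 * f (swapOn (insert i S) x).1 ∂((iidLaw ι p).prod (iidLaw ι p)) ≤
    2⁻¹ * ∫ x, (f x.1 - f (resample i x)) ^ 2 ∂((iidLaw ι p).prod (iidLaw ι p)) := by
  set Q := (iidLaw ι p).prod (iidLaw ι p)
  have hsi := measurePreserving_swapOn p (ι := ι) {i}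
  have hsS := measurePreserving_swapOn p (ι := ι) S
  have hC0 : 0 ≤ C := (abs_nonneg _).trans (hC 0)
  have hb : ∀ a b, ‖f a * f b‖ ≤ C * C := fun a b => by
    rw [norm_mul]; exact mul_le_mul (hC a) (hC b) (norm_nonneg _) hC0
  have mT : ∀ T : Finset ι, Measurable fun x : (ι → ℝ) × (ι → ℝ) => f (swapOn T x).1 :=
    fun T => hf.comp (measurable_fst.comp (measurable_swapOn T))
  have m1 : Measurable fun x : (ι → ℝ) × (ι → ℝ) => f x.1 := hf.comp measurable_fst
  have mr : Measurable fun x : (ι → ℝ) × (ι → ℝ) => f (resample i x) :=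
    hf.comp (measurable_resample i)
  have e1 : ∀ x : (ι → ℝ) × (ι → ℝ), (swapOn S (swapOn {i} x)).1 = (swapOn (insert i S) x).1 := by
    intro x; ext j
    by_cases h : j = i
    · subst h; simp [swapOn, hi]
    · simp [swapOn, h]
  have e2 : ∀ x : (ι → ℝ) × (ι → ℝ), (swapOn (insert i S) (swapOn {i} x)).1 = (swapOn S x).1 := by
    intro x; ext j
    by_cases h : j = i
    · subst h; simp [swapOn, hi]
    · simp [swapOn, h]
  have e3 : ∀ x : (ι → ℝ) × (ι → ℝ), resample i (swapOn S x) = (swapOn (insert i S) x).1 := by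
    intro x; ext j
    by_cases h : j = i
    · subst h; simp [swapOn, resample, hi]
    · simp [swapOn, resample, h]
  -- Exchanging coordinate i preserves the law. It identifies the four correlations between {x, x
  -- resampled at i} and {x swapped on S, x swapped on S ∪ {i}} in pairs.
  have I1 : ∫ x, f (resample i x) * f (swapOn (insert i S) x).1 ∂Q =
      ∫ x, f x.1 * f (swapOn S x).1 ∂Q := by
    rw [← hsi.integral_comp_aestronglyMeasurable (f := fun x => f x.1 * f (swapOn S x).1)
      (m1.mul (mT S)).aestronglyMeasurable]
    simp only [e1, swapOn_singleton_fst, Q]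
  have I2 : ∫ x, f (resample i x) * f (swapOn S x).1 ∂Q =
      ∫ x, f x.1 * f (swapOn (insert i S) x).1 ∂Q := by
    rw [← hsi.integral_comp_aestronglyMeasurable
      (f := fun x => f x.1 * f (swapOn (insert i S) x).1)
      (m1.mul (mT (insert i S))).aestronglyMeasurable]
    simp only [e2, swapOn_singleton_fst, Q]
  have I3 : ∫ x, (f (swapOn S x).1 - f (swapOn (insert i S) x).1) ^ 2 ∂Q =
      ∫ x, (f x.1 - f (resample i x)) ^ 2 ∂Q := by
    rw [← hsS.integral_comp_aestronglyMeasurable (f := fun x => (f x.1 - f (resample i x)) ^ 2)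
      ((m1.sub mr).pow_const 2).aestronglyMeasurable]
    simp only [e3, Q]
  have int : ∀ {a b : (ι → ℝ) × (ι → ℝ) → ℝ}, Measurable a → Measurable b →
      (∀ x, |a x| ≤ C) → (∀ x, |b x| ≤ C) → Integrable (fun x => a x * b x) Q := by
    intro a b ha hb' ha' hb''
    refine integrable_of_bounded (ha.mul hb').aestronglyMeasurable (C := C * C) fun x => ?_
    rw [norm_mul]; exact mul_le_mul (ha' x) (hb'' x) (norm_nonneg _) hC0
  have intsq : ∀ {a b : (ι → ℝ) × (ι → ℝ) → ℝ}, Measurable a → Measurable b →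
      (∀ x, |a x| ≤ C) → (∀ x, |b x| ≤ C) → Integrable (fun x => (a x - b x) ^ 2) Q := by
    intro a b ha hb' ha' hb''
    have : (fun x => (a x - b x) ^ 2) = fun x => a x * a x - 2 * (a x * b x) + b x * b x := by
      ext x; ring
    rw [this]
    exact ((int ha ha ha' ha').sub ((int ha hb' ha' hb'').const_mul 2)).add (int hb' hb' hb'' hb'')
  have hc1 : ∀ x : (ι → ℝ) × (ι → ℝ), |f x.1| ≤ C := fun x => hC _
  have hcT : ∀ T : Finset ι, ∀ x : (ι → ℝ) × (ι → ℝ), |f (swapOn T x).1| ≤ C := fun T x => hC _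
  have hcr : ∀ x : (ι → ℝ) × (ι → ℝ), |f (resample i x)| ≤ C := fun x => hC _
  -- This is ab ≤ (a² + b²)/2 for the increments a, b of f at coordinate i before and after the swap
  -- on S. By `I1` and `I2` the mean of ab is twice the left side of the claim; by `I3` a² and b²
  -- have the same mean.
  have key : ∫ x, (2⁻¹ * ((f x.1 - f (resample i x)) ^ 2 +
        (f (swapOn S x).1 - f (swapOn (insert i S) x).1) ^ 2)
      - (f x.1 * f (swapOn S x).1 - f x.1 * f (swapOn (insert i S) x).1 -
        f (resample i x) * f (swapOn S x).1 + f (resample i x) * f (swapOn (insert i S) x).1)) ∂Q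
      ≥ 0 := by
    refine integral_nonneg fun x => ?_
    dsimp only [Pi.zero_apply]
    nlinarith [sq_nonneg ((f x.1 - f (resample i x)) -
      (f (swapOn S x).1 - f (swapOn (insert i S) x).1))]
  have J1 := int m1 (mT S) hc1 (hcT S)
  have J2 := int m1 (mT (insert i S)) hc1 (hcT _)
  have J3 := int mr (mT S) hcr (hcT _)
  have J4 := int mr (mT (insert i S)) hcr (hcT _)
  have K1 := intsq m1 mr hc1 hcr
  have K2 := intsq (mT S) (mT (insert i S)) (hcT _) (hcT _)
  have K12 : Integrable (fun x => (f x.1 - f (resample i x)) ^ 2 +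
      (f (swapOn S x).1 - f (swapOn (insert i S) x).1) ^ 2) Q := K1.add K2
  have J12 : Integrable (fun x => f x.1 * f (swapOn S x).1 -
      f x.1 * f (swapOn (insert i S) x).1) Q := J1.sub J2
  have J123 : Integrable (fun x => f x.1 * f (swapOn S x).1 -
      f x.1 * f (swapOn (insert i S) x).1 - f (resample i x) * f (swapOn S x).1) Q := J12.sub J3
  have J1234 : Integrable (fun x => f x.1 * f (swapOn S x).1 -
      f x.1 * f (swapOn (insert i S) x).1 - f (resample i x) * f (swapOn S x).1 +
      f (resample i x) * f (swapOn (insert i S) x).1) Q := J123.add J4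
  rw [integral_sub (K12.const_mul _) J1234, integral_const_mul, integral_add K1 K2, I3,
    integral_add J123 J4, integral_sub J12 J3, integral_sub J1 J2, I1, I2] at key
  linarith

/-- The Efron–Stein inequality. -/
theorem efronStein (hf : Measurable f) (hC : ∀ z, |f z| ≤ C) :
    ∫ z, f z ^ 2 ∂(iidLaw ι p) - (∫ z, f z ∂(iidLaw ι p)) ^ 2 ≤
      2⁻¹ * ∑ i, ∫ x, (f x.1 - f (resample i x)) ^ 2 ∂((iidLaw ι p).prod (iidLaw ι p)) := by
  -- The correlation interpolates between E f² at S = ∅ and (E f)² at S = univ, and each new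
  -- coordinate costs one term of the sum.
  have key : ∀ S : Finset ι, ∫ z, f z ^ 2 ∂(iidLaw ι p) -
      ∫ x, f x.1 * f (swapOn S x).1 ∂((iidLaw ι p).prod (iidLaw ι p)) ≤
      2⁻¹ * ∑ i ∈ S, ∫ x, (f x.1 - f (resample i x)) ^ 2 ∂((iidLaw ι p).prod (iidLaw ι p)) := by
    intro S
    induction S using Finset.induction_on with
    | empty =>
      have : ∫ x, f x.1 * f (swapOn ∅ x).1 ∂((iidLaw ι p).prod (iidLaw ι p)) =
          ∫ z, f z ^ 2 ∂(iidLaw ι p) := by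
        rw [← (measurePreserving_fst (μ := iidLaw ι p)
          (ν := iidLaw ι p)).integral_comp_aestronglyMeasurable
          (hf.pow_const 2).aestronglyMeasurable]
        simp [swapOn, sq]
      simp [this]
    | insert i S hi ih =>
      rw [Finset.sum_insert hi, mul_add]
      linarith [efronStein_telescope p hf hC S hi]
  have h := key Finset.univ
  have e : ∫ x, f x.1 * f (swapOn Finset.univ x).1 ∂((iidLaw ι p).prod (iidLaw ι p)) =
      (∫ z, f z ∂(iidLaw ι p)) ^ 2 := by
    rw [sq, ← integral_prod_mul]
    simp [swapOn]
  rwa [e] at h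

/-- A fourth moment version of the Efron–Stein inequality. -/
theorem efronStein_four (hf : Measurable f) (hC : ∀ z, |f z| ≤ C) :
    ∫ z, (f z - ∫ z, f z ∂(iidLaw ι p)) ^ 4 ∂(iidLaw ι p) ≤
      (9 / 2) * ∫ x, (∑ i, (f x.1 - f (resample i x)) ^ 2) ^ 2
        ∂((iidLaw ι p).prod (iidLaw ι p)) := by
  set Q := (iidLaw ι p).prod (iidLaw ι p) with hQ
  set c := ∫ z, f z ∂(iidLaw ι p) with hc
  have hC0 : 0 ≤ C := (abs_nonneg _).trans (hC 0)
  have m1 : Measurable fun x : (ι → ℝ) × (ι → ℝ) => f x.1 := hf.comp measurable_fst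
  have mr : ∀ i, Measurable fun x : (ι → ℝ) × (ι → ℝ) => f (resample i x) :=
    fun i => hf.comp (measurable_resample i)
  have mh : Measurable fun z => f z - c := hf.sub_const c
  have hh : ∀ z, |f z - c| ≤ C + |c| := fun z => (abs_sub _ _).trans (by gcongr; exact hC z)
  set D := C + |c| with hD
  have hD0 : 0 ≤ D := by positivity
  have hh2 : ∀ z, |(f z - c) ^ 2| ≤ D ^ 2 := fun z => by
    rw [abs_pow]; exact pow_le_pow_left₀ (abs_nonneg _) (hh z) 2
  have hΔ : ∀ i (x : (ι → ℝ) × (ι → ℝ)), |f x.1 - f (resample i x)| ≤ 2 * C := fun i x =>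
    (abs_sub _ _).trans (by linarith [hC x.1, hC (resample i x)])
  have iint : Integrable f (iidLaw ι p) := integrable_of_bounded hf.aestronglyMeasurable hC
  have es2 := efronStein p hf hC
  -- The second order inequality is used twice: for f, and for h² with h = f - E f.
  have es4 := efronStein p (mh.pow_const 2) hh2
  have var_eq : ∫ z, (f z - c) ^ 2 ∂(iidLaw ι p) = ∫ z, f z ^ 2 ∂(iidLaw ι p) - c ^ 2 := by
    have : ∀ z, (f z - c) ^ 2 = f z ^ 2 - 2 * c * f z + c ^ 2 := fun z => by ring
    have i2 : Integrable (fun z => f z ^ 2) (iidLaw ι p) :=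
      integrable_of_bounded (hf.pow_const 2).aestronglyMeasurable (C := C ^ 2) fun z => by
        rw [norm_pow]; exact pow_le_pow_left₀ (norm_nonneg _) (hC z) 2
    simp_rw [this]
    have i3 : Integrable (fun z => f z ^ 2 - 2 * c * f z) (iidLaw ι p) :=
      i2.sub (iint.const_mul _)
    rw [integral_add i3 (integrable_const _),
      integral_sub i2 (iint.const_mul _), integral_const_mul]
    simp only [integral_const, probReal_univ, smul_eq_mul, one_mul, ← hc]
    ring
  set V : (ι → ℝ) × (ι → ℝ) → ℝ := fun x => ∑ i, (f x.1 - f (resample i x)) ^ 2 with hV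
  have mV : Measurable V := by
    refine Finset.measurable_sum _ fun i _ => ((m1.sub (mr i)).pow_const 2)
  have hV0 : ∀ x, 0 ≤ V x := fun x => Finset.sum_nonneg fun i _ => sq_nonneg _
  have hVb : ∀ x, |V x| ≤ ∑ _i : ι, (2 * C) ^ 2 := fun x => by
    rw [abs_of_nonneg (hV0 x)]
    refine Finset.sum_le_sum fun i _ => ?_
    rw [← sq_abs]; exact pow_le_pow_left₀ (abs_nonneg _) (hΔ i x) 2
  set K := ∑ _i : ι, (2 * C) ^ 2 with hK
  have hK0 : 0 ≤ K := by positivity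
  have iV : Integrable V Q := integrable_of_bounded mV.aestronglyMeasurable hVb
  have iV2 : Integrable (fun x => V x ^ 2) Q :=
    integrable_of_bounded (mV.pow_const 2).aestronglyMeasurable (C := K ^ 2) fun x => by
      rw [norm_pow]; exact pow_le_pow_left₀ (norm_nonneg _) (hVb x) 2
  have iΔ : ∀ i, Integrable (fun x : (ι → ℝ) × (ι → ℝ) => (f x.1 - f (resample i x)) ^ 2) Q :=
    fun i => integrable_of_bounded ((m1.sub (mr i)).pow_const 2).aestronglyMeasurable
      (C := (2 * C) ^ 2) fun x => by
        rw [norm_pow]; exact pow_le_pow_left₀ (norm_nonneg _) (hΔ i x) 2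
  have iΔh : ∀ i, ∀ g : (ι → ℝ) × (ι → ℝ) → ι → ℝ, Measurable g →
      Integrable (fun x => (f x.1 - f (resample i x)) ^ 2 * (f (g x) - c) ^ 2) Q := fun i g hg => by
    refine integrable_of_bounded (((m1.sub (mr i)).pow_const 2).mul
      ((mh.comp hg).pow_const 2)).aestronglyMeasurable (C := (2 * C) ^ 2 * D ^ 2) fun x => ?_
    rw [norm_mul, norm_pow, norm_pow]
    exact mul_le_mul (pow_le_pow_left₀ (norm_nonneg _) (hΔ i x) 2)
      (pow_le_pow_left₀ (norm_nonneg _) (hh _) 2) (by positivity) (by positivity)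
  -- Exchanging coordinate i turns the resampled value into the original one and leaves the squared
  -- increment unchanged.
  have sym : ∀ i, ∫ x, (f x.1 - f (resample i x)) ^ 2 * (f (resample i x) - c) ^ 2 ∂Q =
      ∫ x, (f x.1 - f (resample i x)) ^ 2 * (f x.1 - c) ^ 2 ∂Q := fun i => by
    rw [← (measurePreserving_swapOn p {i}).integral_comp_aestronglyMeasurable
      (iΔh i Prod.fst measurable_fst).aestronglyMeasurable]
    simp only [resample_swapOn_singleton, swapOn_singleton_fst]
    refine integral_congr_ae (Eventually.of_forall fun x => ?_)
    dsimp only; ring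
  have step : ∀ i, ∫ x, ((f x.1 - c) ^ 2 - (f (resample i x) - c) ^ 2) ^ 2 ∂Q ≤
      4 * ∫ x, (f x.1 - f (resample i x)) ^ 2 * (f x.1 - c) ^ 2 ∂Q := fun i => by
    have := integral_mono_of_nonneg (μ := Q)
      (f := fun x => ((f x.1 - c) ^ 2 - (f (resample i x) - c) ^ 2) ^ 2)
      (g := fun x => 2 * ((f x.1 - f (resample i x)) ^ 2 * (f x.1 - c) ^ 2 +
        (f x.1 - f (resample i x)) ^ 2 * (f (resample i x) - c) ^ 2))
      (Eventually.of_forall fun x => sq_nonneg _)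
      (((iΔh i _ measurable_fst).add (iΔh i _ (measurable_resample i))).const_mul 2)
      (Eventually.of_forall fun x => by
        dsimp only
        have : ((f x.1 - c) ^ 2 - (f (resample i x) - c) ^ 2) ^ 2 =
          (f x.1 - f (resample i x)) ^ 2 * ((f x.1 - c) + (f (resample i x) - c)) ^ 2 := by ring
        rw [this]
        nlinarith [mul_nonneg (sq_nonneg (f x.1 - f (resample i x)))
          (sq_nonneg ((f x.1 - c) - (f (resample i x) - c)))])
    rw [integral_const_mul, integral_add (iΔh i _ measurable_fst)
      (iΔh i _ (measurable_resample i)), sym] at this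
    linarith
  have sumstep : ∑ i, ∫ x, (f x.1 - f (resample i x)) ^ 2 * (f x.1 - c) ^ 2 ∂Q =
      ∫ x, V x * (f x.1 - c) ^ 2 ∂Q := by
    rw [← integral_finsetSum _ fun i _ => iΔh i _ measurable_fst]
    simp only [hV, Finset.sum_mul]
  have i4 : Integrable (fun z => (f z - c) ^ 4) (iidLaw ι p) :=
    integrable_of_bounded (mh.pow_const 4).aestronglyMeasurable (C := D ^ 4) fun z => by
      rw [norm_pow]; exact pow_le_pow_left₀ (norm_nonneg _) (hh z) 4
  have mp := measurePreserving_fst (μ := iidLaw ι p) (ν := iidLaw ι p)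
  have i4' : Integrable (fun x : (ι → ℝ) × (ι → ℝ) => (f x.1 - c) ^ 4) Q :=
    mp.integrable_comp_of_integrable i4
  have E4 : ∫ x, (f x.1 - c) ^ 4 ∂Q = ∫ z, (f z - c) ^ 4 ∂(iidLaw ι p) :=
    mp.integral_comp_aestronglyMeasurable (f := fun z => (f z - c) ^ 4) i4.aestronglyMeasurable
  have young : ∫ x, V x * (f x.1 - c) ^ 2 ∂Q ≤
      ∫ x, V x ^ 2 ∂Q + 4⁻¹ * ∫ z, (f z - c) ^ 4 ∂(iidLaw ι p) := by
    rw [← E4, ← integral_const_mul, ← integral_add iV2 (i4'.const_mul _)]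
    refine integral_mono_of_nonneg (Eventually.of_forall fun x => ?_)
      (iV2.add (i4'.const_mul _)) (Eventually.of_forall fun x => ?_)
    · exact mul_nonneg (hV0 x) (sq_nonneg _)
    · dsimp only
      nlinarith [sq_nonneg (V x - 2⁻¹ * (f x.1 - c) ^ 2)]
  have EV : ∑ i, ∫ x, (f x.1 - f (resample i x)) ^ 2 ∂Q = ∫ x, V x ∂Q := by
    rw [← integral_finsetSum _ fun i _ => iΔ i]
  have EVsq : (∫ x, V x ∂Q) ^ 2 ≤ ∫ x, V x ^ 2 ∂Q := by
    have h0 : 0 ≤ ∫ x, (V x - ∫ y, V y ∂Q) ^ 2 ∂Q := integral_nonneg fun x => sq_nonneg _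
    have : ∀ x, (V x - ∫ y, V y ∂Q) ^ 2 =
        V x ^ 2 - 2 * (∫ y, V y ∂Q) * V x + (∫ y, V y ∂Q) ^ 2 := fun z => by ring
    simp_rw [this] at h0
    have i3 : Integrable (fun x => V x ^ 2 - 2 * (∫ y, V y ∂Q) * V x) Q :=
      iV2.sub (iV.const_mul _)
    rw [integral_add i3 (integrable_const _),
      integral_sub iV2 (iV.const_mul _), integral_const_mul] at h0
    simp only [integral_const, probReal_univ, smul_eq_mul, one_mul] at h0
    nlinarith
  rw [← var_eq, EV] at es2
  have pw : ∀ z, ((f z - c) ^ 2) ^ 2 = (f z - c) ^ 4 := fun z => by ring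
  simp_rw [pw] at es4
  have sum4 := Finset.sum_le_sum fun i (_ : i ∈ Finset.univ) => step i
  rw [← Finset.mul_sum, sumstep] at sum4
  have v0 : 0 ≤ ∫ z, (f z - c) ^ 2 ∂(iidLaw ι p) := integral_nonneg fun x => sq_nonneg _
  have : (∫ z, (f z - c) ^ 2 ∂(iidLaw ι p)) ^ 2 ≤ (2⁻¹ * ∫ x, V x ∂Q) ^ 2 :=
    pow_le_pow_left₀ v0 es2 2
  -- Altogether E h⁴ ≤ (E V/2)² + 2 E[V h²] ≤ E V²/4 + 2 E V² + E h⁴/2. Absorbing the last term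
  -- gives the factor 9/2.
  nlinarith

end

noncomputable section

open scoped Matrix.Norms.L2Operator

/-! ### Resolvents, Hilbert–Schmidt norms and traces -/

section Resolvent

variable {n : Type*} [Fintype n] [DecidableEq n]

/-- The squared Hilbert–Schmidt norm. -/
def hsSq (X : Matrix n n ℂ) : ℝ := ∑ i, ∑ j, ‖X i j‖ ^ 2

theorem hsSq_nonneg (X : Matrix n n ℂ) : 0 ≤ hsSq X := by unfold hsSq; positivity

theorem sum_sq_mulVec_le (X : Matrix n n ℂ) (v : n → ℂ) :
    ∑ i, ‖(X.mulVec v) i‖ ^ 2 ≤ ‖X‖ ^ 2 * ∑ i, ‖v i‖ ^ 2 := by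
  have h := X.l2_opNorm_mulVec (WithLp.toLp 2 v)
  have h2 := pow_le_pow_left₀ (norm_nonneg _) h 2
  rw [mul_pow, EuclideanSpace.norm_sq_eq, EuclideanSpace.norm_sq_eq] at h2
  exact h2

theorem hsSq_mul_le_left (X Y : Matrix n n ℂ) : hsSq (X * Y) ≤ ‖X‖ ^ 2 * hsSq Y := by
  unfold hsSq
  rw [Finset.sum_comm, Finset.sum_comm (f := fun i j => ‖Y i j‖ ^ 2), Finset.mul_sum]
  refine Finset.sum_le_sum fun j _ => ?_
  exact sum_sq_mulVec_le X fun i => Y i j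

theorem hsSq_conjTranspose (X : Matrix n n ℂ) : hsSq X.conjTranspose = hsSq X := by
  unfold hsSq
  rw [Finset.sum_comm]
  simp [Matrix.conjTranspose_apply]

theorem hsSq_mul_le_right (X Y : Matrix n n ℂ) : hsSq (X * Y) ≤ hsSq X * ‖Y‖ ^ 2 := by
  rw [← hsSq_conjTranspose, Matrix.conjTranspose_mul, mul_comm, ← hsSq_conjTranspose X,
    ← Matrix.l2_opNorm_conjTranspose Y]
  exact hsSq_mul_le_left _ _

theorem hsSq_one : hsSq (1 : Matrix n n ℂ) = Fintype.card n := by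
  simp [hsSq, Matrix.one_apply, apply_ite]

theorem hsSq_le (X : Matrix n n ℂ) : hsSq X ≤ Fintype.card n * ‖X‖ ^ 2 := by
  have := hsSq_mul_le_left X 1
  rwa [mul_one, hsSq_one, mul_comm] at this

theorem norm_trace_mul_sq_le (X Y : Matrix n n ℂ) :
    ‖(X * Y).trace‖ ^ 2 ≤ hsSq X * hsSq Y := by
  have h1 : ‖(X * Y).trace‖ ≤ ∑ x : n × n, ‖X x.1 x.2‖ * ‖Y x.2 x.1‖ := by
    rw [Fintype.sum_prod_type]
    simp only [Matrix.trace, Matrix.diag, Matrix.mul_apply]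
    refine (norm_sum_le _ _).trans (Finset.sum_le_sum fun i _ => ?_)
    refine (norm_sum_le _ _).trans (Finset.sum_le_sum fun j _ => ?_)
    rw [norm_mul]
  refine (pow_le_pow_left₀ (norm_nonneg _) h1 2).trans ?_
  refine (Finset.sum_mul_sq_le_sq_mul_sq _ _ _).trans (le_of_eq ?_)
  unfold hsSq
  rw [Finset.sum_comm (f := fun i j => ‖Y i j‖ ^ 2), Fintype.sum_prod_type, Fintype.sum_prod_type]

theorem norm_trace_le (X : Matrix n n ℂ) : ‖X.trace‖ ≤ Fintype.card n * ‖X‖ := by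
  have h := norm_trace_mul_sq_le X 1
  rw [mul_one, hsSq_one] at h
  have h2 : ‖X.trace‖ ^ 2 ≤ (Fintype.card n * ‖X‖) ^ 2 := by
    refine h.trans ?_
    rw [mul_pow, sq (Fintype.card n : ℝ)]
    nlinarith [hsSq_le X, Nat.cast_nonneg (α := ℝ) (Fintype.card n)]
  exact (sq_le_sq₀ (norm_nonneg _) (by positivity)).1 h2

theorem sum_norm_sq_col_le (X : Matrix n n ℂ) (j : n) : ∑ i, ‖X i j‖ ^ 2 ≤ ‖X‖ ^ 2 := by
  have h := sum_sq_mulVec_le X (Pi.single j 1)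
  have e : ∑ i, ‖(Pi.single j 1 : n → ℂ) i‖ ^ 2 = 1 := by
    simp [Pi.single_apply, apply_ite]
  rw [e, mul_one] at h
  simpa [Matrix.mulVec_single_one, Matrix.col] using h

theorem norm_entry_le (X : Matrix n n ℂ) (i j : n) : ‖X i j‖ ≤ ‖X‖ := by
  have h := sum_norm_sq_col_le X j
  have h2 := Finset.single_le_sum (f := fun i => ‖X i j‖ ^ 2) (fun _ _ => by positivity)
    (Finset.mem_univ i)
  exact (sq_le_sq₀ (norm_nonneg _) (norm_nonneg _)).1 (h2.trans h)

/-- The resolvent of a real matrix. -/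
def resol (M : Matrix n n ℝ) (z : ℂ) : Matrix n n ℂ := (M.map Complex.ofReal - z • 1)⁻¹

/-- The normalized trace of the resolvent. -/
def normTrResol (M : Matrix n n ℝ) (z : ℂ) : ℂ := (Fintype.card n : ℂ)⁻¹ * (resol M z).trace

variable {M M' : Matrix n n ℝ} {z w : ℂ}

theorem ofReal_sub_ne_zero (x : ℝ) (hz : z.im ≠ 0) : (x : ℂ) - z ≠ 0 := by
  intro h
  apply hz
  have := congrArg Complex.im h
  simpa using this

/-- The real spectral theorem, pushed to ℂ entrywise. The real eigenvalues are kept because the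
spectral measures are defined with them. -/
theorem exists_unitary_diagonalization (hM : M.IsHermitian) :
    ∃ U ∈ unitary (Matrix n n ℂ), M.map Complex.ofReal =
      U * Matrix.diagonal (fun i => (hM.eigenvalues i : ℂ)) * star U := by
  set V := hM.eigenvectorUnitary with hV
  refine ⟨Complex.ofRealHom.mapMatrix (V : Matrix n n ℝ), ?_, ?_⟩
  · have h1 : star (Complex.ofRealHom.mapMatrix (V : Matrix n n ℝ)) =
        Complex.ofRealHom.mapMatrix (star (V : Matrix n n ℝ)) := by
      ext i j; simp [Matrix.star_apply]
    rw [Unitary.mem_iff, h1, ← map_mul, ← map_mul]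
    simp
  · have h1 : star (Complex.ofRealHom.mapMatrix (V : Matrix n n ℝ)) =
        Complex.ofRealHom.mapMatrix (star (V : Matrix n n ℝ)) := by
      ext i j; simp [Matrix.star_apply]
    have h2 : Matrix.diagonal (fun i => (hM.eigenvalues i : ℂ)) =
        Complex.ofRealHom.mapMatrix (Matrix.diagonal hM.eigenvalues) := by
      ext i j; by_cases h : i = j <;> simp [h]
    rw [h1, h2, ← map_mul, ← map_mul]
    have := hM.spectral_theorem
    rw [Unitary.conjStarAlgAut_apply] at this
    change Complex.ofRealHom.mapMatrix M = _
    congr 1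

theorem exists_resol_diagonalization (hM : M.IsHermitian) (hz : z.im ≠ 0) :
    ∃ U ∈ unitary (Matrix n n ℂ), resol M z =
      U * Matrix.diagonal (fun i => ((hM.eigenvalues i : ℂ) - z)⁻¹) * star U ∧
      (M.map Complex.ofReal - z • 1) * resol M z = 1 := by
  obtain ⟨U, hU, hd⟩ := exists_unitary_diagonalization hM
  obtain ⟨hU1, hU2⟩ := Unitary.mem_iff.1 hU
  have h1 : M.map Complex.ofReal - z • 1 =
      U * Matrix.diagonal (fun i => (hM.eigenvalues i : ℂ) - z) * star U := by
    have : Matrix.diagonal (fun i => (hM.eigenvalues i : ℂ) - z) =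
        Matrix.diagonal (fun i => (hM.eigenvalues i : ℂ)) - z • 1 := by
      ext i j; by_cases h : i = j <;> simp [h]
    rw [this, hd, mul_sub, sub_mul, mul_smul_comm, mul_one, smul_mul_assoc, hU2]
  have h2 : (M.map Complex.ofReal - z • 1) *
      (U * Matrix.diagonal (fun i => ((hM.eigenvalues i : ℂ) - z)⁻¹) * star U) = 1 := by
    rw [h1]
    calc _ = U * (Matrix.diagonal (fun i => (hM.eigenvalues i : ℂ) - z) * (star U * U) *
          Matrix.diagonal (fun i => ((hM.eigenvalues i : ℂ) - z)⁻¹)) * star U := by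
          simp only [mul_assoc]
      _ = 1 := by
          rw [hU1, mul_one, Matrix.diagonal_mul_diagonal]
          have : (fun i => ((hM.eigenvalues i : ℂ) - z) * ((hM.eigenvalues i : ℂ) - z)⁻¹) =
              fun _ => 1 := by
            ext i; exact mul_inv_cancel₀ (ofReal_sub_ne_zero _ hz)
          rw [this, Matrix.diagonal_one, mul_one, hU2]
  have h3 : resol M z = U * Matrix.diagonal (fun i => ((hM.eigenvalues i : ℂ) - z)⁻¹) * star U :=
    Matrix.inv_eq_right_inv h2
  exact ⟨U, hU, h3, by rw [h3, h2]⟩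

theorem mul_resol (hM : M.IsHermitian) (hz : z.im ≠ 0) :
    (M.map Complex.ofReal - z • 1) * resol M z = 1 :=
  (exists_resol_diagonalization hM hz).choose_spec.2.2

theorem resol_mul (hM : M.IsHermitian) (hz : z.im ≠ 0) :
    resol M z * (M.map Complex.ofReal - z • 1) = 1 :=
  mul_eq_one_comm.1 (mul_resol hM hz)

theorem norm_inv_ofReal_sub_le (x : ℝ) (hz : z.im ≠ 0) : ‖((x : ℂ) - z)⁻¹‖ ≤ |z.im|⁻¹ := by
  rw [norm_inv]
  refine inv_anti₀ (abs_pos.2 hz) ?_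
  have := Complex.abs_im_le_norm ((x : ℂ) - z)
  simpa using this

theorem norm_resol_le (hM : M.IsHermitian) (hz : z.im ≠ 0) : ‖resol M z‖ ≤ |z.im|⁻¹ := by
  obtain ⟨U, hU, h, -⟩ := exists_resol_diagonalization hM hz
  rw [h, CStarRing.norm_mul_mem_unitary _ (Unitary.star_mem hU),
    CStarRing.norm_mem_unitary_mul _ hU, Matrix.l2_opNorm_diagonal]
  exact (pi_norm_le_iff_of_nonneg (by positivity)).2 fun i => norm_inv_ofReal_sub_le _ hz

theorem trace_resol (hM : M.IsHermitian) (hz : z.im ≠ 0) :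
    (resol M z).trace = ∑ i, ((hM.eigenvalues i : ℂ) - z)⁻¹ := by
  obtain ⟨U, hU, h, -⟩ := exists_resol_diagonalization hM hz
  rw [h, Matrix.trace_mul_cycle, (Unitary.mem_iff.1 hU).1, one_mul, Matrix.trace_diagonal]

/-- The resolvent identity. -/
theorem resol_sub_resol (hM : M.IsHermitian) (hM' : M'.IsHermitian) (hz : z.im ≠ 0)
    (hw : w.im ≠ 0) :
    resol M z - resol M' w =
      resol M z * ((M' - M).map Complex.ofReal + (z - w) • 1) * resol M' w := by
  have e : (M' - M).map Complex.ofReal + (z - w) • 1 =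
      (M'.map Complex.ofReal - w • 1) - (M.map Complex.ofReal - z • (1 : Matrix n n ℂ)) := by
    ext i j; simp [sub_mul]; ring
  rw [e, mul_sub, resol_mul hM hz, sub_mul, mul_assoc, mul_resol hM' hw, mul_one, one_mul]

theorem norm_normTrResol_le (hM : M.IsHermitian) (hz : z.im ≠ 0) :
    ‖normTrResol M z‖ ≤ |z.im|⁻¹ := by
  unfold normTrResol
  rw [norm_mul, norm_inv, Complex.norm_natCast]
  rcases Nat.eq_zero_or_pos (Fintype.card n) with h | h
  · simp [h]
  · rw [inv_mul_le_iff₀ (by exact_mod_cast h)]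
    exact (norm_trace_le _).trans (by gcongr; exact norm_resol_le hM hz)

theorem continuous_resol {X : Type*} [TopologicalSpace X] {M : X → Matrix n n ℝ}
    (hM : Continuous M) (hH : ∀ x, (M x).IsHermitian) (hz : z.im ≠ 0) :
    Continuous fun x => resol (M x) z := by
  have hc : Continuous fun x => (M x).map Complex.ofReal - z • (1 : Matrix n n ℂ) :=
    (hM.matrix_map Complex.continuous_ofReal).sub continuous_const
  have hd : ∀ x, ((M x).map Complex.ofReal - z • (1 : Matrix n n ℂ)).det ≠ 0 := fun x h => by
    have := congrArg Matrix.det (mul_resol (hH x) hz)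
    rw [Matrix.det_mul, h, zero_mul, Matrix.det_one] at this
    exact zero_ne_one this
  unfold resol
  -- Cramer's rule writes the inverse as the adjugate over a nonvanishing determinant, and both are
  -- continuous.
  simp only [Matrix.inv_def, Ring.inverse_eq_inv']
  exact (hc.matrix_det.inv₀ hd).smul hc.matrix_adjugate

theorem continuous_normTrResol {X : Type*} [TopologicalSpace X] {M : X → Matrix n n ℝ}
    (hM : Continuous M) (hH : ∀ x, (M x).IsHermitian) (hz : z.im ≠ 0) :
    Continuous fun x => normTrResol (M x) z :=
  continuous_const.mul (continuous_resol hM hH hz).matrix_trace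

end Resolvent

/-! ### Concentration for linear pencils with independent coefficients -/

section Concentration

variable {ι : Type*} [Fintype ι] [DecidableEq ι] {n : Type*} [Fintype n] [DecidableEq n]

/-- The real symmetric matrix depending linearly on `z` with coefficient matrices `E`. -/
def pencil (E : ι → Matrix n n ℝ) (z : ι → ℝ) : Matrix n n ℝ := ∑ i, z i • E i

variable {E : ι → Matrix n n ℝ}

theorem pencil_isHermitian (hE : ∀ i, (E i).IsHermitian) (z : ι → ℝ) :
    (pencil E z).IsHermitian := by
  unfold pencil Matrix.IsHermitian
  rw [Matrix.conjTranspose_sum]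
  refine Finset.sum_congr rfl fun i _ => ?_
  rw [Matrix.conjTranspose_smul, (hE i).eq, star_trivial]

theorem pencil_update (z : ι → ℝ) (i : ι) (u : ℝ) :
    pencil E (Function.update z i u) = pencil E z - (z i - u) • E i := by
  unfold pencil
  rw [← Finset.add_sum_erase _ _ (Finset.mem_univ i),
    ← Finset.add_sum_erase _ (fun j => z j • E j) (Finset.mem_univ i), Function.update_self]
  have : ∑ j ∈ Finset.univ.erase i, Function.update z i u j • E j =
      ∑ j ∈ Finset.univ.erase i, z j • E j := Finset.sum_congr rfl fun j hj => by
    rw [Function.update_of_ne (Finset.ne_of_mem_erase hj)]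
  rw [this, sub_smul]
  abel

theorem continuous_pencil : Continuous (pencil E) := by
  unfold pencil
  fun_prop

theorem resol_pencil_update (hE : ∀ i, (E i).IsHermitian) {w : ℂ} (hw : w.im ≠ 0) (z : ι → ℝ)
    (i : ι) (u : ℝ) :
    resol (pencil E (Function.update z i u)) w = resol (pencil E z) w +
      ((z i - u : ℝ) : ℂ) • (resol (pencil E (Function.update z i u)) w *
        (E i).map Complex.ofReal * resol (pencil E z) w) := by
  have h := resol_sub_resol (pencil_isHermitian hE (Function.update z i u))
    (pencil_isHermitian hE z) hw hw
  have e : pencil E z - pencil E (Function.update z i u) = (z i - u) • E i := by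
    rw [pencil_update]; abel
  have e2 : ((z i - u) • E i).map Complex.ofReal =
      ((z i - u : ℝ) : ℂ) • (E i).map Complex.ofReal := by
    ext a b; simp
  rw [e, e2, sub_self, zero_smul, add_zero, mul_smul_comm, smul_mul_assoc] at h
  rw [← h]; abel

/-- The resolvent identity is substituted into itself once. The linear term then involves the same
matrix G² for every i, so the sum of its squares over i is controlled by a single Bessel-type bound
(the constant c₁ below). The updated resolvent, which depends on i, survives only in the quadratic
remainder, where Cauchy–Schwarz gives the squares of `hsSq` (the constant c₂). -/
theorem normTrResol_pencil_update_sub (hE : ∀ i, (E i).IsHermitian) {w : ℂ} (hw : w.im ≠ 0)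
    (z : ι → ℝ) (i : ι) (u : ℝ) :
    normTrResol (pencil E z) w - normTrResol (pencil E (Function.update z i u)) w =
      -((Fintype.card n : ℂ)⁻¹ * ((z i - u : ℝ) : ℂ) *
        (((E i).map Complex.ofReal * (resol (pencil E z) w * resol (pencil E z) w)).trace +
        ((z i - u : ℝ) : ℂ) * ((E i).map Complex.ofReal *
          (resol (pencil E z) w * resol (pencil E (Function.update z i u)) w *
            (E i).map Complex.ofReal * resol (pencil E z) w)).trace)) := by
  have h := resol_pencil_update hE hw z i u
  set G := resol (pencil E z) w
  set G' := resol (pencil E (Function.update z i u)) w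
  set F := (E i).map Complex.ofReal
  set d := ((z i - u : ℝ) : ℂ)
  have h1 : G'.trace = G.trace + d * (F * (G * G)).trace + 
      d * (d * (F * (G * G' * F * G)).trace) := by
    have e1 : (G' * F * G).trace = (F * (G * G')).trace := by
      rw [mul_assoc, Matrix.trace_mul_comm, mul_assoc]
    have e2 : (F * (G * G')).trace = (F * (G * G)).trace + 
          d * (F * (G * G' * F * G)).trace := by
      conv_lhs => rw [h]
      rw [mul_add, mul_add, Matrix.trace_add, mul_smul_comm, mul_smul_comm, Matrix.trace_smul,
        smul_eq_mul]
      simp only [mul_assoc]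
    conv_lhs => rw [h]
    rw [Matrix.trace_add, Matrix.trace_smul, smul_eq_mul, e1, e2]
    ring
  simp only [normTrResol]
  rw [h1]
  ring

/-- Resampling single coordinates changes the normalized trace of the resolvent little. -/
theorem sum_sq_normTrResol_sub_le (hE : ∀ i, (E i).IsHermitian) {w : ℂ} (hw : w.im ≠ 0)
    {c₁ c₂ : ℝ} (hc₁ : ∀ X : Matrix n n ℂ,
      ∑ i, ‖((E i).map Complex.ofReal * X).trace‖ ^ 2 ≤ c₁ * hsSq X) (hc₁0 : 0 ≤ c₁)
    (hc₂ : ∑ i, hsSq ((E i).map Complex.ofReal) ^ 2 ≤ c₂ * Fintype.card n)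
    (z u : ι → ℝ) {Y : ℝ} (hY2 : ∀ i, (z i - u i) ^ 2 ≤ Y) (hY4 : ∀ i, (z i - u i) ^ 4 ≤ Y)
    (hY0 : 0 ≤ Y) :
    ∑ i, ‖normTrResol (pencil E z) w -
      normTrResol (pencil E (Function.update z i (u i))) w‖ ^ 2 ≤
      2 * (c₁ * |w.im|⁻¹ ^ 4 + c₂ * |w.im|⁻¹ ^ 6) * (Fintype.card n : ℝ)⁻¹ * Y := by
  set N := (Fintype.card n : ℝ) with hN
  set η := |w.im|⁻¹ with hη
  have hη0 : 0 ≤ η := by positivity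
  set G := resol (pencil E z) w with hG
  have hGn : ‖G‖ ≤ η := norm_resol_le (pencil_isHermitian hE z) hw
  have hGG : ‖G * G‖ ≤ η ^ 2 := by
    rw [sq]; exact (norm_mul_le _ _).trans (mul_le_mul hGn hGn (norm_nonneg _) hη0)
  have term : ∀ i, ‖normTrResol (pencil E z) w -
      normTrResol (pencil E (Function.update z i (u i))) w‖ ^ 2 ≤
      2 * N⁻¹ ^ 2 * Y * (‖((E i).map Complex.ofReal * (G * G)).trace‖ ^ 2 +
        η ^ 6 * hsSq ((E i).map Complex.ofReal) ^ 2) := by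
    intro i
    rw [normTrResol_pencil_update_sub hE hw, norm_neg, norm_mul, norm_mul, norm_inv,
      Complex.norm_natCast, Complex.norm_real]
    set G' := resol (pencil E (Function.update z i (u i))) w
    set F := (E i).map Complex.ofReal
    have hG'n : ‖G'‖ ≤ η := norm_resol_le (pencil_isHermitian hE _) hw
    set a := (F * (G * G)).trace
    set b := (F * (G * G' * F * G)).trace with hb
    have hb2 : ‖b‖ ^ 2 ≤ η ^ 6 * hsSq F ^ 2 := by
      have hGG' : ‖G * G'‖ ≤ η ^ 2 := by
        rw [sq]; exact (norm_mul_le _ _).trans (mul_le_mul hGn hG'n (norm_nonneg _) hη0)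
      calc ‖b‖ ^ 2 ≤ hsSq F * hsSq (G * G' * F * G) := norm_trace_mul_sq_le _ _
        _ ≤ hsSq F * (((η ^ 2) ^ 2 * hsSq F) * η ^ 2) := by
          refine mul_le_mul_of_nonneg_left ?_ (hsSq_nonneg _)
          refine (hsSq_mul_le_right _ _).trans ?_
          refine mul_le_mul ?_ (pow_le_pow_left₀ (norm_nonneg _) hGn 2) (by positivity)
            (mul_nonneg (by positivity) (hsSq_nonneg _))
          exact (hsSq_mul_le_left _ _).trans (mul_le_mul_of_nonneg_right
            (pow_le_pow_left₀ (norm_nonneg _) hGG' 2) (hsSq_nonneg _))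
        _ = η ^ 6 * hsSq F ^ 2 := by ring
    set d := z i - u i
    have hsum : ‖a + (d : ℂ) * b‖ ^ 2 ≤ 2 * (‖a‖ ^ 2 + d ^ 2 * ‖b‖ ^ 2) := by
      have h1 : ‖a + (d : ℂ) * b‖ ≤ ‖a‖ + |d| * ‖b‖ := by
        refine (norm_add_le _ _).trans ?_
        rw [norm_mul, Complex.norm_real, Real.norm_eq_abs]
      refine (pow_le_pow_left₀ (norm_nonneg _) h1 2).trans ?_
      rw [← sq_abs d]
      nlinarith [sq_nonneg (‖a‖ - |d| * ‖b‖)]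
    calc (N⁻¹ * ‖d‖ * ‖a + (d : ℂ) * b‖) ^ 2 = N⁻¹ ^ 2 * d ^ 2 * ‖a + (d : ℂ) * b‖ ^ 2 := by
          rw [mul_pow, mul_pow, Real.norm_eq_abs, sq_abs]
      _ ≤ N⁻¹ ^ 2 * d ^ 2 * (2 * (‖a‖ ^ 2 + d ^ 2 * ‖b‖ ^ 2)) :=
          mul_le_mul_of_nonneg_left hsum (by positivity)
      _ = 2 * N⁻¹ ^ 2 * (d ^ 2 * ‖a‖ ^ 2 + d ^ 4 * ‖b‖ ^ 2) := by ring
      _ ≤ 2 * N⁻¹ ^ 2 * (Y * ‖a‖ ^ 2 + Y * (η ^ 6 * hsSq F ^ 2)) := by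
          refine mul_le_mul_of_nonneg_left (add_le_add ?_ ?_) (by positivity)
          · exact mul_le_mul_of_nonneg_right (hY2 i) (by positivity)
          · exact mul_le_mul (hY4 i) hb2 (by positivity) hY0
      _ = _ := by ring
  refine (Finset.sum_le_sum fun i _ => term i).trans ?_
  rw [← Finset.mul_sum, Finset.sum_add_distrib, ← Finset.mul_sum]
  have h1 : ∑ i, ‖((E i).map Complex.ofReal * (G * G)).trace‖ ^ 2 ≤ c₁ * (N * η ^ 4) := by
    refine (hc₁ _).trans (mul_le_mul_of_nonneg_left ?_ hc₁0)
    refine (hsSq_le _).trans ?_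
    rw [show η ^ 4 = (η ^ 2) ^ 2 by ring]
    gcongr
  have h2 : η ^ 6 * ∑ i, hsSq ((E i).map Complex.ofReal) ^ 2 ≤ η ^ 6 * (c₂ * N) :=
    mul_le_mul_of_nonneg_left hc₂ (by positivity)
  calc _ ≤ 2 * N⁻¹ ^ 2 * Y * (c₁ * (N * η ^ 4) + η ^ 6 * (c₂ * N)) :=
        mul_le_mul_of_nonneg_left (add_le_add h1 h2) (by positivity)
    _ = 2 * (c₁ * η ^ 4 + c₂ * η ^ 6) * (N⁻¹ * (N⁻¹ * N)) * Y := by ring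
    _ = _ := by
      rcases eq_or_ne N 0 with h | h
      · simp [h]
      · rw [inv_mul_cancel₀ h, mul_one]

/-- Fourth moment concentration for the normalized trace of the resolvent of a linear pencil with
independent coefficients. -/
theorem integral_normTrResol_sub_pow_four_le {p : Measure ℝ} [IsProbabilityMeasure p]
    (hp : Integrable (fun x : ℝ => x ^ 32) p)
    (hE : ∀ i, (E i).IsHermitian) {w : ℂ} (hw : w.im ≠ 0)
    {c₁ c₂ : ℝ} (hc₁ : ∀ X : Matrix n n ℂ,
      ∑ i, ‖((E i).map Complex.ofReal * X).trace‖ ^ 2 ≤ c₁ * hsSq X) (hc₁0 : 0 ≤ c₁)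
    (hc₂ : ∑ i, hsSq ((E i).map Complex.ofReal) ^ 2 ≤ c₂ * Fintype.card n)
    (hc₂0 : 0 ≤ c₂) {K : ℝ} (hK : 0 < K) :
    ∫ z, ‖normTrResol (pencil E z) w - ∫ z, normTrResol (pencil E z) w ∂(iidLaw ι p)‖ ^ 4
        ∂(iidLaw ι p) ≤
      72 * (c₁ * |w.im|⁻¹ ^ 4 + c₂ * |w.im|⁻¹ ^ 6) ^ 2 * (Fintype.card n : ℝ)⁻¹ ^ 2 *
        (1 + K + 2 ^ 32 * Fintype.card ι * (∫ x, x ^ 32 ∂p) / K ^ 3) := by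
  set c := c₁ * |w.im|⁻¹ ^ 4 + c₂ * |w.im|⁻¹ ^ 6 with hc
  have hc0 : 0 ≤ c := by positivity
  set s : (ι → ℝ) → ℂ := fun z => normTrResol (pencil E z) w with hs
  have hsb : ∀ z, ‖s z‖ ≤ |w.im|⁻¹ := fun z => norm_normTrResol_le (pencil_isHermitian hE z) hw
  have hsc : Continuous s := continuous_normTrResol continuous_pencil (pencil_isHermitian hE) hw
  set N := (Fintype.card n : ℝ) with hN
  set Q := (iidLaw ι p).prod (iidLaw ι p) with hQ
  -- T dominates 1 and the eighth powers of all increments at once. Since d ≤ K + d⁴/K³, a maximum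
  -- over the coordinates costs K plus a sum of 32nd moments damped by K³. The factor 2³¹ comes from
  -- (a + b)³² ≤ 2³¹(a³² + b³²).
  set T : (ι → ℝ) × (ι → ℝ) → ℝ := fun x =>
    1 + K + 2 ^ 31 * (∑ i, (x.1 i ^ 32 + x.2 i ^ 32)) / K ^ 3 with hT
  have hT0 : ∀ x, 0 ≤ T x := fun x => by
    have : ∀ i, 0 ≤ x.1 i ^ 32 + x.2 i ^ 32 := fun i => by positivity
    have := Finset.sum_nonneg fun i (_ : i ∈ Finset.univ) => this i
    positivity
  have hV : ∀ x : (ι → ℝ) × (ι → ℝ), (∑ i, ‖s x.1 - s (resample i x)‖ ^ 2) ^ 2 ≤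
      4 * c ^ 2 * N⁻¹ ^ 2 * T x := fun x => by
    have h8 : ∀ i, (x.1 i - x.2 i) ^ 8 ≤ K + 2 ^ 31 * (∑ i, (x.1 i ^ 32 + x.2 i ^ 32)) / K ^ 3 := by
      intro i
      have h32 : (x.1 i - x.2 i) ^ 32 ≤ 2 ^ 31 * (∑ i, (x.1 i ^ 32 + x.2 i ^ 32)) := by
        have h := Even.add_pow_le (n := 32) (by decide) (a := x.1 i) (b := -x.2 i)
        rw [← sub_eq_add_neg, Even.neg_pow (by decide : Even 32)] at h
        refine h.trans ?_
        have := Finset.single_le_sum (f := fun i => x.1 i ^ 32 + x.2 i ^ 32)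
          (fun i _ => by positivity) (Finset.mem_univ i)
        norm_num at this ⊢
        linarith
      set d := (x.1 i - x.2 i) ^ 8 with hd
      have hd0 : 0 ≤ d := by positivity
      have hd4 : (x.1 i - x.2 i) ^ 32 = d ^ 4 := by rw [hd]; ring
      rw [hd4] at h32
      have h2 : d ≤ K + d ^ 4 / K ^ 3 := by
        rcases le_total d K with h | h
        · have : 0 ≤ d ^ 4 / K ^ 3 := by positivity
          linarith
        · have : d ≤ d ^ 4 / K ^ 3 := by
            rw [le_div_iff₀ (by positivity), show d ^ 4 = d * d ^ 3 by ring]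
            gcongr
          linarith
      refine h2.trans ?_
      gcongr
    have hYsq : ∀ i, (x.1 i - x.2 i) ^ 8 ≤ T x ∧ (x.1 i - x.2 i) ^ 4 ≤ T x := fun i => by
      have h := h8 i
      have e : T x = 1 + (K + 2 ^ 31 * (∑ i, (x.1 i ^ 32 + x.2 i ^ 32)) / K ^ 3) := by
        simp only [hT]; ring
      rw [e]
      refine ⟨by linarith, ?_⟩
      nlinarith [sq_nonneg ((x.1 i - x.2 i) ^ 4 - 1)]
    -- Y = √T is admissible because Y² = T bounds both the fourth and the eighth powers of the
    -- increments.
    have h := sum_sq_normTrResol_sub_le hE hw hc₁ hc₁0 hc₂ x.1 x.2 (Y := Real.sqrt (T x))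
      (fun i => Real.le_sqrt_of_sq_le (by
        have := (hYsq i).2
        calc _ = (x.1 i - x.2 i) ^ 4 := by ring
          _ ≤ _ := this))
      (fun i => Real.le_sqrt_of_sq_le (by
        have := (hYsq i).1
        calc _ = (x.1 i - x.2 i) ^ 8 := by ring
          _ ≤ _ := this)) (Real.sqrt_nonneg _)
    refine (pow_le_pow_left₀ (Finset.sum_nonneg fun i _ => by positivity) h 2).trans (le_of_eq ?_)
    rw [mul_pow, Real.sq_sqrt (hT0 x)]
    ring
  have ifst : ∀ i, Integrable (fun x : (ι → ℝ) × (ι → ℝ) => x.1 i ^ 32) Q := fun i =>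
    (((measurePreserving_eval (fun _ : ι => p) i).comp measurePreserving_fst)).integrable_comp_of_integrable hp
  have isnd : ∀ i, Integrable (fun x : (ι → ℝ) × (ι → ℝ) => x.2 i ^ 32) Q := fun i =>
    (((measurePreserving_eval (fun _ : ι => p) i).comp measurePreserving_snd)).integrable_comp_of_integrable hp
  have efst : ∀ i, ∫ x : (ι → ℝ) × (ι → ℝ), x.1 i ^ 32 ∂Q = ∫ x, x ^ 32 ∂p := fun i =>
    (((measurePreserving_eval (fun _ : ι => p) i).comp
      (measurePreserving_fst (ν := iidLaw ι p)))).integral_comp_aestronglyMeasurable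
      hp.aestronglyMeasurable
  have esnd : ∀ i, ∫ x : (ι → ℝ) × (ι → ℝ), x.2 i ^ 32 ∂Q = ∫ x, x ^ 32 ∂p := fun i =>
    (((measurePreserving_eval (fun _ : ι => p) i).comp
      (measurePreserving_snd (μ := iidLaw ι p)))).integral_comp_aestronglyMeasurable
      hp.aestronglyMeasurable
  have iadd : ∀ i, Integrable (fun x : (ι → ℝ) × (ι → ℝ) => x.1 i ^ 32 + x.2 i ^ 32) Q :=
    fun i => (ifst i).add (isnd i)
  have isum : Integrable (fun x : (ι → ℝ) × (ι → ℝ) => ∑ i, (x.1 i ^ 32 + x.2 i ^ 32)) Q :=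
    integrable_finsetSum _ fun i _ => iadd i
  have iT : Integrable T Q :=
    (integrable_const (1 + K)).add ((isum.const_mul _).div_const _)
  have eT : ∫ x, T x ∂Q = 1 + K + 2 ^ 32 * Fintype.card ι * (∫ x, x ^ 32 ∂p) / K ^ 3 := by
    have i2 : Integrable (fun x : (ι → ℝ) × (ι → ℝ) =>
      2 ^ 31 * (∑ i, (x.1 i ^ 32 + x.2 i ^ 32)) / K ^ 3) Q := (isum.const_mul _).div_const _
    simp only [hT]
    rw [integral_add (integrable_const _) i2, integral_div, integral_const_mul,
      integral_finsetSum _ fun i _ => iadd i]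
    simp_rw [integral_add (ifst _) (isnd _), efst, esnd]
    simp
    ring
  -- The Efron–Stein bound is real, so it is applied to real and imaginary parts. Here 18 = (9/2)·4,
  -- and ‖z‖⁴ ≤ 2((Re z)⁴ + (Im z)⁴) later gives 72 = 2·(18 + 18).
  have part : ∀ g : ℂ → ℝ, Continuous g → (∀ a b, g a - g b = g (a - b)) → (∀ a, |g a| ≤ ‖a‖) →
      ∫ z, (g (s z) - ∫ z, g (s z) ∂(iidLaw ι p)) ^ 4 ∂(iidLaw ι p) ≤
        18 * c ^ 2 * N⁻¹ ^ 2 *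
          (1 + K + 2 ^ 32 * Fintype.card ι * (∫ x, x ^ 32 ∂p) / K ^ 3) := by
    intro g hg hgs hgn
    have h := efronStein_four p (f := fun z => g (s z)) (hg.comp hsc).measurable
      (C := |w.im|⁻¹) fun z => (hgn _).trans (hsb z)
    refine h.trans ?_
    have h2 : ∫ x, (∑ i, (g (s x.1) - g (s (resample i x))) ^ 2) ^ 2 ∂Q ≤
        ∫ x, 4 * c ^ 2 * N⁻¹ ^ 2 * T x ∂Q := by
      refine integral_mono_of_nonneg (Eventually.of_forall fun x => sq_nonneg _)
        (iT.const_mul _) (Eventually.of_forall fun x => ?_)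
      refine le_trans ?_ (hV x)
      refine pow_le_pow_left₀ (Finset.sum_nonneg fun i _ => sq_nonneg _)
        (Finset.sum_le_sum fun i _ => ?_) 2
      rw [hgs, ← sq_abs]
      exact pow_le_pow_left₀ (abs_nonneg _) (hgn _) 2
    rw [integral_const_mul, eT] at h2
    linarith
  have is : Integrable s (iidLaw ι p) :=
    integrable_of_bounded hsc.aestronglyMeasurable hsb
  have hre := part Complex.re Complex.continuous_re (fun a b => (Complex.sub_re a b).symm)
    Complex.abs_re_le_norm
  have him := part Complex.im Complex.continuous_im (fun a b => (Complex.sub_im a b).symm)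
    Complex.abs_im_le_norm
  have ere : ∫ z, (s z).re ∂(iidLaw ι p) = (∫ z, s z ∂(iidLaw ι p)).re := integral_re is
  have eim : ∫ z, (s z).im ∂(iidLaw ι p) = (∫ z, s z ∂(iidLaw ι p)).im := integral_im is
  rw [ere] at hre
  rw [eim] at him
  set m := ∫ z, s z ∂(iidLaw ι p) with hm
  have hbd : ∀ z, ‖s z - m‖ ≤ |w.im|⁻¹ + ‖m‖ := fun z =>
    (norm_sub_le _ _).trans (by gcongr; exact hsb z)
  have i4 : ∀ g : ℂ → ℝ, Continuous g → (∀ a b, g a - g b = g (a - b)) → (∀ a, |g a| ≤ ‖a‖) →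
      Integrable (fun z => (g (s z) - g m) ^ 4) (iidLaw ι p) := by
    intro g hg hgs hgn
    refine integrable_of_bounded (((hg.comp hsc).sub continuous_const).pow 4).aestronglyMeasurable
      (C := (|w.im|⁻¹ + ‖m‖) ^ 4) fun z => ?_
    rw [norm_pow, hgs]
    exact pow_le_pow_left₀ (norm_nonneg _) ((hgn _).trans (hbd z)) 4
  have i4re := i4 Complex.re Complex.continuous_re (fun a b => (Complex.sub_re a b).symm)
    Complex.abs_re_le_norm
  have i4im := i4 Complex.im Complex.continuous_im (fun a b => (Complex.sub_im a b).symm)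
    Complex.abs_im_le_norm
  have fin : ∫ z, ‖s z - m‖ ^ 4 ∂(iidLaw ι p) ≤
      ∫ z, 2 * (((s z).re - m.re) ^ 4 + ((s z).im - m.im) ^ 4) ∂(iidLaw ι p) := by
    refine integral_mono_of_nonneg (Eventually.of_forall fun z => by positivity)
      ((i4re.add i4im).const_mul 2) (Eventually.of_forall fun z => ?_)
    have h1 : ‖s z - m‖ ^ 2 = ((s z).re - m.re) ^ 2 + ((s z).im - m.im) ^ 2 := by
      rw [← Complex.normSq_eq_norm_sq, Complex.normSq_apply]
      simp; ring
    dsimp only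
    rw [show ‖s z - m‖ ^ 4 = (‖s z - m‖ ^ 2) ^ 2 by ring, h1]
    nlinarith [sq_nonneg (((s z).re - m.re) ^ 2 - ((s z).im - m.im) ^ 2)]
  rw [integral_const_mul, integral_add i4re i4im] at fin
  linarith

end Concentration

/-! ### The blocks A ± B as linear pencils, and summable fourth moments -/

section DiscoPencil

variable {N : ℕ}

/-- The normalized sum `(A + e B) / √(2N)` of the palindromic Toeplitz and the symmetric block. -/
def blockSum (e : ℝ) (z : DiscoIndex N → ℝ) : Matrix (Fin N) (Fin N) ℝ :=
  (Real.sqrt (2 * N))⁻¹ •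
    (pstMatrix (fun k => z (Sum.inl k)) + e • symMatrix (fun q => z (Sum.inr q)))

/-- The coefficient matrices of `blockSum`. -/
def blockCoeff (e : ℝ) (α : DiscoIndex N) : Matrix (Fin N) (Fin N) ℝ :=
  blockSum e (Pi.single α 1)

/-- The free entry in position `(i, j)` of a real symmetric matrix. -/
def symIndex (x : Fin N × Fin N) : {q : Fin N × Fin N // q.1 ≤ q.2} :=
  ⟨(min x.1 x.2, max x.1 x.2), min_le_max⟩

theorem blockSum_apply (e : ℝ) (z : DiscoIndex N → ℝ) (i j : Fin N) :
    blockSum e z i j = (Real.sqrt (2 * N))⁻¹ *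
      (z (Sum.inl (pstDiag i j)) + e * z (Sum.inr (symIndex (i, j)))) := by
  simp [blockSum, pstMatrix, symMatrix, symIndex]

theorem blockSum_isHermitian (e : ℝ) (z : DiscoIndex N → ℝ) : (blockSum e z).IsHermitian := by
  have h1 := (pstMatrix_isHermitian fun k => z (Sum.inl k))
  have h2 := (symMatrix_isHermitian fun q => z (Sum.inr q))
  unfold blockSum Matrix.IsHermitian at *
  rw [Matrix.conjTranspose_smul, Matrix.conjTranspose_add, Matrix.conjTranspose_smul, h1, h2]
  simp

theorem blockCoeff_isHermitian (e : ℝ) (α : DiscoIndex N) : (blockCoeff e α).IsHermitian :=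
  blockSum_isHermitian e _

theorem blockSum_eq_pencil (e : ℝ) (z : DiscoIndex N → ℝ) :
    blockSum e z = pencil (blockCoeff e) z := by
  ext i j
  have key : ∀ β : DiscoIndex N, ∑ α, z α * (Pi.single α (1 : ℝ) : DiscoIndex N → ℝ) β = z β := by
    intro β
    rw [Finset.sum_eq_single β]
    · simp
    · intro α _ h; rw [Pi.single_eq_of_ne h.symm, mul_zero]
    · intro h; exact absurd (Finset.mem_univ _) h
  rw [pencil, Matrix.sum_apply]
  simp only [Matrix.smul_apply, blockCoeff, blockSum_apply, smul_eq_mul]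
  rw [← key (Sum.inl (pstDiag i j)), ← key (Sum.inr (symIndex (i, j))), Finset.mul_sum,
    ← Finset.sum_add_distrib, Finset.mul_sum]
  exact Finset.sum_congr rfl fun α _ => by ring

/-- Cauchy–Schwarz on each fibre, whose size is at most m. -/
theorem sum_norm_sq_fiber_sum_le {κ β : Type*} [Fintype κ] [DecidableEq κ] [Fintype β]
    (g : β → κ) (a : β → ℂ) {m : ℝ}
    (hm : ∀ k, ((Finset.univ.filter fun b => g b = k).card : ℝ) ≤ m) :
    ∑ k, ‖∑ b, if g b = k then a b else 0‖ ^ 2 ≤ m * ∑ b, ‖a b‖ ^ 2 := by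
  rw [← Finset.sum_fiberwise Finset.univ g (fun b => ‖a b‖ ^ 2), Finset.mul_sum]
  refine Finset.sum_le_sum fun k _ => ?_
  rw [← Finset.sum_filter]
  calc ‖∑ b ∈ Finset.univ.filter (fun b => g b = k), a b‖ ^ 2
      ≤ (∑ b ∈ Finset.univ.filter (fun b => g b = k), ‖a b‖) ^ 2 :=
        pow_le_pow_left₀ (norm_nonneg _) (norm_sum_le _ _) 2
    _ ≤ (Finset.univ.filter fun b => g b = k).card *
        ∑ b ∈ Finset.univ.filter (fun b => g b = k), ‖a b‖ ^ 2 := sq_sum_le_card_mul_sum_sq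
    _ ≤ _ := mul_le_mul_of_nonneg_right (hm k) (by positivity)

/-- In row i the condition forces |i - j| to be k or N - 1 - k, which leaves at most four columns.
-/
theorem card_pstDiag_fiber_le (k : Fin ((N + 1) / 2)) :
    ((Finset.univ.filter fun x : Fin N × Fin N => pstDiag x.1 x.2 = k).card : ℝ) ≤ 4 * N := by
  have h1 : ∀ i : Fin N, (Finset.univ.filter fun j : Fin N => pstDiag i j = k).card ≤ 4 := by
    intro i
    have : ((Finset.univ.filter fun j : Fin N => pstDiag i j = k).map Fin.valEmbedding) ⊆
        {(i : ℕ) + k, (i : ℕ) - k, (i : ℕ) + (N - 1 - k), (i : ℕ) - (N - 1 - k)} := by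
      intro a ha
      simp only [Finset.mem_map, Finset.mem_filter, Finset.mem_univ, true_and] at ha
      obtain ⟨j, hj, rfl⟩ := ha
      have hk := congrArg Fin.val hj
      simp only [pstDiag] at hk
      simp only [Finset.mem_insert, Finset.mem_singleton, Fin.valEmbedding_apply]
      have := i.isLt; have := j.isLt
      omega
    have := Finset.card_le_card this
    rw [Finset.card_map] at this
    exact this.trans Finset.card_le_four
  have h2 : (Finset.univ.filter fun x : Fin N × Fin N => pstDiag x.1 x.2 = k).card =
      ∑ i : Fin N, (Finset.univ.filter fun j : Fin N => pstDiag i j = k).card := by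
    simp only [Finset.card_filter]
    rw [Fintype.sum_prod_type]
  rw [h2]
  have h3 := Finset.sum_le_sum fun i (_ : i ∈ Finset.univ) => h1 i
  simp only [Finset.sum_const, Finset.card_univ, Fintype.card_fin, smul_eq_mul] at h3
  have : ((∑ i : Fin N, (Finset.univ.filter fun j : Fin N => pstDiag i j = k).card : ℕ) : ℝ) ≤
      ((N * 4 : ℕ) : ℝ) := Nat.cast_le.2 h3
  refine this.trans (le_of_eq ?_)
  push_cast; ring

theorem symIndex_eq_iff (x : Fin N × Fin N) (q : {q : Fin N × Fin N // q.1 ≤ q.2}) :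
    symIndex x = q ↔ x = q.1 ∨ x = q.1.swap := by
  obtain ⟨⟨a, b⟩, h⟩ := q
  obtain ⟨i, j⟩ := x
  simp only [symIndex, Subtype.mk.injEq, Prod.mk.injEq, Prod.swap_prod_mk]
  dsimp only at h
  rcases le_total i j with hij | hij
  · rw [min_eq_left hij, max_eq_right hij]
    constructor
    · exact Or.inl
    · rintro (h' | ⟨rfl, rfl⟩)
      · exact h'
      · exact ⟨le_antisymm hij h, le_antisymm h hij⟩
  · rw [min_eq_right hij, max_eq_left hij]
    constructor
    · rintro ⟨rfl, rfl⟩; exact Or.inr ⟨rfl, rfl⟩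
    · rintro (⟨rfl, rfl⟩ | ⟨rfl, rfl⟩)
      · exact ⟨le_antisymm hij h, le_antisymm h hij⟩
      · exact ⟨rfl, rfl⟩

/-- The true bound is 2. The weaker 4N lets both kinds of entries share the estimates that follow.
-/
theorem card_symIndex_fiber_le (q : {q : Fin N × Fin N // q.1 ≤ q.2}) :
    ((Finset.univ.filter fun x : Fin N × Fin N => symIndex x = q).card : ℝ) ≤ 4 * N := by
  have hN : 1 ≤ N := q.1.1.pos
  have h : (Finset.univ.filter fun x : Fin N × Fin N => symIndex x = q) ⊆ {q.1, q.1.swap} := by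
    intro x hx
    simpa [symIndex_eq_iff] using hx
  have h2 := (Finset.card_le_card h).trans Finset.card_le_two
  have h3 : ((Finset.univ.filter fun x : Fin N × Fin N => symIndex x = q).card : ℝ) ≤ 2 := by
    exact_mod_cast h2
  have h4 : (1 : ℝ) ≤ N := by exact_mod_cast hN
  linarith

theorem blockCoeff_inl_apply (e : ℝ) (k : Fin ((N + 1) / 2)) (i j : Fin N) :
    blockCoeff e (Sum.inl k) i j =
      if pstDiag i j = k then (Real.sqrt (2 * N))⁻¹ else 0 := by
  simp only [blockCoeff, blockSum_apply, Pi.single_apply]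
  split_ifs <;> simp_all

theorem blockCoeff_inr_apply (e : ℝ) (q : {q : Fin N × Fin N // q.1 ≤ q.2}) (i j : Fin N) :
    blockCoeff e (Sum.inr q) i j =
      if symIndex (i, j) = q then (Real.sqrt (2 * N))⁻¹ * e else 0 := by
  simp only [blockCoeff, blockSum_apply, Pi.single_apply]
  split_ifs <;> simp_all

theorem hsSq_eq_sum_prod {n : Type*} [Fintype n] (X : Matrix n n ℂ) :
    hsSq X = ∑ x : n × n, ‖X x.2 x.1‖ ^ 2 := by
  rw [Fintype.sum_prod_type, hsSq, Finset.sum_comm]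

theorem trace_mul_eq_sum_prod {n : Type*} [Fintype n] (X Y : Matrix n n ℂ) :
    (X * Y).trace = ∑ x : n × n, X x.1 x.2 * Y x.2 x.1 := by
  rw [Fintype.sum_prod_type]
  simp [Matrix.trace, Matrix.mul_apply]

theorem inv_sqrt_sq (hN : 1 ≤ N) : ((Real.sqrt (2 * N))⁻¹) ^ 2 = (2 * (N : ℝ))⁻¹ := by
  rw [inv_pow, Real.sq_sqrt (by positivity)]

/-- The trace is ±(2N)^(-1/2) times a sum of entries of X over a fibre. Fibres of size at most 4N
give the constant (2N)⁻¹·4N = 2. -/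
theorem sum_norm_sq_trace_fiber_le {κ : Type*} [Fintype κ] [DecidableEq κ] (hN : 1 ≤ N)
    (g : Fin N × Fin N → κ)
    (hg : ∀ k, ((Finset.univ.filter fun x => g x = k).card : ℝ) ≤ 4 * N) {e : ℝ} (he : e ^ 2 = 1)
    (E : κ → Matrix (Fin N) (Fin N) ℝ)
    (hE : ∀ k i j, E k i j = if g (i, j) = k then (Real.sqrt (2 * N))⁻¹ * e else 0)
    (X : Matrix (Fin N) (Fin N) ℂ) :
    ∑ k, ‖((E k).map Complex.ofReal * X).trace‖ ^ 2 ≤ 2 * hsSq X := by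
  have hN' : (0 : ℝ) < N := by exact_mod_cast hN
  have h1 : ∀ k, ‖((E k).map Complex.ofReal * X).trace‖ ^ 2 = (2 * (N : ℝ))⁻¹ *
      ‖∑ x, if g x = k then X x.2 x.1 else 0‖ ^ 2 := by
    intro k
    have : ((E k).map Complex.ofReal * X).trace = (((Real.sqrt (2 * N))⁻¹ * e : ℝ) : ℂ) *
        ∑ x, if g x = k then X x.2 x.1 else 0 := by
      rw [trace_mul_eq_sum_prod, Finset.mul_sum]
      refine Finset.sum_congr rfl fun x _ => ?_
      rw [Matrix.map_apply, hE]
      split_ifs <;> simp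
    rw [this, norm_mul, Complex.norm_real, mul_pow, Real.norm_eq_abs, sq_abs, mul_pow, he, mul_one,
      inv_sqrt_sq hN]
  simp_rw [h1]
  rw [← Finset.mul_sum]
  have h2 := sum_norm_sq_fiber_sum_le g (fun x => X x.2 x.1) hg
  rw [← hsSq_eq_sum_prod] at h2
  calc _ ≤ (2 * (N : ℝ))⁻¹ * (4 * N * hsSq X) := by gcongr
    _ = 2 * hsSq X := by field_simp; ring

/-- Here `hsSq` of a coefficient is its fibre size over 2N, and the squared fibre sizes sum to at
most 4N·N². -/
theorem sum_hsSq_sq_fiber_le {κ : Type*} [Fintype κ] [DecidableEq κ] (hN : 1 ≤ N)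
    (g : Fin N × Fin N → κ)
    (hg : ∀ k, ((Finset.univ.filter fun x => g x = k).card : ℝ) ≤ 4 * N) {e : ℝ} (he : e ^ 2 = 1)
    (E : κ → Matrix (Fin N) (Fin N) ℝ)
    (hE : ∀ k i j, E k i j = if g (i, j) = k then (Real.sqrt (2 * N))⁻¹ * e else 0) :
    ∑ k, hsSq ((E k).map Complex.ofReal) ^ 2 ≤ N := by
  have hN' : (0 : ℝ) < N := by exact_mod_cast hN
  have h1 : ∀ k, hsSq ((E k).map Complex.ofReal) ^ 2 = (2 * (N : ℝ))⁻¹ ^ 2 *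
      ‖∑ x, if g x = k then (1 : ℂ) else 0‖ ^ 2 := by
    intro k
    have : hsSq ((E k).map Complex.ofReal) = (2 * (N : ℝ))⁻¹ *
        ‖∑ x, if g x = k then (1 : ℂ) else 0‖ := by
      rw [← Finset.sum_filter, Finset.sum_const, nsmul_eq_mul, mul_one, Complex.norm_natCast,
        hsSq, ← Fintype.sum_prod_type', Finset.card_filter, Nat.cast_sum, Finset.mul_sum]
      refine Finset.sum_congr rfl fun x _ => ?_
      rw [Matrix.map_apply, hE, Complex.norm_real, Real.norm_eq_abs, sq_abs]
      split_ifs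
      · rw [mul_pow, he, inv_sqrt_sq hN]; simp
      · simp
    rw [this, mul_pow]
  simp_rw [h1]
  rw [← Finset.mul_sum]
  have h2 := sum_norm_sq_fiber_sum_le g (fun _ => (1 : ℂ)) hg
  simp only [norm_one, one_pow, Finset.sum_const, Finset.card_univ, Fintype.card_prod,
    Fintype.card_fin, nsmul_eq_mul, mul_one] at h2
  push_cast at h2
  calc _ ≤ (2 * (N : ℝ))⁻¹ ^ 2 * (4 * N * (N * N)) := by gcongr
    _ = N := by field_simp; ring

theorem sum_norm_sq_trace_blockCoeff_le (hN : 1 ≤ N) {e : ℝ} (he : e ^ 2 = 1)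
    (X : Matrix (Fin N) (Fin N) ℂ) :
    ∑ α, ‖((blockCoeff e α).map Complex.ofReal * X).trace‖ ^ 2 ≤ 4 * hsSq X := by
  rw [Fintype.sum_sum_type]
  have h1 := sum_norm_sq_trace_fiber_le hN (fun x => pstDiag x.1 x.2) card_pstDiag_fiber_le
    (one_pow 2) (fun k => blockCoeff e (Sum.inl k))
    (fun k i j => by rw [blockCoeff_inl_apply, mul_one]) X
  have h2 := sum_norm_sq_trace_fiber_le hN symIndex card_symIndex_fiber_le
    he (fun k => blockCoeff e (Sum.inr k)) (fun k i j => blockCoeff_inr_apply e k i j) X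
  linarith

theorem sum_hsSq_sq_blockCoeff_le (hN : 1 ≤ N) {e : ℝ} (he : e ^ 2 = 1) :
    ∑ α, hsSq ((blockCoeff (N := N) e α).map Complex.ofReal) ^ 2 ≤ 2 * N := by
  rw [Fintype.sum_sum_type]
  have h1 := sum_hsSq_sq_fiber_le hN (fun x => pstDiag x.1 x.2) card_pstDiag_fiber_le
    (one_pow 2) (fun k => blockCoeff e (Sum.inl k))
    (fun k i j => by rw [blockCoeff_inl_apply, mul_one])
  have h2 := sum_hsSq_sq_fiber_le hN symIndex card_symIndex_fiber_le
    he (fun k => blockCoeff e (Sum.inr k)) (fun k i j => blockCoeff_inr_apply e k i j)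
  linarith

theorem card_discoIndex_le (hN : 1 ≤ N) : (Fintype.card (DiscoIndex N) : ℝ) ≤ 2 * (N : ℝ) ^ 2 := by
  have h1 : Fintype.card (DiscoIndex N) ≤ N + N ^ 2 := by
    rw [Fintype.card_sum, Fintype.card_fin]
    have : Fintype.card {q : Fin N × Fin N // q.1 ≤ q.2} ≤ N ^ 2 := by
      refine (Fintype.card_subtype_le _).trans ?_
      simp [sq]
    omega
  have h2 : (Fintype.card (DiscoIndex N) : ℝ) ≤ N + (N : ℝ) ^ 2 := by exact_mod_cast h1
  have h3 : (1 : ℝ) ≤ N := by exact_mod_cast hN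
  nlinarith

/-- The fourth central moment of the Stieltjes transform is summable in the size. -/
theorem integral_normTrResol_blockSum_sub_pow_four_le {p : Measure ℝ} (hp : IsEntryLaw p)
    {e : ℝ} (he : e ^ 2 = 1) {w : ℂ} (hw : w.im ≠ 0) :
    ∃ C : ℝ, 0 ≤ C ∧ ∀ N : ℕ, 1 ≤ N →
      ∫ z, ‖normTrResol (blockSum e z) w -
          ∫ z, normTrResol (blockSum e z) w ∂(iidLaw (DiscoIndex N) p)‖ ^ 4
        ∂(iidLaw (DiscoIndex N) p) ≤ C / (N * Real.sqrt N) := by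
  have := hp.isProbabilityMeasure
  set m := ∫ x, x ^ 32 ∂p with hm
  have hm0 : 0 ≤ m := integral_nonneg fun x => by positivity
  set c := 4 * |w.im|⁻¹ ^ 4 + 2 * |w.im|⁻¹ ^ 6 with hc
  refine ⟨72 * c ^ 2 * (2 + 2 ^ 33 * m), by positivity, fun N hN => ?_⟩
  have hN1 : (1 : ℝ) ≤ N := by exact_mod_cast hN
  have hs1 : 1 ≤ Real.sqrt N := Real.one_le_sqrt.2 hN1
  have hs0 : 0 < Real.sqrt N := by positivity
  have hsN : Real.sqrt N ^ 2 = N := Real.sq_sqrt (by positivity)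
  -- The truncation level is K = √N. With at most 2N² free entries, the moment term is of order
  -- N²/K³ = √N as well, so the bound is of order N⁻²·√N = N^(-3/2).
  have h := integral_normTrResol_sub_pow_four_le (E := blockCoeff (N := N) e) (p := p)
    (hp.integrable_pow 32) (blockCoeff_isHermitian e) hw
    (sum_norm_sq_trace_blockCoeff_le hN he) (by norm_num)
    (c₂ := 2) (by simpa using sum_hsSq_sq_blockCoeff_le hN he) (by norm_num) hs0
  simp only [← blockSum_eq_pencil, Fintype.card_fin] at h
  refine h.trans ?_
  have hcard := card_discoIndex_le hN
  set s := Real.sqrt N with hs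
  have hT : 1 + s + 2 ^ 32 * (Fintype.card (DiscoIndex N) : ℝ) * m / s ^ 3 ≤
      (2 + 2 ^ 33 * m) * s := by
    have h2 : 2 ^ 32 * (Fintype.card (DiscoIndex N) : ℝ) * m / s ^ 3 ≤ 2 ^ 33 * m * s := by
      rw [div_le_iff₀ (by positivity)]
      calc 2 ^ 32 * (Fintype.card (DiscoIndex N) : ℝ) * m ≤ 2 ^ 32 * (2 * (N : ℝ) ^ 2) * m := by
            gcongr
        _ = 2 ^ 33 * m * s * s ^ 3 := by rw [← hsN]; ring
    linarith
  calc _ ≤ 72 * c ^ 2 * (N : ℝ)⁻¹ ^ 2 * ((2 + 2 ^ 33 * m) * s) :=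
        mul_le_mul_of_nonneg_left hT (by positivity)
    _ = _ := by
      rw [eq_div_iff (by positivity)]
      have hN0 : (N : ℝ) ≠ 0 := by positivity
      calc _ = 72 * c ^ 2 * (2 + 2 ^ 33 * m) * ((N : ℝ)⁻¹ ^ 2 * (N * s ^ 2)) := by ring
        _ = _ := by rw [hsN, show (N : ℝ)⁻¹ ^ 2 * (N * N) = ((N : ℝ)⁻¹ * N) ^ 2 by ring,
                      inv_mul_cancel₀ hN0]; ring

end DiscoPencil

/-! ### Approximate Gaussian integration by parts -/

section IntegrationByParts

variable {ι : Type*} [Fintype ι] [DecidableEq ι] {n : Type*} [Fintype n] [DecidableEq n]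

theorem sq_norm_le_hsSq (X : Matrix n n ℂ) : ‖X‖ ^ 2 ≤ hsSq X := by
  have h : ‖X‖ ≤ Real.sqrt (hsSq X) := by
    rw [Matrix.l2_opNorm_def]
    refine ContinuousLinearMap.opNorm_le_bound _ (Real.sqrt_nonneg _) fun v => ?_
    refine (sq_le_sq₀ (norm_nonneg _) (by positivity)).1 ?_
    rw [mul_pow, Real.sq_sqrt (hsSq_nonneg X), EuclideanSpace.norm_sq_eq,
      EuclideanSpace.norm_sq_eq, hsSq, Finset.sum_mul]
    refine Finset.sum_le_sum fun i _ => ?_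
    change ‖∑ j, X i j * v j‖ ^ 2 ≤ _
    calc ‖∑ j, X i j * v j‖ ^ 2 ≤ (∑ j, ‖X i j‖ * ‖v j‖) ^ 2 := by
          refine pow_le_pow_left₀ (norm_nonneg _) ((norm_sum_le _ _).trans ?_) 2
          exact Finset.sum_le_sum fun j _ => (norm_mul _ _).le
      _ ≤ _ := Finset.sum_mul_sq_le_sq_mul_sq _ _ _
  calc ‖X‖ ^ 2 ≤ Real.sqrt (hsSq X) ^ 2 := pow_le_pow_left₀ (norm_nonneg _) h 2
    _ = _ := Real.sq_sqrt (hsSq_nonneg X)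

theorem integrable_coord_pow {p : Measure ℝ} [IsProbabilityMeasure p] (i : ι) {k : ℕ}
    (h : Integrable (fun x : ℝ => x ^ k) p) :
    Integrable (fun z : ι → ℝ => ((z i : ℂ)) ^ k) (iidLaw ι p) := by
  have h2 : Integrable (fun x : ℝ => (x : ℂ) ^ k) p := by
    simpa using h.ofReal (𝕜 := ℂ)
  exact (measurePreserving_eval (fun _ : ι => p) i).integrable_comp_of_integrable h2

theorem norm_matrix_mul_le {A B : Matrix n n ℂ} {a b : ℝ} (hA : ‖A‖ ≤ a) (hB : ‖B‖ ≤ b) :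
    ‖A * B‖ ≤ a * b :=
  (norm_mul_le _ _).trans (mul_le_mul hA hB (norm_nonneg _) ((norm_nonneg _).trans hA))

/-- Approximate Gaussian integration by parts for one coefficient of a linear pencil. -/
theorem norm_integral_coord_mul_trace_add_le {p : Measure ℝ} (hp : IsEntryLaw p)
    {E : ι → Matrix n n ℝ} (hE : ∀ i, (E i).IsHermitian) {w : ℂ} (hw : w.im ≠ 0) (i : ι)
    {κ : ℝ} (hκ : ‖(E i).map Complex.ofReal‖ ≤ κ)
    (hκtr : ∀ X : Matrix n n ℂ, ‖((E i).map Complex.ofReal * X).trace‖ ≤ 2 * κ * ‖X‖)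
    {R : (ι → ℝ) → Matrix n n ℂ} (hR : Continuous R) (hRn : ∀ z, ‖R z‖ ≤ |w.im|⁻¹)
    (hRi : ∀ z u, R (Function.update z i u) = R z) :
    ‖∫ z, ((z i : ℂ) * ((E i).map Complex.ofReal * (R z * resol (pencil E z) w)).trace +
      ((E i).map Complex.ofReal * (R z * resol (pencil E z) w * (E i).map Complex.ofReal *
        resol (pencil E z) w)).trace) ∂(iidLaw ι p)‖ ≤
      κ ^ 3 * |w.im|⁻¹ ^ 4 * ∫ x, (4 * |x| + 2 * |x| ^ 3) ∂p := by
  have := hp.isProbabilityMeasure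
  set η := |w.im|⁻¹ with hη
  have hη0 : 0 ≤ η := by positivity
  have hκ0 : 0 ≤ κ := (norm_nonneg _).trans hκ
  set F := (E i).map Complex.ofReal with hF
  set G : (ι → ℝ) → Matrix n n ℂ := fun z => resol (pencil E z) w with hG
  set G₀ : (ι → ℝ) → Matrix n n ℂ := fun z => G (Function.update z i 0) with hG₀
  have hGc : Continuous G := continuous_resol continuous_pencil (pencil_isHermitian hE) hw
  have hG₀c : Continuous G₀ := hGc.comp (continuous_id.update i continuous_const)
  have hGn : ∀ z, ‖G z‖ ≤ η := fun z => norm_resol_le (pencil_isHermitian hE z) hw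
  have hG₀n : ∀ z, ‖G₀ z‖ ≤ η := fun z => hGn _
  have hG₀i : ∀ z u, G₀ (Function.update z i u) = G₀ z := fun z u => by
    simp only [hG₀, Function.update_idem]
  -- The resolvent is expanded around coordinate i set to 0. The coefficients formed with G₀ do not
  -- depend on that coordinate, so they are independent of it.
  have exp1 : ∀ z, G z = G₀ z - (z i : ℂ) • (G₀ z * F * G z) := fun z => by
    have := resol_pencil_update hE hw z i 0
    rw [sub_zero] at this
    change G₀ z = G z + (z i : ℂ) • (G₀ z * F * G z) at this
    exact eq_sub_of_add_eq this.symm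
  have exp2 : ∀ z, G z = G₀ z - (z i : ℂ) • (G₀ z * F * G₀ z) +
      (z i : ℂ) ^ 2 • (G₀ z * F * G₀ z * F * G z) := fun z => by
    conv_lhs => rw [exp1 z]
    have : G₀ z * F * G z = G₀ z * F * (G₀ z - (z i : ℂ) • (G₀ z * F * G z)) := by
      rw [← exp1 z]
    rw [this, mul_sub, smul_sub, mul_smul_comm, smul_smul, ← sq]
    simp only [mul_assoc]
    abel
  set f₀ : (ι → ℝ) → ℂ := fun z => (F * (R z * G₀ z)).trace with hf₀
  set g₀ : (ι → ℝ) → ℂ := fun z => (F * (R z * G₀ z * F * G₀ z)).trace with hg₀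
  set g : (ι → ℝ) → ℂ := fun z => (F * (R z * G z * F * G z)).trace with hg
  set h : (ι → ℝ) → ℂ := fun z => (F * (R z * G₀ z * F * G₀ z * F * G z)).trace with hh
  have cf₀ : Continuous f₀ := (continuous_const.mul (hR.mul hG₀c)).matrix_trace
  have cg₀ : Continuous g₀ :=
    (continuous_const.mul (((hR.mul hG₀c).mul continuous_const).mul hG₀c)).matrix_trace
  have cg : Continuous g :=
    (continuous_const.mul (((hR.mul hGc).mul continuous_const).mul hGc)).matrix_trace
  have ch : Continuous h := (continuous_const.mul (((((hR.mul hG₀c).mul continuous_const).mul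
    hG₀c).mul continuous_const).mul hGc)).matrix_trace
  have trb : ∀ {X : Matrix n n ℂ} {b : ℝ}, ‖X‖ ≤ b → ‖(F * X).trace‖ ≤ 2 * κ * b := fun hX =>
    (hκtr _).trans (mul_le_mul_of_nonneg_left hX (by positivity))
  have bf₀ : ∀ z, ‖f₀ z‖ ≤ 2 * κ * (η * η) := fun z =>
    trb (norm_matrix_mul_le (hRn z) (hG₀n z))
  have bg₀ : ∀ z, ‖g₀ z‖ ≤ 2 * κ * (η * η * κ * η) := fun z => trb (norm_matrix_mul_le
    (norm_matrix_mul_le (norm_matrix_mul_le (hRn z) (hG₀n z)) hκ) (hG₀n z))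
  have bg : ∀ z, ‖g z‖ ≤ 2 * κ * (η * η * κ * η) := fun z => trb (norm_matrix_mul_le
    (norm_matrix_mul_le (norm_matrix_mul_le (hRn z) (hGn z)) hκ) (hGn z))
  have bh : ∀ z, ‖h z‖ ≤ 2 * κ * (η * η * κ * η * κ * η) := fun z => trb (norm_matrix_mul_le
    (norm_matrix_mul_le (norm_matrix_mul_le
    (norm_matrix_mul_le (norm_matrix_mul_le (hRn z) (hG₀n z)) hκ) (hG₀n z)) hκ) (hGn z))
  have bd : ∀ z, ‖g z - g₀ z‖ ≤ 4 * κ ^ 3 * η ^ 4 * |z i| := fun z => by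
    have hD : ‖G z - G₀ z‖ ≤ |z i| * (η * κ * η) := by
      have : G z - G₀ z = -((z i : ℂ) • (G₀ z * F * G z)) := by
        conv_lhs => rw [exp1 z]
        abel
      rw [this, norm_neg, norm_smul, Complex.norm_real, Real.norm_eq_abs]
      exact mul_le_mul_of_nonneg_left (norm_matrix_mul_le (norm_matrix_mul_le (hG₀n z) hκ) (hGn z))
        (abs_nonneg _)
    have : g z - g₀ z = (F * (R z * (G z - G₀ z) * F * G z)).trace +
        (F * (R z * G₀ z * F * (G z - G₀ z))).trace := by
      rw [← Matrix.trace_add, ← Matrix.trace_sub]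
      congr 1
      noncomm_ring
    rw [this]
    refine (norm_add_le _ _).trans ((add_le_add (trb (norm_matrix_mul_le (norm_matrix_mul_le
      (norm_matrix_mul_le (hRn z) hD) hκ) (hGn z))) (trb (norm_matrix_mul_le (norm_matrix_mul_le
      (norm_matrix_mul_le (hRn z) (hG₀n z)) hκ) hD))).trans (le_of_eq ?_))
    ring
  -- The first term integrates to 0 because the mean is 0. The second integrates to the mean of g₀
  -- because the variance is 1. What remains is g - g₀ = O(|z i|) and a cubic term, both with three
  -- factors of κ.
  have point : ∀ z, (z i : ℂ) * (F * (R z * G z)).trace + g z =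
      (z i : ℂ) ^ 1 * f₀ z - (z i : ℂ) ^ 2 * g₀ z + (g z + (z i : ℂ) ^ 3 * h z) := fun z => by
    have : (F * (R z * G z)).trace = f₀ z - (z i : ℂ) * g₀ z + (z i : ℂ) ^ 2 * h z := by
      conv_lhs => rw [exp2 z]
      simp only [mul_add, mul_sub, mul_smul_comm, Matrix.trace_add, Matrix.trace_sub,
        Matrix.trace_smul, smul_eq_mul, hf₀, hg₀, hh, mul_assoc]
    rw [this]; ring
  have ipow : ∀ k, Integrable (fun z : ι → ℝ => (z i : ℂ) ^ k) (iidLaw ι p) := fun k =>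
    integrable_coord_pow i (hp.integrable_pow k)
  have if₀ : Integrable (fun z => (z i : ℂ) ^ 1 * f₀ z) (iidLaw ι p) :=
    (ipow 1).mul_bdd cf₀.aestronglyMeasurable (Eventually.of_forall bf₀)
  have ig₀ : Integrable (fun z => (z i : ℂ) ^ 2 * g₀ z) (iidLaw ι p) :=
    (ipow 2).mul_bdd cg₀.aestronglyMeasurable (Eventually.of_forall bg₀)
  have ih : Integrable (fun z => (z i : ℂ) ^ 3 * h z) (iidLaw ι p) :=
    (ipow 3).mul_bdd ch.aestronglyMeasurable (Eventually.of_forall bh)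
  have ig : Integrable g (iidLaw ι p) := integrable_of_bounded cg.aestronglyMeasurable bg
  have ig₀' : Integrable g₀ (iidLaw ι p) := integrable_of_bounded cg₀.aestronglyMeasurable bg₀
  have e1 : ∫ z, (z i : ℂ) ^ 1 * f₀ z ∂(iidLaw ι p) = 0 := by
    rw [integral_coord_mul p i (g := fun x => (x : ℂ) ^ 1) (by fun_prop) cf₀.measurable
      (fun z u => by simp only [hf₀, hRi, hG₀i])]
    simp only [pow_one]
    rw [integral_complex_ofReal, hp.mean_eq_zero]
    simp
  have e2 : ∫ z, (z i : ℂ) ^ 2 * g₀ z ∂(iidLaw ι p) = ∫ z, g₀ z ∂(iidLaw ι p) := by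
    rw [integral_coord_mul p i (g := fun x => (x : ℂ) ^ 2) (by fun_prop) cg₀.measurable
      (fun z u => by simp only [hg₀, hRi, hG₀i])]
    have : ∫ x : ℝ, (x : ℂ) ^ 2 ∂p = ((∫ x : ℝ, x ^ 2 ∂p : ℝ) : ℂ) := by
      rw [← integral_complex_ofReal]; simp
    rw [this, hp.variance_eq_one]
    simp
  change ‖∫ z, ((z i : ℂ) * (F * (R z * G z)).trace + g z) ∂(iidLaw ι p)‖ ≤ _
  simp_rw [point]
  have ifg : Integrable (fun z => (z i : ℂ) ^ 1 * f₀ z - (z i : ℂ) ^ 2 * g₀ z) (iidLaw ι p) :=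
    if₀.sub ig₀
  have igh : Integrable (fun z => g z + (z i : ℂ) ^ 3 * h z) (iidLaw ι p) := ig.add ih
  rw [integral_add ifg igh, integral_sub if₀ ig₀, e1, e2, zero_sub, neg_add_eq_sub,
    ← integral_sub igh ig₀']
  have iabs : ∀ k : ℕ, Integrable (fun x : ℝ => |x| ^ k) p := fun k => by
    simpa using (hp.integrable_pow k).norm
  have iabs1 : Integrable (fun x : ℝ => |x|) p := by simpa using iabs 1
  have ib : Integrable (fun x : ℝ => 4 * |x| + 2 * |x| ^ 3) p :=
    (iabs1.const_mul 4).add ((iabs 3).const_mul 2)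
  have mpe := measurePreserving_eval (fun _ : ι => p) i
  have ibz : Integrable (fun z : ι → ℝ => 4 * |z i| + 2 * |z i| ^ 3) (iidLaw ι p) :=
    mpe.integrable_comp_of_integrable ib
  have ebz : ∫ z : ι → ℝ, (4 * |z i| + 2 * |z i| ^ 3) ∂(iidLaw ι p) =
      ∫ x, (4 * |x| + 2 * |x| ^ 3) ∂p :=
    mpe.integral_comp_aestronglyMeasurable (f := fun x : ℝ => 4 * |x| + 2 * |x| ^ 3)
      ib.aestronglyMeasurable
  rw [← ebz, ← integral_const_mul]
  refine norm_integral_le_of_norm_le (ibz.const_mul _) (Eventually.of_forall fun z => ?_)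
  have : g z + (z i : ℂ) ^ 3 * h z - g₀ z = (g z - g₀ z) + (z i : ℂ) ^ 3 * h z := by ring
  rw [this]
  refine (norm_add_le _ _).trans ?_
  rw [norm_mul, norm_pow, Complex.norm_real, Real.norm_eq_abs]
  calc _ ≤ 4 * κ ^ 3 * η ^ 4 * |z i| + |z i| ^ 3 * (2 * κ * (η * η * κ * η * κ * η)) :=
        add_le_add (bd z) (mul_le_mul_of_nonneg_left (bh z) (by positivity))
    _ = _ := by ring

end IntegrationByParts

/-! ### Contraction over the entries of the symmetric block -/

section SymmetricSum

variable {N : ℕ}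

theorem sum_ite_symIndex (x : Fin N × Fin N) (f : Fin N × Fin N → ℂ) :
    ∑ y, (if symIndex y = symIndex x then f y else 0) =
      f x.swap + if x.1 = x.2 then 0 else f x := by
  have h : ∀ y, symIndex y = symIndex x ↔ y = x ∨ y = x.swap := fun y => by
    rw [symIndex_eq_iff]
    have hx := (symIndex_eq_iff x (symIndex x)).1 rfl
    generalize symIndex x = q at hx
    rcases hx with rfl | rfl
    · rfl
    · rw [Prod.swap_swap]; tauto
  simp only [h]
  by_cases hx : x.1 = x.2
  · have : x.swap = x := by ext <;> simp [hx]
    simp [this, hx]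
  · have hne : x ≠ x.swap := fun h' => hx (congrArg Prod.fst h')
    rw [if_neg hx]
    have : ∀ y, (if y = x ∨ y = x.swap then f y else 0) =
        (if y = x.swap then f y else 0) + if y = x then f y else 0 := fun y => by
      by_cases h1 : y = x
      · subst h1; simp [hne]
      · simp [h1]
    simp_rw [this]
    rw [Finset.sum_add_distrib]
    simp

/-- Each free entry of B sits at a position and its transpose. Pairing a position with its transpose
yields the product of traces, of order N² for bounded U and V. Pairing an off-diagonal position with
itself yields a single sum, which is only of order N. The sign e enters squared. -/
theorem sum_trace_blockCoeff_mul {e : ℝ} (he : e ^ 2 = 1) (hN : 1 ≤ N)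
    (U V : Matrix (Fin N) (Fin N) ℂ) :
    ∑ q, ((blockCoeff e (Sum.inr q)).map Complex.ofReal *
      (U * (blockCoeff e (Sum.inr q)).map Complex.ofReal * V)).trace =
      (2 * (N : ℂ))⁻¹ * (U.trace * V.trace +
        ∑ x : Fin N × Fin N, if x.1 = x.2 then 0 else U x.2 x.1 * V x.2 x.1) := by
  set a : ℂ := (((Real.sqrt (2 * N))⁻¹ * e : ℝ) : ℂ) with ha
  have ha2 : a * a = (2 * (N : ℂ))⁻¹ := by
    rw [ha, ← Complex.ofReal_mul, ← sq, mul_pow, he, inv_sqrt_sq hN]; simp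
  have hB : ∀ q i j, ((blockCoeff e (Sum.inr q)).map Complex.ofReal : Matrix (Fin N) (Fin N) ℂ) i j
      = if symIndex (i, j) = q then a else 0 := fun q i j => by
    rw [Matrix.map_apply, blockCoeff_inr_apply]
    split_ifs <;> simp [ha]
  have inner : ∀ q (s t : Fin N), (U * (blockCoeff e (Sum.inr q)).map Complex.ofReal * V) s t =
      a * ∑ y : Fin N × Fin N, if symIndex y = q then U s y.1 * V y.2 t else 0 := fun q s t => by
    rw [Matrix.mul_apply, Fintype.sum_prod_type_right, Finset.mul_sum]
    refine Finset.sum_congr rfl fun d _ => ?_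
    rw [Matrix.mul_apply, Finset.sum_mul, Finset.mul_sum]
    refine Finset.sum_congr rfl fun c _ => ?_
    rw [hB]
    split_ifs <;> ring
  simp_rw [trace_mul_eq_sum_prod]
  rw [Finset.sum_comm]
  simp only [hB, inner, ite_mul, zero_mul, Finset.sum_ite_eq, Finset.mem_univ, if_true]
  have step : ∀ x : Fin N × Fin N,
      a * (a * ∑ y, if symIndex y = symIndex x then U x.2 y.1 * V y.2 x.1 else 0) =
      (2 * (N : ℂ))⁻¹ *
        (U x.2 x.2 * V x.1 x.1 + if x.1 = x.2 then 0 else U x.2 x.1 * V x.2 x.1) := fun x => by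
    rw [sum_ite_symIndex x, ← mul_assoc, ha2]
    rfl
  simp only [Prod.mk.eta, step]
  rw [← Finset.mul_sum, Finset.sum_add_distrib]
  congr 2
  rw [Fintype.sum_prod_type, Finset.sum_comm]
  simp only [Matrix.trace, Matrix.diag, Finset.sum_mul_sum]

/-- Cauchy–Schwarz in the Hilbert–Schmidt norm: bounding the n² terms separately would lose a factor
n. -/
theorem norm_sum_offDiag_mul_le {n : Type*} [Fintype n] [DecidableEq n] (U V : Matrix n n ℂ) :
    ‖∑ x : n × n, if x.1 = x.2 then 0 else U x.2 x.1 * V x.2 x.1‖ ≤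
      Fintype.card n * ‖U‖ * ‖V‖ := by
  have h1 : ‖∑ x : n × n, if x.1 = x.2 then 0 else U x.2 x.1 * V x.2 x.1‖ ≤
      ∑ x : n × n, ‖U x.2 x.1‖ * ‖V x.2 x.1‖ := by
    refine (norm_sum_le _ _).trans (Finset.sum_le_sum fun x _ => ?_)
    split_ifs
    · rw [norm_zero]; positivity
    · rw [norm_mul]
  have h2 : (∑ x : n × n, ‖U x.2 x.1‖ * ‖V x.2 x.1‖) ^ 2 ≤ (Fintype.card n * ‖U‖ * ‖V‖) ^ 2 := by
    refine (Finset.sum_mul_sq_le_sq_mul_sq _ _ _).trans ?_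
    rw [← hsSq_eq_sum_prod, ← hsSq_eq_sum_prod]
    calc hsSq U * hsSq V ≤ (Fintype.card n * ‖U‖ ^ 2) * (Fintype.card n * ‖V‖ ^ 2) :=
          mul_le_mul (hsSq_le U) (hsSq_le V) (hsSq_nonneg _) (by positivity)
      _ = _ := by ring
  exact h1.trans ((sq_le_sq₀ (by positivity) (by positivity)).1 h2)

end SymmetricSum

/-! ### The approximate self-consistent equation for the mean -/

section SelfConsistent

variable {N : ℕ}

/-- The mean Stieltjes transform of the normalized block sum. -/
def meanTr (e : ℝ) (p : Measure ℝ) (N : ℕ) (ζ : ℂ) : ℂ :=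
  ∫ z, normTrResol (blockSum e z) ζ ∂(iidLaw (DiscoIndex N) p)

theorem card_symIndex_fiber_le_two (q : {q : Fin N × Fin N // q.1 ≤ q.2}) :
    ((Finset.univ.filter fun x : Fin N × Fin N => symIndex x = q).card : ℝ) ≤ 2 := by
  have h : (Finset.univ.filter fun x : Fin N × Fin N => symIndex x = q) ⊆ {q.1, q.1.swap} := by
    intro x hx
    simpa [symIndex_eq_iff] using hx
  exact_mod_cast (Finset.card_le_card h).trans Finset.card_le_two

theorem norm_inv_sqrt_mul_sq (hN : 1 ≤ N) {e : ℝ} (he : e ^ 2 = 1) :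
    ‖((((Real.sqrt (2 * N))⁻¹ * e : ℝ)) : ℂ)‖ ^ 2 = (2 * (N : ℝ))⁻¹ := by
  rw [Complex.norm_real, Real.norm_eq_abs, sq_abs, mul_pow, he, mul_one, inv_sqrt_sq hN]

theorem map_blockCoeff_inr_apply (e : ℝ) (q : {q : Fin N × Fin N // q.1 ≤ q.2}) (x : Fin N × Fin N) :
    ((blockCoeff e (Sum.inr q)).map Complex.ofReal : Matrix (Fin N) (Fin N) ℂ) x.1 x.2 =
      if symIndex x = q then ((((Real.sqrt (2 * N))⁻¹ * e : ℝ)) : ℂ) else 0 := by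
  rw [Matrix.map_apply, blockCoeff_inr_apply]
  split_ifs <;> simp

/-- At most two entries are nonzero, each of square 1/(2N), and the Hilbert–Schmidt norm dominates
the operator norm. -/
theorem norm_blockCoeff_inr_le (hN : 1 ≤ N) {e : ℝ} (he : e ^ 2 = 1)
    (q : {q : Fin N × Fin N // q.1 ≤ q.2}) :
    ‖(blockCoeff e (Sum.inr q)).map Complex.ofReal‖ ≤ (Real.sqrt N)⁻¹ := by
  have hN' : (0 : ℝ) < N := by exact_mod_cast hN
  refine (sq_le_sq₀ (norm_nonneg _) (by positivity)).1 ((sq_norm_le_hsSq _).trans ?_)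
  rw [inv_pow, Real.sq_sqrt hN'.le, hsSq, ← Fintype.sum_prod_type']
  simp only [map_blockCoeff_inr_apply]
  have : ∀ x : Fin N × Fin N, ‖(if symIndex x = q then ((((Real.sqrt (2 * N))⁻¹ * e : ℝ)) : ℂ)
      else 0)‖ ^ 2 = if symIndex x = q then (2 * (N : ℝ))⁻¹ else 0 := fun x => by
    split_ifs
    · exact norm_inv_sqrt_mul_sq hN he
    · simp
  rw [Finset.sum_congr rfl fun x _ => this x, ← Finset.sum_filter, Finset.sum_const, nsmul_eq_mul]
  calc _ ≤ 2 * (2 * (N : ℝ))⁻¹ := by gcongr; exact card_symIndex_fiber_le_two q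
    _ = (N : ℝ)⁻¹ := by field_simp

theorem norm_trace_blockCoeff_inr_mul_le (hN : 1 ≤ N) {e : ℝ} (he : e ^ 2 = 1)
    (q : {q : Fin N × Fin N // q.1 ≤ q.2}) (X : Matrix (Fin N) (Fin N) ℂ) :
    ‖((blockCoeff e (Sum.inr q)).map Complex.ofReal * X).trace‖ ≤ 2 * (Real.sqrt N)⁻¹ * ‖X‖ := by
  have hN' : (0 : ℝ) < N := by exact_mod_cast hN
  set a := ((((Real.sqrt (2 * N))⁻¹ * e : ℝ)) : ℂ) with ha
  have han : ‖a‖ ≤ (Real.sqrt N)⁻¹ := by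
    refine (sq_le_sq₀ (norm_nonneg _) (by positivity)).1 ?_
    rw [norm_inv_sqrt_mul_sq hN he, inv_pow, Real.sq_sqrt hN'.le]
    exact inv_anti₀ hN' (by linarith)
  rw [trace_mul_eq_sum_prod]
  have : ∀ x : Fin N × Fin N, ((blockCoeff e (Sum.inr q)).map Complex.ofReal :
      Matrix (Fin N) (Fin N) ℂ) x.1 x.2 * X x.2 x.1 = if symIndex x = q then a * X x.2 x.1 else 0 :=
    fun x => by rw [map_blockCoeff_inr_apply, ite_mul, zero_mul]
  rw [Finset.sum_congr rfl fun x _ => this x, ← Finset.sum_filter]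
  calc _ ≤ ∑ x ∈ Finset.univ.filter (fun x : Fin N × Fin N => symIndex x = q),
        (Real.sqrt N)⁻¹ * ‖X‖ := by
        refine (norm_sum_le _ _).trans (Finset.sum_le_sum fun x _ => ?_)
        rw [norm_mul]
        exact mul_le_mul han (norm_entry_le _ _ _) (norm_nonneg _) (by positivity)
    _ ≤ 2 * ((Real.sqrt N)⁻¹ * ‖X‖) := by
        rw [Finset.sum_const, nsmul_eq_mul]
        gcongr
        exact card_symIndex_fiber_le_two q
    _ = _ := by ring

theorem continuous_blockSum (e : ℝ) : Continuous (blockSum (N := N) e) := by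
  have : blockSum (N := N) e = pencil (blockCoeff e) := funext fun z => blockSum_eq_pencil e z
  rw [this]
  exact continuous_pencil

theorem blockSum_sub_blockSum_zero (e : ℝ) (z : DiscoIndex N → ℝ) :
    blockSum e z - blockSum 0 z = ∑ q, z (Sum.inr q) • blockCoeff e (Sum.inr q) := by
  ext i j
  rw [Matrix.sub_apply, blockSum_apply, blockSum_apply, Matrix.sum_apply]
  simp only [Matrix.smul_apply, blockCoeff_inr_apply, smul_eq_mul, mul_ite, mul_zero,
    Finset.sum_ite_eq, Finset.mem_univ, if_true]
  ring

theorem blockSum_zero_update_inr (z : DiscoIndex N → ℝ) (q : {q : Fin N × Fin N // q.1 ≤ q.2})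
    (u : ℝ) : blockSum 0 (Function.update z (Sum.inr q) u) = blockSum 0 z := by
  ext i j
  simp [blockSum_apply]

theorem normTrResol_im_nonneg {n : Type*} [Fintype n] [DecidableEq n] {M : Matrix n n ℝ}
    (hM : M.IsHermitian) {ζ : ℂ} (hζ : 0 < ζ.im) : 0 ≤ (normTrResol M ζ).im := by
  rw [normTrResol, trace_resol hM hζ.ne']
  have : ((Fintype.card n : ℂ)⁻¹ * ∑ i, ((hM.eigenvalues i : ℂ) - ζ)⁻¹).im =
      (Fintype.card n : ℝ)⁻¹ * ∑ i, (((hM.eigenvalues i : ℂ) - ζ)⁻¹).im := by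
    rw [← Complex.im_sum, ← Complex.ofReal_natCast, ← Complex.ofReal_inv, Complex.im_ofReal_mul]
  rw [this]
  refine mul_nonneg (by positivity) (Finset.sum_nonneg fun i _ => ?_)
  rw [Complex.inv_im]
  refine div_nonneg ?_ (Complex.normSq_nonneg _)
  simp [hζ.le]

theorem meanTr_im_nonneg {p : Measure ℝ} [IsProbabilityMeasure p] (e : ℝ) {ζ : ℂ}
    (hζ : 0 < ζ.im) : 0 ≤ (meanTr e p N ζ).im := by
  have hi : Integrable (fun z => normTrResol (blockSum (N := N) e z) ζ) (iidLaw (DiscoIndex N) p) :=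
    integrable_of_bounded (continuous_normTrResol (continuous_blockSum e) (blockSum_isHermitian e)
      hζ.ne').aestronglyMeasurable fun z => norm_normTrResol_le (blockSum_isHermitian e z) hζ.ne'
  have : (meanTr e p N ζ).im = ∫ z, (normTrResol (blockSum e z) ζ).im ∂(iidLaw (DiscoIndex N) p) :=
    (integral_im hi).symm
  rw [this]
  exact integral_nonneg fun z => normTrResol_im_nonneg (blockSum_isHermitian e z) hζ

theorem norm_meanTr_le {p : Measure ℝ} [IsProbabilityMeasure p] (e : ℝ) {ζ : ℂ}
    (hζ : ζ.im ≠ 0) : ‖meanTr e p N ζ‖ ≤ |ζ.im|⁻¹ := by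
  refine (norm_integral_le_of_norm_le_const (Eventually.of_forall fun z =>
    norm_normTrResol_le (blockSum_isHermitian e z) hζ)).trans ?_
  simp

/-- The approximate self-consistent equation for the mean Stieltjes transform. -/
theorem norm_meanTr_sub_meanTr_zero_le {p : Measure ℝ} (hp : IsEntryLaw p) {e : ℝ}
    (he : e ^ 2 = 1) {ζ : ℂ} (hζ : 0 < ζ.im) (hN : 1 ≤ N) :
    ‖meanTr e p N ζ - meanTr 0 p N (ζ + meanTr e p N ζ / 2)‖ ≤
      2⁻¹ * ζ.im⁻¹ ^ 2 *
        ∫ z, ‖normTrResol (blockSum e z) ζ - meanTr e p N ζ‖ ∂(iidLaw (DiscoIndex N) p) +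
      ζ.im⁻¹ ^ 3 * (N : ℝ)⁻¹ +
      ζ.im⁻¹ ^ 4 * (∫ x, (4 * |x| + 2 * |x| ^ 3) ∂p) * (Real.sqrt N)⁻¹ := by
  have := hp.isProbabilityMeasure
  have hN' : (0 : ℝ) < N := by exact_mod_cast hN
  have hNC : (N : ℂ) ≠ 0 := by exact_mod_cast hN'.ne'
  set P := iidLaw (DiscoIndex N) p with hP
  set b := meanTr e p N ζ with hb
  set w := ζ + b / 2 with hw
  set η := ζ.im⁻¹ with hη
  have hη0 : 0 < η := by positivity
  have habs : |ζ.im|⁻¹ = η := by rw [abs_of_pos hζ]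
  have hbim : 0 ≤ b.im := meanTr_im_nonneg e hζ
  -- The shifted point stays at height at least Im ζ because a mean Stieltjes transform has
  -- nonnegative imaginary part; so R obeys the same norm bound as G.
  have hwim : ζ.im ≤ w.im := by
    rw [hw, Complex.add_im, show (b / 2).im = b.im / 2 by simp]
    linarith
  have hw0 : 0 < w.im := hζ.trans_le hwim
  set G : (DiscoIndex N → ℝ) → Matrix (Fin N) (Fin N) ℂ := fun z => resol (blockSum e z) ζ with hG
  set R : (DiscoIndex N → ℝ) → Matrix (Fin N) (Fin N) ℂ := fun z => resol (blockSum 0 z) w with hR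
  set F : {q : Fin N × Fin N // q.1 ≤ q.2} → Matrix (Fin N) (Fin N) ℂ :=
    fun q => (blockCoeff e (Sum.inr q)).map Complex.ofReal with hF
  have hGc : Continuous G := continuous_resol (continuous_blockSum e) (blockSum_isHermitian e) hζ.ne'
  have hRc : Continuous R := continuous_resol (continuous_blockSum 0) (blockSum_isHermitian 0) hw0.ne'
  have hGn : ∀ z, ‖G z‖ ≤ η := fun z => habs ▸ norm_resol_le (blockSum_isHermitian e z) hζ.ne'
  have hRn : ∀ z, ‖R z‖ ≤ η := fun z => by
    refine (norm_resol_le (blockSum_isHermitian 0 z) hw0.ne').trans ?_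
    rw [abs_of_pos hw0]
    exact inv_anti₀ hζ hwim
  set s : (DiscoIndex N → ℝ) → ℂ := fun z => normTrResol (blockSum e z) ζ with hs
  set r : (DiscoIndex N → ℝ) → ℂ := fun z => normTrResol (blockSum 0 z) w with hr
  set t : (DiscoIndex N → ℝ) → ℂ := fun z => (N : ℂ)⁻¹ * (R z * G z).trace with ht
  set ρ : (DiscoIndex N → ℝ) → ℂ := fun z =>
    ∑ x : Fin N × Fin N, if x.1 = x.2 then 0 else (R z * G z) x.2 x.1 * G z x.2 x.1 with hρ
  set h : {q : Fin N × Fin N // q.1 ≤ q.2} → (DiscoIndex N → ℝ) → ℂ := fun q z =>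
    (z (Sum.inr q) : ℂ) * (F q * (R z * G z)).trace + (F q * (R z * G z * F q * G z)).trace with hh
  have hibp : ∀ q, ‖∫ z, h q z ∂P‖ ≤ (Real.sqrt N)⁻¹ ^ 3 * η ^ 4 *
      ∫ x, (4 * |x| + 2 * |x| ^ 3) ∂p := fun q => by
    have := norm_integral_coord_mul_trace_add_le hp (blockCoeff_isHermitian (N := N) e) hζ.ne'
      (Sum.inr q) (norm_blockCoeff_inr_le hN he q) (norm_trace_blockCoeff_inr_mul_le hN he q) hRc
      (fun z => habs.symm ▸ hRn z)
      (fun z u => by simp only [hR, blockSum_zero_update_inr])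
    simp only [← blockSum_eq_pencil, habs] at this
    exact this
  have hint : ∀ q, Integrable (h q) P := fun q => by
    have c1 : Continuous fun z => (F q * (R z * G z)).trace :=
      (continuous_const.mul (hRc.mul hGc)).matrix_trace
    have c2 : Continuous fun z => (F q * (R z * G z * F q * G z)).trace :=
      (continuous_const.mul (((hRc.mul hGc).mul continuous_const).mul hGc)).matrix_trace
    have i0 : Integrable (fun z : DiscoIndex N → ℝ => (z (Sum.inr q) : ℂ)) P := by
      simpa using integrable_coord_pow (p := p) (Sum.inr q : DiscoIndex N) (hp.integrable_pow 1)
    refine Integrable.add (i0.mul_bdd (c := 2 * (Real.sqrt N)⁻¹ * (η * η)) c1.aestronglyMeasurable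
      (Eventually.of_forall fun z => ?_))
      (integrable_of_bounded c2.aestronglyMeasurable
        (C := 2 * (Real.sqrt N)⁻¹ * (η * η * ‖F q‖ * η)) fun z => ?_)
    · exact (norm_trace_blockCoeff_inr_mul_le hN he q _).trans
        (mul_le_mul_of_nonneg_left (norm_matrix_mul_le (hRn z) (hGn z)) (by positivity))
    · exact (norm_trace_blockCoeff_inr_mul_le hN he q _).trans
        (mul_le_mul_of_nonneg_left (norm_matrix_mul_le (norm_matrix_mul_le
          (norm_matrix_mul_le (hRn z) (hGn z)) le_rfl) (hGn z)) (by positivity))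
  -- The resolvent identity gives a term linear in the entries of B and the term -b t/2 from the
  -- shift. Adding and subtracting the contraction turns the linear term into the integration by
  -- parts errors h plus s t/2 and the lower order ρ. The shift b/2 is chosen so that only (s - b)
  -- t/2 remains, which is small by concentration.
  have point : ∀ z, s z - r z = 2⁻¹ * ((s z - b) * t z) + (2 * (N : ℂ) ^ 2)⁻¹ * ρ z -
      (N : ℂ)⁻¹ * ∑ q, h q z := fun z => by
    have hres := resol_sub_resol (blockSum_isHermitian e z) (blockSum_isHermitian 0 z) hζ.ne' hw0.ne'
    have hK : (blockSum 0 z - blockSum e z).map Complex.ofReal =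
        -∑ q, (z (Sum.inr q) : ℂ) • F q := by
      have : blockSum 0 z - blockSum e z = -∑ q, z (Sum.inr q) • blockCoeff e (Sum.inr q) := by
        rw [← blockSum_sub_blockSum_zero]; abel
      rw [this]
      ext i j
      simp [Matrix.sum_apply, hF]
    rw [hK] at hres
    change G z - R z = G z * _ * R z at hres
    have htr : (G z).trace - (R z).trace = -(∑ q, (z (Sum.inr q) : ℂ) * (F q * (R z * G z)).trace) -
        (b / 2) * (R z * G z).trace := by
      rw [← Matrix.trace_sub, hres, Matrix.trace_mul_comm, ← mul_assoc, mul_add, Matrix.trace_add,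
        mul_neg, Matrix.trace_neg, Finset.mul_sum, Matrix.trace_sum]
      have hzw : ζ - w = -(b / 2) := by rw [hw]; ring
      rw [hzw, mul_smul_comm, mul_one, Matrix.trace_smul, smul_eq_mul, neg_mul, ← sub_eq_add_neg]
      congr 2
      refine Finset.sum_congr rfl fun q _ => ?_
      rw [mul_smul_comm, Matrix.trace_smul, smul_eq_mul, Matrix.trace_mul_comm]
    have hsum := sum_trace_blockCoeff_mul he hN (R z * G z) (G z)
    change ∑ q, (F q * (R z * G z * F q * G z)).trace = _ * (_ + ρ z) at hsum
    have e1 : s z = (N : ℂ)⁻¹ * (G z).trace := by simp [hs, normTrResol, hG]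
    have e2 : r z = (N : ℂ)⁻¹ * (R z).trace := by simp [hr, normTrResol, hR]
    have e3 : (G z).trace = N * s z := by rw [e1, mul_inv_cancel_left₀ hNC]
    have e4 : (R z * G z).trace = N * t z := by simp only [ht]; rw [mul_inv_cancel_left₀ hNC]
    have e5 : s z - r z = (N : ℂ)⁻¹ * ((G z).trace - (R z).trace) := by rw [e1, e2]; ring
    have e6 : ∑ q, h q z = ∑ q, (z (Sum.inr q) : ℂ) * (F q * (R z * G z)).trace +
        ∑ q, (F q * (R z * G z * F q * G z)).trace := Finset.sum_add_distrib
    rw [e6, hsum, e5, htr, e3, e4]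
    field_simp
    ring
  have hsc : Continuous s := continuous_normTrResol (continuous_blockSum e)
    (blockSum_isHermitian e) hζ.ne'
  have hrc : Continuous r := continuous_normTrResol (continuous_blockSum 0)
    (blockSum_isHermitian 0) hw0.ne'
  have hsn : ∀ z, ‖s z‖ ≤ η := fun z => habs ▸ norm_normTrResol_le (blockSum_isHermitian e z) hζ.ne'
  have hrn : ∀ z, ‖r z‖ ≤ |w.im|⁻¹ := fun z => norm_normTrResol_le (blockSum_isHermitian 0 z) hw0.ne'
  have si : Integrable s P := integrable_of_bounded hsc.aestronglyMeasurable hsn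
  have ri : Integrable r P := integrable_of_bounded hrc.aestronglyMeasurable hrn
  have hi : Integrable (fun z => (N : ℂ)⁻¹ * ∑ q, h q z) P :=
    (integrable_finsetSum _ fun q _ => hint q).const_mul _
  have hsi : Integrable (fun z => s z - r z) P := si.sub ri
  have hmain : b - meanTr 0 p N w = ∫ z, (2⁻¹ * ((s z - b) * t z) + (2 * (N : ℂ) ^ 2)⁻¹ * ρ z) ∂P -
      (N : ℂ)⁻¹ * ∑ q, ∫ z, h q z ∂P := by
    have e1 : b - meanTr 0 p N w = ∫ z, (s z - r z) ∂P := (integral_sub si ri).symm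
    have e2 : (N : ℂ)⁻¹ * ∑ q, ∫ z, h q z ∂P = ∫ z, (N : ℂ)⁻¹ * ∑ q, h q z ∂P := by
      rw [integral_const_mul, integral_finsetSum _ fun q _ => hint q]
    rw [e1, e2, eq_sub_iff_add_eq, ← integral_add hsi hi]
    refine integral_congr_ae (Eventually.of_forall fun z => ?_)
    dsimp only
    rw [point z]; ring
  rw [hmain]
  have htn : ∀ z, ‖t z‖ ≤ η ^ 2 := fun z => by
    simp only [ht]
    rw [norm_mul, norm_inv, Complex.norm_natCast, inv_mul_le_iff₀ hN', sq]
    have := norm_trace_le (R z * G z)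
    rw [Fintype.card_fin] at this
    exact this.trans (mul_le_mul_of_nonneg_left (norm_matrix_mul_le (hRn z) (hGn z)) hN'.le)
  have hρn : ∀ z, ‖ρ z‖ ≤ N * η ^ 3 := fun z => by
    refine (norm_sum_offDiag_mul_le (R z * G z) (G z)).trans ?_
    rw [Fintype.card_fin, mul_assoc, show η ^ 3 = η * η * η by ring]
    gcongr
    · exact norm_matrix_mul_le (hRn z) (hGn z)
    · exact hGn z
  have first : ‖∫ z, (2⁻¹ * ((s z - b) * t z) + (2 * (N : ℂ) ^ 2)⁻¹ * ρ z) ∂P‖ ≤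
      2⁻¹ * η ^ 2 * ∫ z, ‖s z - b‖ ∂P + η ^ 3 * (N : ℝ)⁻¹ := by
    have isb : Integrable (fun z => ‖s z - b‖) P := (si.sub (integrable_const b)).norm
    have : 2⁻¹ * η ^ 2 * ∫ z, ‖s z - b‖ ∂P + η ^ 3 * (N : ℝ)⁻¹ =
        ∫ z, (2⁻¹ * η ^ 2 * ‖s z - b‖ + η ^ 3 * (N : ℝ)⁻¹) ∂P := by
      rw [integral_add (isb.const_mul _) (integrable_const _), integral_const_mul]
      simp
    rw [this]
    refine norm_integral_le_of_norm_le ((isb.const_mul _).add (integrable_const _))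
      (Eventually.of_forall fun z => (norm_add_le _ _).trans (add_le_add ?_ ?_))
    · rw [norm_mul, norm_mul, norm_inv, Complex.norm_ofNat, mul_assoc, mul_comm ‖s z - b‖]
      gcongr
      exact htn z
    · rw [norm_mul, norm_inv, norm_mul, norm_pow, Complex.norm_natCast, Complex.norm_ofNat]
      calc (2 * (N : ℝ) ^ 2)⁻¹ * ‖ρ z‖ ≤ (2 * (N : ℝ) ^ 2)⁻¹ * (N * η ^ 3) := by
            gcongr; exact hρn z
        _ = 2⁻¹ * (η ^ 3 * (N : ℝ)⁻¹) := by field_simp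
        _ ≤ _ := by nlinarith [show 0 ≤ η ^ 3 * (N : ℝ)⁻¹ by positivity]
  have m0 : 0 ≤ ∫ x, (4 * |x| + 2 * |x| ^ 3) ∂p := integral_nonneg fun x => by positivity
  set m := ∫ x, (4 * |x| + 2 * |x| ^ 3) ∂p with hm
  have second : ‖(N : ℂ)⁻¹ * ∑ q, ∫ z, h q z ∂P‖ ≤ η ^ 4 * m * (Real.sqrt N)⁻¹ := by
    rw [norm_mul, norm_inv, Complex.norm_natCast]
    have hs0 : 0 < Real.sqrt N := by positivity
    have hsq : Real.sqrt N ^ 2 = N := Real.sq_sqrt hN'.le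
    have hcard : (Fintype.card {q : Fin N × Fin N // q.1 ≤ q.2} : ℝ) ≤ (N : ℝ) ^ 2 := by
      have : Fintype.card {q : Fin N × Fin N // q.1 ≤ q.2} ≤ N ^ 2 := by
        refine (Fintype.card_subtype_le _).trans ?_
        simp [sq]
      exact_mod_cast this
    -- At most N² errors of order N^(-3/2), divided by N, leave N^(-1/2).
    calc (N : ℝ)⁻¹ * ‖∑ q, ∫ z, h q z ∂P‖
        ≤ (N : ℝ)⁻¹ * ∑ q : {q : Fin N × Fin N // q.1 ≤ q.2}, (Real.sqrt N)⁻¹ ^ 3 * η ^ 4 * m := by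
          gcongr
          exact (norm_sum_le _ _).trans (Finset.sum_le_sum fun q _ => hibp q)
      _ = (N : ℝ)⁻¹ * (Fintype.card {q : Fin N × Fin N // q.1 ≤ q.2} *
          ((Real.sqrt N)⁻¹ ^ 3 * η ^ 4 * m)) := by
          rw [Finset.sum_const, nsmul_eq_mul, Finset.card_univ]
      _ ≤ (N : ℝ)⁻¹ * ((N : ℝ) ^ 2 * ((Real.sqrt N)⁻¹ ^ 3 * η ^ 4 * m)) := by gcongr
      _ = η ^ 4 * m * (Real.sqrt N)⁻¹ * (((N : ℝ)⁻¹ * N) * (N * ((Real.sqrt N)⁻¹ ^ 2))) := by ring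
      _ = _ := by
          rw [inv_mul_cancel₀ hN'.ne', show (Real.sqrt N)⁻¹ ^ 2 = (N : ℝ)⁻¹ by rw [inv_pow, hsq],
            mul_inv_cancel₀ hN'.ne']
          ring
  exact (norm_sub_le _ _).trans (add_le_add first second)

/-- Pointwise a ≤ t + a⁴/t³ for a ≥ 0, which makes the fourth moment bound usable for the first
moment. -/
theorem integral_norm_normTrResol_sub_le {p : Measure ℝ} [IsProbabilityMeasure p] (e : ℝ)
    {ζ : ℂ} (hζ : ζ.im ≠ 0) {t : ℝ} (ht : 0 < t) :
    ∫ z, ‖normTrResol (blockSum e z) ζ - meanTr e p N ζ‖ ∂(iidLaw (DiscoIndex N) p) ≤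
      t + (∫ z, ‖normTrResol (blockSum e z) ζ - meanTr e p N ζ‖ ^ 4 ∂(iidLaw (DiscoIndex N) p)) /
        t ^ 3 := by
  have hc : Continuous fun z => ‖normTrResol (blockSum (N := N) e z) ζ - meanTr e p N ζ‖ :=
    ((continuous_normTrResol (continuous_blockSum e) (blockSum_isHermitian e) hζ).sub
      continuous_const).norm
  have hb : ∀ z : DiscoIndex N → ℝ, ‖normTrResol (blockSum e z) ζ - meanTr e p N ζ‖ ≤
      |ζ.im|⁻¹ + ‖meanTr e p N ζ‖ := fun z =>
    (norm_sub_le _ _).trans (by gcongr; exact norm_normTrResol_le (blockSum_isHermitian e z) hζ)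
  have i4 : Integrable (fun z => ‖normTrResol (blockSum e z) ζ - meanTr e p N ζ‖ ^ 4)
      (iidLaw (DiscoIndex N) p) :=
    integrable_of_bounded (hc.pow 4).aestronglyMeasurable
      (C := (|ζ.im|⁻¹ + ‖meanTr e p N ζ‖) ^ 4) fun z => by
        rw [norm_pow, norm_norm]; exact pow_le_pow_left₀ (norm_nonneg _) (hb z) 4
  have : t + (∫ z, ‖normTrResol (blockSum e z) ζ - meanTr e p N ζ‖ ^ 4
      ∂(iidLaw (DiscoIndex N) p)) / t ^ 3 =
      ∫ z, (t + ‖normTrResol (blockSum e z) ζ - meanTr e p N ζ‖ ^ 4 / t ^ 3)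
        ∂(iidLaw (DiscoIndex N) p) := by
    rw [integral_add (integrable_const _) (i4.div_const _), integral_div]
    simp
  rw [this]
  refine integral_mono_of_nonneg (Eventually.of_forall fun z => norm_nonneg _)
    ((integrable_const _).add (i4.div_const _)) (Eventually.of_forall fun z => ?_)
  dsimp only
  set a := ‖normTrResol (blockSum e z) ζ - meanTr e p N ζ‖
  have ha : 0 ≤ a := norm_nonneg _
  rcases le_total a t with h | h
  · have : 0 ≤ a ^ 4 / t ^ 3 := by positivity
    linarith
  · have : a ≤ a ^ 4 / t ^ 3 := by
      rw [le_div_iff₀ (by positivity), show a ^ 4 = a * a ^ 3 by ring]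
      gcongr
    linarith

theorem tendsto_meanTr_sub_meanTr_zero {p : Measure ℝ} (hp : IsEntryLaw p) {e : ℝ}
    (he : e ^ 2 = 1) {ζ : ℂ} (hζ : 0 < ζ.im) :
    Tendsto (fun N => meanTr e p N ζ - meanTr 0 p N (ζ + meanTr e p N ζ / 2)) atTop (𝓝 0) := by
  have := hp.isProbabilityMeasure
  obtain ⟨C, hC0, hC⟩ := integral_normTrResol_blockSum_sub_pow_four_le hp he hζ.ne'
  have hN : Tendsto (fun N : ℕ => (N : ℝ)⁻¹) atTop (𝓝 0) := tendsto_inv_atTop_nhds_zero_nat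
  have hs : Tendsto (fun N : ℕ => (Real.sqrt N)⁻¹) atTop (𝓝 0) :=
    (tendsto_inv_atTop_zero.comp Real.tendsto_sqrt_atTop).comp tendsto_natCast_atTop_atTop
  have h1 : Tendsto (fun N : ℕ => ∫ z, ‖normTrResol (blockSum e z) ζ - meanTr e p N ζ‖
      ∂(iidLaw (DiscoIndex N) p)) atTop (𝓝 0) := by
    rw [Metric.tendsto_atTop']
    intro ε hε
    have h2 : Tendsto (fun N : ℕ => C / (ε / 2) ^ 3 * ((N : ℝ)⁻¹ * (Real.sqrt N)⁻¹)) atTop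
        (𝓝 (C / (ε / 2) ^ 3 * (0 * 0))) := (hN.mul hs).const_mul _
    rw [mul_zero, mul_zero] at h2
    obtain ⟨n₀, hn₀⟩ := (h2.eventually (gt_mem_nhds (half_pos hε))).exists_forall_of_atTop
    refine ⟨n₀, fun n hn => ?_⟩
    rw [Real.dist_0_eq_abs, abs_of_nonneg (integral_nonneg fun _ => norm_nonneg _)]
    refine (integral_norm_normTrResol_sub_le e hζ.ne' (half_pos hε)).trans_lt ?_
    have h3 := hC n (by omega)
    have h4 := hn₀ n hn.le
    have h5 : (∫ z, ‖normTrResol (blockSum e z) ζ - meanTr e p n ζ‖ ^ 4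
        ∂(iidLaw (DiscoIndex n) p)) / (ε / 2) ^ 3 ≤
        C / (ε / 2) ^ 3 * ((n : ℝ)⁻¹ * (Real.sqrt n)⁻¹) := by
      rw [← mul_inv, ← div_eq_mul_inv, div_right_comm]
      gcongr
      exact h3
    linarith
  have h2 : Tendsto (fun N : ℕ => 2⁻¹ * ζ.im⁻¹ ^ 2 *
        ∫ z, ‖normTrResol (blockSum e z) ζ - meanTr e p N ζ‖ ∂(iidLaw (DiscoIndex N) p) +
      ζ.im⁻¹ ^ 3 * (N : ℝ)⁻¹ +
      ζ.im⁻¹ ^ 4 * (∫ x, (4 * |x| + 2 * |x| ^ 3) ∂p) * (Real.sqrt N)⁻¹) atTop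
      (𝓝 (2⁻¹ * ζ.im⁻¹ ^ 2 * 0 + ζ.im⁻¹ ^ 3 * 0 +
        ζ.im⁻¹ ^ 4 * (∫ x, (4 * |x| + 2 * |x| ^ 3) ∂p) * 0)) :=
    ((h1.const_mul _).add (hN.const_mul _)).add (hs.const_mul _)
  simp only [mul_zero, add_zero] at h2
  refine squeeze_zero_norm' ?_ h2
  filter_upwards [eventually_ge_atTop 1] with N hN
  exact norm_meanTr_sub_meanTr_zero_le hp he hζ hN

end SelfConsistent

/-! ### Circulant matrices and the variances of their eigenvalues -/

section Circulant

/-- The characters of ℤ/n diagonalize a circulant: F below is the Fourier matrix and F' its inverse.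
Evenness of b makes the eigenvalues real cosine sums. -/
theorem trace_resol_circulant {n : ℕ} [NeZero n] {b : ZMod n → ℝ} (hb : ∀ d, b (-d) = b d)
    {w : ℂ} (hw : w.im ≠ 0) :
    (resol (Matrix.circulant b) w).trace =
      ∑ k : ZMod n, (((∑ d, b d * (ZMod.stdAddChar (d * k) : ℂ).re : ℝ) : ℂ) - w)⁻¹ := by
  set ψ : AddChar (ZMod n) ℂ := ZMod.stdAddChar with hψ
  have hn : (n : ℂ) ≠ 0 := by exact_mod_cast NeZero.ne n
  set lam : ZMod n → ℝ := fun k => ∑ d, b d * (ψ (d * k)).re with hlam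
  have hlamC : ∀ k, ∑ d, (b d : ℂ) * ψ (-(d * k)) = lam k := by
    intro k
    set S := ∑ d, (b d : ℂ) * ψ (-(d * k)) with hS
    have h1 : S = ∑ d, (b d : ℂ) * ψ (d * k) := by
      rw [hS, ← Equiv.sum_comp (Equiv.neg (ZMod n))]
      refine Finset.sum_congr rfl fun d _ => ?_
      simp [hb]
    have h2 : (starRingEnd ℂ) S = S := by
      conv_rhs => rw [h1]
      rw [hS, map_sum]
      refine Finset.sum_congr rfl fun d _ => ?_
      rw [map_mul, AddChar.map_neg_eq_conj, Complex.conj_conj, Complex.conj_ofReal]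
    rw [Complex.conj_eq_iff_re] at h2
    rw [← h2, h1, Complex.re_sum]
    congr 1
    refine Finset.sum_congr rfl fun d _ => ?_
    rw [Complex.re_ofReal_mul]
  set F : Matrix (ZMod n) (ZMod n) ℂ := Matrix.of fun i k => ψ (i * k) with hF
  set F' : Matrix (ZMod n) (ZMod n) ℂ := Matrix.of fun k i => (n : ℂ)⁻¹ * ψ (-(k * i)) with hF'
  have hFF : F' * F = 1 := by
    ext k l
    simp only [hF, hF', Matrix.mul_apply, Matrix.of_apply]
    have : ∀ i, (n : ℂ)⁻¹ * ψ (-(k * i)) * ψ (i * l) = (n : ℂ)⁻¹ * ψ (i * (l - k)) := fun i => by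
      rw [mul_assoc, ← AddChar.map_add_eq_mul]
      congr 2; ring
    rw [Finset.sum_congr rfl fun i _ => this i, ← Finset.mul_sum,
      AddChar.sum_mulShift _ (ZMod.isPrimitive_stdAddChar n), ZMod.card]
    by_cases h : k = l
    · subst h; simp [hn]
    · rw [if_neg (by rwa [sub_eq_zero, eq_comm]), Matrix.one_apply_ne h]
      simp
  have hFF2 : F * F' = 1 := mul_eq_one_comm.1 hFF
  have hcF : (Matrix.circulant b).map Complex.ofReal * F =
      F * Matrix.diagonal (fun k => (lam k : ℂ)) := by
    ext i k
    rw [Matrix.mul_diagonal, ← hlamC k, Finset.mul_sum, Matrix.mul_apply,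
      ← Equiv.sum_comp (Equiv.subLeft i)]
    refine Finset.sum_congr rfl fun d _ => ?_
    simp only [hF, Matrix.map_apply, Matrix.circulant_apply, Matrix.of_apply, Equiv.subLeft_apply,
      sub_sub_cancel]
    rw [mul_left_comm, ← AddChar.map_add_eq_mul]
    congr 2; ring
  have hsub : (Matrix.circulant b).map Complex.ofReal - w • 1 =
      F * Matrix.diagonal (fun k => (lam k : ℂ) - w) * F' := by
    have : Matrix.diagonal (fun k => (lam k : ℂ) - w) =
        Matrix.diagonal (fun k => (lam k : ℂ)) - w • 1 := by
      ext i j; by_cases h : i = j <;> simp [h]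
    rw [this, mul_sub, ← hcF, sub_mul, mul_smul_comm, mul_one, smul_mul_assoc, mul_assoc, hFF2,
      mul_one]
  have hres : resol (Matrix.circulant b) w =
      F * Matrix.diagonal (fun k => ((lam k : ℂ) - w)⁻¹) * F' := by
    refine Matrix.inv_eq_right_inv ?_
    rw [hsub]
    calc _ = F * (Matrix.diagonal (fun k => (lam k : ℂ) - w) * (F' * F) *
          Matrix.diagonal (fun k => ((lam k : ℂ) - w)⁻¹)) * F' := by simp only [mul_assoc]
      _ = 1 := by
          rw [hFF, mul_one, Matrix.diagonal_mul_diagonal]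
          have : (fun k => ((lam k : ℂ) - w) * ((lam k : ℂ) - w)⁻¹) = fun _ => 1 := by
            ext k; exact mul_inv_cancel₀ (ofReal_sub_ne_zero _ hw)
          rw [this, Matrix.diagonal_one, mul_one, hFF2]
  rw [hres, Matrix.trace_mul_cycle, hFF, one_mul, Matrix.trace_diagonal]

/-- The free parameter on the `d`-th cyclic diagonal. -/
def toepIdx {m : ℕ} (d : ZMod (m + 1)) : Fin ((m + 2 + 1) / 2) :=
  ⟨min d.val (m + 1 - d.val), by omega⟩

theorem toepIdx_neg {m : ℕ} (d : ZMod (m + 1)) : toepIdx (-d) = toepIdx d := by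
  ext
  simp only [toepIdx, ZMod.neg_val]
  have := d.val_lt
  split_ifs with h
  · subst h; simp
  · omega

theorem toepIdx_eq_iff {m : ℕ} (d d' : ZMod (m + 1)) : toepIdx d = toepIdx d' ↔ d = d' ∨ d = -d' := by
  constructor
  · intro h
    have h' := congrArg Fin.val h
    simp only [toepIdx] at h'
    have h1 := d.val_lt
    have h2 := d'.val_lt
    by_cases h0 : d' = 0
    · subst h0
      left
      simp only [ZMod.val_zero] at h'
      exact ZMod.val_injective _ (by rw [ZMod.val_zero]; omega)
    · have h3 := ZMod.neg_val d'
      rw [if_neg h0] at h3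
      have h4 : d'.val ≠ 0 := by rwa [Ne, ZMod.val_eq_zero]
      rcases (by omega : d.val = d'.val ∨ d.val = m + 1 - d'.val) with h5 | h5
      · exact Or.inl (ZMod.val_injective _ h5)
      · exact Or.inr (ZMod.val_injective _ (by rw [h3, h5]))
  · rintro (rfl | rfl)
    · rfl
    · exact toepIdx_neg d'

/-- For size N = m + 2 the palindrome symmetry is d ↦ N - 1 - d = m + 1 - d, which is negation
modulo m + 1. So the corner without the last row and column is a circulant of size m + 1. -/
theorem pstDiag_castSucc {m : ℕ} (i j : Fin (m + 1)) :
    pstDiag i.castSucc j.castSucc = @toepIdx m (@HSub.hSub (Fin (m + 1)) _ _ _ i j) := by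
  ext
  simp only [pstDiag, toepIdx, Fin.val_castSucc]
  have e : @ZMod.val (m + 1) (@HSub.hSub (Fin (m + 1)) _ _ _ i j) = ((i - j : Fin (m + 1)) : ℕ) :=
    rfl
  rw [e]
  have := i.isLt; have := j.isLt
  rcases le_or_gt j i with h | h
  · rw [Fin.sub_val_of_le h]
    have : (j : ℕ) ≤ i := h
    omega
  · rw [Fin.coe_sub_iff_lt.2 h]
    have : (i : ℕ) < j := h
    omega

theorem card_neg_fixed_le {m : ℕ} :
    (Finset.univ.filter fun d : ZMod (m + 1) => d = -d).card ≤ 2 := by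
  have : (Finset.univ.filter fun d : ZMod (m + 1) => d = -d).image ZMod.val ⊆
      {0, (m + 1) / 2} := by
    intro a ha
    simp only [Finset.mem_image, Finset.mem_filter, Finset.mem_univ, true_and] at ha
    obtain ⟨d, hd, rfl⟩ := ha
    have h := congrArg ZMod.val hd
    rw [ZMod.neg_val] at h
    have := d.val_lt
    simp only [Finset.mem_insert, Finset.mem_singleton]
    split_ifs at h with h0
    · left; exact h
    · right; omega
  have h := Finset.card_le_card this
  rw [Finset.card_image_of_injective _ (ZMod.val_injective _)] at h
  exact h.trans Finset.card_le_two

/-- The coefficients of the eigenvalues of the circulant as linear forms in the free entries. -/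
def eigCoeff {m : ℕ} (k : ZMod (m + 1)) : DiscoIndex (m + 2) → ℝ :=
  Sum.elim (fun a => ∑ d : ZMod (m + 1), if toepIdx d = a then (ZMod.stdAddChar (d * k) : ℂ).re else 0)
    fun _ => 0

theorem sum_toepIdx_ite {m : ℕ} (c : ZMod (m + 1) → ℝ) (hc : ∀ d, c (-d) = c d) (d : ZMod (m + 1)) :
    ∑ d', (if toepIdx d' = toepIdx d then c d' else 0) = c d * if d = -d then 1 else 2 := by
  simp only [toepIdx_eq_iff]
  by_cases hd : d = -d
  · have : ∀ d', (d' = d ∨ d' = -d) ↔ d' = d := fun d' => by rw [← hd, or_self]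
    simp only [this, Finset.sum_ite_eq', Finset.mem_univ, if_true, if_pos hd, mul_one]
  · have : ∀ d', (if d' = d ∨ d' = -d then c d' else 0) =
        (if d' = d then c d' else 0) + if d' = -d then c d' else 0 := fun d' => by
      by_cases h1 : d' = d
      · subst h1; simp [hd]
      · simp [h1]
    simp only [this, Finset.sum_add_distrib, Finset.sum_ite_eq', Finset.mem_univ, if_true, hc,
      if_neg hd]
    ring

theorem re_stdAddChar_neg {m : ℕ} (k d : ZMod (m + 1)) :
    (ZMod.stdAddChar (-d * k) : ℂ).re = (ZMod.stdAddChar (d * k) : ℂ).re := by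
  rw [neg_mul, AddChar.map_neg_eq_conj, Complex.conj_re]

theorem abs_re_stdAddChar_le {n : ℕ} [NeZero n] (x : ZMod n) :
    |(ZMod.stdAddChar x : ℂ).re| ≤ 1 :=
  (Complex.abs_re_le_norm _).trans (AddChar.norm_apply _ _).le

theorem abs_eigCoeff_le {m : ℕ} (k : ZMod (m + 1)) (α : DiscoIndex (m + 2)) :
    |eigCoeff k α| ≤ 2 := by
  rcases α with a | q
  · simp only [eigCoeff, Sum.elim_inl]
    by_cases h : ∃ d : ZMod (m + 1), toepIdx d = a
    · obtain ⟨d, rfl⟩ := h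
      rw [sum_toepIdx_ite (fun d => (ZMod.stdAddChar (d * k) : ℂ).re) (re_stdAddChar_neg k), abs_mul]
      have := abs_re_stdAddChar_le (d * k)
      have h2 : |(if d = -d then (1 : ℝ) else 2)| ≤ 2 := by split_ifs <;> norm_num
      nlinarith [abs_nonneg ((ZMod.stdAddChar (d * k) : ℂ).re),
        abs_nonneg (if d = -d then (1 : ℝ) else 2)]
    · push Not at h
      rw [Finset.sum_eq_zero fun d _ => if_neg (h d)]
      simp
  · simp [eigCoeff]

/-- Grouping d with -d gives Σ 2cos² minus a correction at the fixed points of negation. Then 2cos²θ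
= 1 + cos 2θ, and orthogonality of characters evaluates the cosine sum. -/
theorem sum_eigCoeff_sq {m : ℕ} (k : ZMod (m + 1)) :
    ∑ α, eigCoeff k α ^ 2 = (m + 1 : ℝ) + (if 2 * k = 0 then (m + 1 : ℝ) else 0) -
      ∑ d : ZMod (m + 1), if d = -d then (ZMod.stdAddChar (d * k) : ℂ).re ^ 2 else 0 := by
  set c : ZMod (m + 1) → ℝ := fun d => (ZMod.stdAddChar (d * k) : ℂ).re with hc
  rw [Fintype.sum_sum_type]
  simp only [eigCoeff, Sum.elim_inl, Sum.elim_inr, ne_eq, OfNat.ofNat_ne_zero, not_false_eq_true,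
    zero_pow, Finset.sum_const_zero, add_zero]
  have h1 : ∀ a : Fin ((m + 2 + 1) / 2), (∑ d, if toepIdx d = a then c d else 0) ^ 2 =
      ∑ d, if toepIdx d = a then c d * ∑ d', (if toepIdx d' = a then c d' else 0) else 0 :=
    fun a => by
      rw [sq, Finset.sum_mul]
      refine Finset.sum_congr rfl fun d _ => ?_
      split_ifs <;> simp
  have h2 : ∑ a : Fin ((m + 2 + 1) / 2), (∑ d, if toepIdx d = a then c d else 0) ^ 2 =
      ∑ d, c d * (c d * if d = -d then 1 else 2) := by
    rw [Finset.sum_congr rfl fun a _ => h1 a, Finset.sum_comm]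
    refine Finset.sum_congr rfl fun d _ => ?_
    rw [Finset.sum_ite_eq, if_pos (Finset.mem_univ _), sum_toepIdx_ite c (re_stdAddChar_neg k)]
  have h3 : ∀ d, 2 * c d ^ 2 = 1 + (ZMod.stdAddChar (d * (2 * k)) : ℂ).re := fun d => by
    have e : (ZMod.stdAddChar (d * (2 * k)) : ℂ) = ZMod.stdAddChar (d * k) ^ 2 := by
      rw [← AddChar.map_nsmul_eq_pow]; congr 1; simp; ring
    have hn : ‖(ZMod.stdAddChar (d * k) : ℂ)‖ = 1 := AddChar.norm_apply _ _
    have hn2 : ‖(ZMod.stdAddChar (d * k) : ℂ)‖ ^ 2 = 1 := by rw [hn]; norm_num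
    rw [← Complex.normSq_eq_norm_sq, Complex.normSq_apply] at hn2
    rw [e, sq (ZMod.stdAddChar (d * k) : ℂ), Complex.mul_re]
    simp only [hc]
    nlinarith
  have h4 : ∑ d : ZMod (m + 1), (ZMod.stdAddChar (d * (2 * k)) : ℂ).re =
      if 2 * k = 0 then (m + 1 : ℝ) else 0 := by
    rw [← Complex.re_sum, AddChar.sum_mulShift _ (ZMod.isPrimitive_stdAddChar _), ZMod.card]
    split_ifs <;> simp
  have h5 : ∀ d, c d * (c d * if d = -d then 1 else 2) =
      2 * c d ^ 2 - if d = -d then c d ^ 2 else 0 := fun d => by split_ifs <;> ring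
  rw [h2, Finset.sum_congr rfl fun d _ => h5 d, Finset.sum_sub_distrib,
    Finset.sum_congr rfl fun d _ => h3 d, Finset.sum_add_distrib, h4]
  simp [hc]

/-- Up to normalization this is the variance of the k-th eigenvalue. It is N + O(1), except that it
is about doubled at the frequencies with k = -k, of which there are at most two. -/
theorem abs_sum_eigCoeff_sq_sub_le {m : ℕ} (k : ZMod (m + 1)) :
    |∑ α, eigCoeff k α ^ 2 - (m + 2)| ≤ 3 + if k = -k then (m + 1 : ℝ) else 0 := by
  have hk : 2 * k = 0 ↔ k = -k := by rw [two_mul, add_eq_zero_iff_eq_neg]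
  rw [sum_eigCoeff_sq]
  simp only [hk]
  set θ := ∑ d : ZMod (m + 1), if d = -d then (ZMod.stdAddChar (d * k) : ℂ).re ^ 2 else 0 with hθ
  have h0 : 0 ≤ θ := Finset.sum_nonneg fun d _ => by split_ifs <;> positivity
  have h2 : θ ≤ 2 := by
    rw [hθ, ← Finset.sum_filter]
    have : ∀ d ∈ Finset.univ.filter (fun d : ZMod (m + 1) => d = -d),
        (ZMod.stdAddChar (d * k) : ℂ).re ^ 2 ≤ 1 := fun d _ => by
      rw [← sq_abs]; exact pow_le_one₀ (abs_nonneg _) (abs_re_stdAddChar_le _)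
    refine (Finset.sum_le_sum this).trans ?_
    rw [Finset.sum_const, nsmul_eq_mul, mul_one]
    exact_mod_cast card_neg_fixed_le
  rw [abs_le]
  split_ifs <;> constructor <;> linarith

theorem sum_eigCoeff_sq_le {m : ℕ} (k : ZMod (m + 1)) :
    ∑ α, eigCoeff k α ^ 2 ≤ 2 * (m + 2) := by
  have h0 : 0 ≤ ∑ d : ZMod (m + 1), if d = -d then (ZMod.stdAddChar (d * k) : ℂ).re ^ 2 else 0 :=
    Finset.sum_nonneg fun d _ => by split_ifs <;> positivity
  rw [sum_eigCoeff_sq]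
  split_ifs <;> linarith

/-- Three per frequency, plus m + 1 for each of the at most two exceptional ones. -/
theorem sum_abs_sum_eigCoeff_sq_sub_le (m : ℕ) :
    ∑ k : ZMod (m + 1), |∑ α, eigCoeff k α ^ 2 - (m + 2)| ≤ 5 * (m + 1) := by
  refine (Finset.sum_le_sum fun k _ => abs_sum_eigCoeff_sq_sub_le k).trans ?_
  rw [Finset.sum_add_distrib, ← Finset.sum_filter, Finset.sum_const, Finset.sum_const,
    Finset.card_univ, ZMod.card, nsmul_eq_mul, nsmul_eq_mul]
  have : ((Finset.univ.filter fun d : ZMod (m + 1) => d = -d).card : ℝ) ≤ 2 := by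
    exact_mod_cast card_neg_fixed_le
  have h1 : (0 : ℝ) ≤ m + 1 := by positivity
  push_cast
  nlinarith

end Circulant

/-! ### Characteristic function estimates for the central limit theorem -/

section CharFun

/-- Factors are replaced one at a time, the remaining ones being bounded by 1. -/
theorem norm_prod_sub_prod_le {ι : Type*} (s : Finset ι) (a b : ι → ℂ) (ha : ∀ i, ‖a i‖ ≤ 1)
    (hb : ∀ i, ‖b i‖ ≤ 1) : ‖∏ i ∈ s, a i - ∏ i ∈ s, b i‖ ≤ ∑ i ∈ s, ‖a i - b i‖ := by
  classical
  induction s using Finset.induction_on with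
  | empty => simp
  | insert i s hi ih =>
    rw [Finset.prod_insert hi, Finset.prod_insert hi, Finset.sum_insert hi]
    have e : a i * ∏ j ∈ s, a j - b i * ∏ j ∈ s, b j =
        (a i - b i) * ∏ j ∈ s, a j + b i * (∏ j ∈ s, a j - ∏ j ∈ s, b j) := by ring
    rw [e]
    refine (norm_add_le _ _).trans (add_le_add ?_ ?_)
    · rw [norm_mul]
      refine mul_le_of_le_one_right (norm_nonneg _) ?_
      rw [norm_prod]
      exact Finset.prod_le_one (fun _ _ => norm_nonneg _) fun j _ => ha j
    · rw [norm_mul]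
      exact (mul_le_of_le_one_left (norm_nonneg _) (hb i)).trans ih

theorem norm_exp_neg_sq_le (u : ℝ) : ‖Complex.exp (-((u : ℂ) ^ 2 / 2))‖ ≤ 1 := by
  rw [Complex.norm_exp]
  have : (-((u : ℂ) ^ 2 / 2)).re = -(u ^ 2 / 2) := by
    rw [show (-((u : ℂ) ^ 2 / 2)) = ((-(u ^ 2 / 2) : ℝ) : ℂ) by push_cast; ring, Complex.ofReal_re]
  rw [this, Real.exp_le_one_iff]
  nlinarith [sq_nonneg u]

theorem exists_norm_charFun_sub_exp_le {p : Measure ℝ} (hp : IsEntryLaw p) {ε : ℝ} (hε : 0 < ε) :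
    ∃ δ > 0, ∀ u : ℝ, |u| < δ →
      ‖charFun p u - Complex.exp (-((u : ℂ) ^ 2 / 2))‖ ≤ ε * u ^ 2 := by
  have := hp.isProbabilityMeasure
  have h := taylor_charFun_two (P := p) (X := id) aemeasurable_id (by simpa using hp.mean_eq_zero)
    (by simpa using hp.variance_eq_one)
  rw [Measure.map_id] at h
  have h2 := h.bound (half_pos hε)
  rw [Metric.eventually_nhds_iff] at h2
  obtain ⟨δ, hδ, h3⟩ := h2
  -- Below δ the Taylor expansion of the characteristic function holds with error ε u²/2. Below 1
  -- and ε, u² ≤ |u| < ε, so the error u⁴/4 of expanding the exponential is at most ε u²/2.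
  refine ⟨min δ (min 1 ε), by positivity, fun u hu => ?_⟩
  have hu1 : |u| < δ := hu.trans_le (min_le_left _ _)
  have hu2 : |u| < 1 := hu.trans_le ((min_le_right _ _).trans (min_le_left _ _))
  have hu3 : |u| < ε := hu.trans_le ((min_le_right _ _).trans (min_le_right _ _))
  have h4 := h3 (y := u) (by simpa using hu1)
  rw [Real.norm_eq_abs, abs_of_nonneg (sq_nonneg u)] at h4
  have husq : u ^ 2 ≤ |u| := by
    rw [← sq_abs, sq]; exact mul_le_of_le_one_left (abs_nonneg _) hu2.le
  have h5 : ‖(1 - (u : ℂ) ^ 2 / 2) - Complex.exp (-((u : ℂ) ^ 2 / 2))‖ ≤ ε / 2 * u ^ 2 := by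
    have e : (1 - (u : ℂ) ^ 2 / 2) - Complex.exp (-((u : ℂ) ^ 2 / 2)) =
        ((-(Real.exp (-(u ^ 2 / 2)) - 1 - (-(u ^ 2 / 2))) : ℝ) : ℂ) := by
      push_cast; ring
    rw [e, Complex.norm_real, norm_neg, Real.norm_eq_abs]
    refine (Real.abs_exp_sub_one_sub_id_le ?_).trans ?_
    · rw [abs_neg, abs_of_nonneg (by positivity)]; linarith
    · have : 0 ≤ u ^ 2 := sq_nonneg u
      nlinarith
  calc _ = ‖(charFun p u - (1 - (u : ℂ) ^ 2 / 2)) +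
        ((1 - (u : ℂ) ^ 2 / 2) - Complex.exp (-((u : ℂ) ^ 2 / 2)))‖ := by congr 1; ring
    _ ≤ ε / 2 * u ^ 2 + ε / 2 * u ^ 2 := (norm_add_le _ _).trans (add_le_add h4 h5)
    _ = _ := by ring

theorem integral_exp_linear {ι : Type*} [Fintype ι] (p : Measure ℝ) [IsProbabilityMeasure p]
    (u : ι → ℝ) :
    ∫ z, Complex.exp (((∑ i, u i * z i : ℝ) : ℂ) * Complex.I) ∂(iidLaw ι p) =
      ∏ i, charFun p (u i) := by
  simp only [charFun_apply_real]
  rw [← integral_fintype_prod_eq_prod (fun i (x : ℝ) => Complex.exp (u i * x * Complex.I))]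
  refine integral_congr_ae (Eventually.of_forall fun z => ?_)
  dsimp only
  rw [← Complex.exp_sum]
  push_cast
  rw [Finset.sum_mul]

theorem abs_exp_neg_sub_exp_neg_le {a b : ℝ} (ha : 0 ≤ a) (hb : 0 ≤ b) :
    |Real.exp (-a) - Real.exp (-b)| ≤ |a - b| := by
  wlog h : a ≤ b generalizing a b
  · rw [abs_sub_comm, abs_sub_comm a]; exact this hb ha (le_of_not_ge h)
  have h1 : Real.exp (-b) ≤ Real.exp (-a) := Real.exp_le_exp.2 (by linarith)
  rw [abs_of_nonneg (by linarith), abs_of_nonpos (by linarith)]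
  have h2 : Real.exp (-b) = Real.exp (-a) * Real.exp (a - b) := by rw [← Real.exp_add]; ring_nf
  have h3 : a - b + 1 ≤ Real.exp (a - b) := Real.add_one_le_exp _
  have h4 : Real.exp (-a) ≤ 1 := Real.exp_le_one_iff.2 (by linarith)
  have h5 := Real.exp_pos (-a)
  have h6 : Real.exp (a - b) ≤ 1 := Real.exp_le_one_iff.2 (by linarith)
  rw [h2]
  nlinarith

end CharFun

/-! ### The palindromic Toeplitz part has a Gaussian limit -/

section Toeplitz

/-- The resolvent identity and Cauchy–Schwarz for the trace. A perturbation of bounded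
Hilbert–Schmidt norm is thus negligible, which allows the last row and column to be discarded. -/
theorem norm_normTrResol_sub_le {n : Type*} [Fintype n] [DecidableEq n] {M M' : Matrix n n ℝ}
    (hM : M.IsHermitian) (hM' : M'.IsHermitian) {w : ℂ} (hw : w.im ≠ 0) :
    ‖normTrResol M w - normTrResol M' w‖ ≤ |w.im|⁻¹ ^ 2 * (Real.sqrt (Fintype.card n))⁻¹ *
      Real.sqrt (hsSq ((M' - M).map Complex.ofReal)) := by
  set D := (M' - M).map Complex.ofReal with hD
  set η := |w.im|⁻¹ with hη
  have hη0 : 0 ≤ η := by positivity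
  have h1 : normTrResol M w - normTrResol M' w =
      (Fintype.card n : ℂ)⁻¹ * (D * (resol M' w * resol M w)).trace := by
    rw [normTrResol, normTrResol, ← mul_sub, ← Matrix.trace_sub, resol_sub_resol hM hM' hw hw,
      sub_self, zero_smul, add_zero, mul_assoc, Matrix.trace_mul_comm, mul_assoc]
  have h2 : ‖(D * (resol M' w * resol M w)).trace‖ ≤
      Real.sqrt (hsSq D) * (Real.sqrt (Fintype.card n) * η ^ 2) := by
    refine (sq_le_sq₀ (norm_nonneg _) (by positivity)).1 ((norm_trace_mul_sq_le _ _).trans ?_)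
    rw [mul_pow, mul_pow, Real.sq_sqrt (hsSq_nonneg _), Real.sq_sqrt (Nat.cast_nonneg _)]
    refine mul_le_mul_of_nonneg_left ((hsSq_le _).trans ?_) (hsSq_nonneg _)
    gcongr
    rw [sq]
    exact (norm_mul_le _ _).trans (mul_le_mul (norm_resol_le hM' hw) (norm_resol_le hM hw)
      (norm_nonneg _) hη0)
  rw [h1, norm_mul, norm_inv, Complex.norm_natCast]
  rcases (Fintype.card n).eq_zero_or_pos with h | h
  · rw [h]; simp
  have h' : (0 : ℝ) < Fintype.card n := by exact_mod_cast h
  calc _ ≤ (Fintype.card n : ℝ)⁻¹ * (Real.sqrt (hsSq D) * (Real.sqrt (Fintype.card n) * η ^ 2)) := by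
        gcongr
    _ = η ^ 2 * ((Fintype.card n : ℝ)⁻¹ * Real.sqrt (Fintype.card n)) * Real.sqrt (hsSq D) := by
        ring
    _ = _ := by
        congr 2
        nth_rewrite 1 [← Real.mul_self_sqrt h'.le]
        have := (Real.sqrt_pos.2 h').ne'
        field_simp

/-- The matrix bordered by a last row and a last column of zeros. -/
def zeroBorder {R : Type*} [Zero R] {n : ℕ} (C : Matrix (Fin n) (Fin n) R) :
    Matrix (Fin (n + 1)) (Fin (n + 1)) R :=
  Matrix.of fun i j => Fin.lastCases (motive := fun _ => R) 0
    (fun i' => Fin.lastCases (motive := fun _ => R) 0 (fun j' => C i' j') j) i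

section

variable {R : Type*} [Zero R] {n : ℕ} (C : Matrix (Fin n) (Fin n) R)

@[simp] theorem zeroBorder_castSucc_castSucc (i j : Fin n) :
    zeroBorder C i.castSucc j.castSucc = C i j := by simp [zeroBorder]

@[simp] theorem zeroBorder_last_left (j : Fin (n + 1)) : zeroBorder C (Fin.last n) j = 0 := by
  simp [zeroBorder]

@[simp] theorem zeroBorder_last_right (i : Fin (n + 1)) : zeroBorder C i (Fin.last n) = 0 := by
  refine Fin.lastCases ?_ (fun i => ?_) i <;> simp [zeroBorder]

end

theorem zeroBorder_isHermitian {n : ℕ} {C : Matrix (Fin n) (Fin n) ℝ} (hC : C.IsHermitian) :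
    (zeroBorder C).IsHermitian := by
  ext i j
  rw [Matrix.conjTranspose_apply, star_trivial]
  refine Fin.lastCases ?_ (fun i => ?_) i <;> refine Fin.lastCases ?_ (fun j => ?_) j <;> simp
  simpa using hC.apply i j

/-- The bordered matrix is block diagonal with an extra eigenvalue 0, which contributes 1/(0 - w).
-/
theorem trace_resol_zeroBorder {n : ℕ} {C : Matrix (Fin n) (Fin n) ℝ} (hC : C.IsHermitian) {w : ℂ}
    (hw : w.im ≠ 0) : (resol (zeroBorder C) w).trace = (resol C w).trace + (-w)⁻¹ := by
  have hw0 : w ≠ 0 := fun h => hw (by simp [h])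
  set R : Matrix (Fin (n + 1)) (Fin (n + 1)) ℂ :=
    zeroBorder (resol C w) + Matrix.single (Fin.last n) (Fin.last n) (-w)⁻¹ with hR
  have h1 : resol (zeroBorder C) w = R := by
    refine Matrix.inv_eq_right_inv ?_
    have hC1 := mul_resol hC hw
    ext i j
    rw [Matrix.mul_apply, Fin.sum_univ_castSucc]
    have hcl : ∀ i : Fin n, i.castSucc ≠ Fin.last n := fun i => (Fin.castSucc_lt_last i).ne
    refine Fin.lastCases ?_ (fun i => ?_) i <;> refine Fin.lastCases ?_ (fun j => ?_) j
    · simp [hR, hw0, (hcl _).symm]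
    · simp [hR, (hcl _).symm]
    · simp [hR, Matrix.one_apply, (hcl _).symm, hcl]
    · have h := congrFun (congrFun hC1 i) j
      rw [Matrix.mul_apply] at h
      simp only [hR, Matrix.sub_apply, Matrix.map_apply, zeroBorder_castSucc_castSucc,
        Matrix.smul_apply, Matrix.add_apply, Matrix.single_apply, (hcl _).symm, if_false,
        add_zero, zeroBorder_last_left, mul_zero, Matrix.one_apply, Fin.castSucc_inj, and_false] at h ⊢
      exact h
  rw [h1, Matrix.trace, Fin.sum_univ_castSucc]
  simp [hR, Matrix.trace, (Fin.castSucc_lt_last _).ne']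

variable {m : ℕ}

/-- The eigenvalues of the circulant part of the normalized palindromic Toeplitz matrix. -/
def toepEig (k : ZMod (m + 1)) (z : DiscoIndex (m + 2) → ℝ) : ℝ :=
  (Real.sqrt (2 * (m + 2 : ℕ)))⁻¹ * ∑ α, eigCoeff k α * z α

/-- The diagonals of the circulant part of the normalized palindromic Toeplitz matrix. -/
def toepSymbol (z : DiscoIndex (m + 2) → ℝ) (d : ZMod (m + 1)) : ℝ :=
  (Real.sqrt (2 * (m + 2 : ℕ)))⁻¹ * z (Sum.inl (toepIdx d))

theorem toepSymbol_neg (z : DiscoIndex (m + 2) → ℝ) (d : ZMod (m + 1)) :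
    toepSymbol z (-d) = toepSymbol z d := by
  rw [toepSymbol, toepIdx_neg, toepSymbol]

theorem toepEig_eq (k : ZMod (m + 1)) (z : DiscoIndex (m + 2) → ℝ) :
    toepEig k z = ∑ d, toepSymbol z d * (ZMod.stdAddChar (d * k) : ℂ).re := by
  simp only [toepEig, toepSymbol, Fintype.sum_sum_type, eigCoeff, Sum.elim_inl, Sum.elim_inr,
    zero_mul, Finset.sum_const_zero, add_zero, Finset.sum_mul]
  rw [Finset.sum_comm, Finset.mul_sum]
  refine Finset.sum_congr rfl fun d _ => ?_
  simp only [ite_mul, zero_mul, Finset.sum_ite_eq, Finset.mem_univ, if_true]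
  ring

/-- The circulant part of the normalized palindromic Toeplitz matrix. -/
def toepCirculant (z : DiscoIndex (m + 2) → ℝ) : Matrix (Fin (m + 1)) (Fin (m + 1)) ℝ :=
  Matrix.circulant (n := ZMod (m + 1)) (toepSymbol z)

theorem toepCirculant_isHermitian (z : DiscoIndex (m + 2) → ℝ) : (toepCirculant z).IsHermitian := by
  ext i j
  rw [Matrix.conjTranspose_apply, star_trivial]
  have h : ∀ d d' : ZMod (m + 1), toepSymbol z (d - d') = toepSymbol z (d' - d) := fun d d' => by
    rw [← neg_sub, toepSymbol_neg]
  exact h j i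

theorem trace_resol_toepCirculant (z : DiscoIndex (m + 2) → ℝ) {w : ℂ} (hw : w.im ≠ 0) :
    (resol (toepCirculant z) w).trace = ∑ k : ZMod (m + 1), ((toepEig k z : ℂ) - w)⁻¹ := by
  simp only [toepEig_eq]
  exact trace_resol_circulant (toepSymbol_neg z) hw

theorem blockSum_zero_castSucc (z : DiscoIndex (m + 2) → ℝ) (i j : Fin (m + 1)) :
    blockSum 0 z i.castSucc j.castSucc = toepCirculant z i j := by
  rw [blockSum_apply, zero_mul, add_zero, pstDiag_castSucc]
  rfl

theorem integral_coord_sq {ι : Type*} [Fintype ι] {p : Measure ℝ} (hp : IsEntryLaw p) (i : ι) :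
    Integrable (fun z : ι → ℝ => z i ^ 2) (iidLaw ι p) ∧ ∫ z, z i ^ 2 ∂(iidLaw ι p) = 1 := by
  have := hp.isProbabilityMeasure
  have h := measurePreserving_eval (fun _ : ι => p) i
  refine ⟨h.integrable_comp_of_integrable (hp.integrable_pow 2), ?_⟩
  rw [← hp.variance_eq_one]
  exact h.integral_comp_aestronglyMeasurable (hp.integrable_pow 2).aestronglyMeasurable

/-- Only the last row and column differ: 2m + 3 entries, each with second moment 1/(2(m + 2)), so
the mean below is at most 1. -/
theorem hsSq_zeroBorder_sub (z : DiscoIndex (m + 2) → ℝ) :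
    hsSq ((zeroBorder (toepCirculant z) - blockSum 0 z).map Complex.ofReal) =
      (2 * ((m + 2 : ℕ) : ℝ))⁻¹ *
        (∑ i : Fin (m + 1), z (Sum.inl (pstDiag i.castSucc (Fin.last (m + 1)))) ^ 2 +
          ∑ j, z (Sum.inl (pstDiag (Fin.last (m + 1)) j)) ^ 2) := by
  have h : ∀ i j, ‖((zeroBorder (toepCirculant z) - blockSum 0 z).map Complex.ofReal) i j‖ ^ 2 =
      (zeroBorder (toepCirculant z) i j - blockSum 0 z i j) ^ 2 := fun i j => by
    rw [Matrix.map_apply, Complex.norm_real, Real.norm_eq_abs, sq_abs, Matrix.sub_apply]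
  have h2 : ∀ i j : Fin (m + 2), blockSum 0 z i j ^ 2 =
      (2 * ((m + 2 : ℕ) : ℝ))⁻¹ * z (Sum.inl (pstDiag i j)) ^ 2 := fun i j => by
    rw [blockSum_apply, zero_mul, add_zero, mul_pow, inv_sqrt_sq (by omega)]
  simp only [hsSq, h]
  rw [Fin.sum_univ_castSucc, mul_add, Finset.mul_sum, Finset.mul_sum]
  congr 1
  · refine Finset.sum_congr rfl fun i _ => ?_
    rw [Fin.sum_univ_castSucc]
    simp only [zeroBorder_castSucc_castSucc, blockSum_zero_castSucc, sub_self]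
    simp [h2]
  · refine Finset.sum_congr rfl fun j _ => ?_
    simp [h2]

theorem integral_hsSq_zeroBorder_sub_le {p : Measure ℝ} (hp : IsEntryLaw p) :
    Integrable (fun z : DiscoIndex (m + 2) → ℝ =>
      hsSq ((zeroBorder (toepCirculant z) - blockSum 0 z).map Complex.ofReal)) (iidLaw _ p) ∧
    ∫ z : DiscoIndex (m + 2) → ℝ,
      hsSq ((zeroBorder (toepCirculant z) - blockSum 0 z).map Complex.ofReal) ∂(iidLaw _ p) ≤ 1 := by
  simp only [hsSq_zeroBorder_sub]
  have i1 : Integrable (fun z : DiscoIndex (m + 2) → ℝ => ∑ i : Fin (m + 1),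
      z (Sum.inl (pstDiag i.castSucc (Fin.last (m + 1)))) ^ 2) (iidLaw _ p) :=
    integrable_finsetSum _ fun i _ => (integral_coord_sq hp _).1
  have i2 : Integrable (fun z : DiscoIndex (m + 2) → ℝ => ∑ j,
      z (Sum.inl (pstDiag (Fin.last (m + 1)) j)) ^ 2) (iidLaw _ p) :=
    integrable_finsetSum _ fun i _ => (integral_coord_sq hp _).1
  refine ⟨(i1.add i2).const_mul _, ?_⟩
  rw [integral_const_mul, integral_add i1 i2, integral_finsetSum _ fun i _ => (integral_coord_sq hp _).1,
    integral_finsetSum _ fun i _ => (integral_coord_sq hp _).1]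
  simp only [(integral_coord_sq hp _).2, Finset.sum_const, Finset.card_univ, Fintype.card_fin,
    nsmul_eq_mul, mul_one]
  rw [inv_mul_le_iff₀ (by positivity)]
  push_cast
  linarith

theorem continuous_toepEig (k : ZMod (m + 1)) :
    Continuous (toepEig k : (DiscoIndex (m + 2) → ℝ) → ℝ) :=
  continuous_const.mul (continuous_finsetSum _ fun _ _ => continuous_const.mul (continuous_apply _))

theorem normTrResol_zeroBorder (z : DiscoIndex (m + 2) → ℝ) {w : ℂ} (hw : w.im ≠ 0) :
    normTrResol (zeroBorder (toepCirculant z)) w =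
      ((m + 2 : ℕ) : ℂ)⁻¹ * (∑ k : ZMod (m + 1), ((toepEig k z : ℂ) - w)⁻¹ + (-w)⁻¹) := by
  rw [normTrResol, trace_resol_zeroBorder (toepCirculant_isHermitian z) hw,
    trace_resol_toepCirculant z hw, Fintype.card_fin]

theorem continuous_inv_ofReal_sub {w : ℂ} (hw : w.im ≠ 0) :
    Continuous fun x : ℝ => ((x : ℂ) - w)⁻¹ :=
  (Complex.continuous_ofReal.sub continuous_const).inv₀ fun x => ofReal_sub_ne_zero x hw

/-- The Toeplitz block is compared with its zero-bordered circulant. The factor 2 comes from √h ≤ 1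
+ h and E h ≤ 1, where h is the squared Hilbert–Schmidt distance. -/
theorem norm_meanTr_zero_sub_le {p : Measure ℝ} (hp : IsEntryLaw p) {w : ℂ} (hw : w.im ≠ 0) :
    ‖meanTr 0 p (m + 2) w - ((m + 2 : ℕ) : ℂ)⁻¹ *
        (∑ k : ZMod (m + 1), ∫ z, ((toepEig k z : ℂ) - w)⁻¹ ∂(iidLaw _ p) + (-w)⁻¹)‖ ≤
      2 * |w.im|⁻¹ ^ 2 * (Real.sqrt (m + 2 : ℕ))⁻¹ := by
  have := hp.isProbabilityMeasure
  have ik : ∀ k : ZMod (m + 1),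
      Integrable (fun z => ((toepEig k z : ℂ) - w)⁻¹) (iidLaw (DiscoIndex (m + 2)) p) := fun k =>
    integrable_of_bounded ((continuous_inv_ofReal_sub hw).comp
      (continuous_toepEig k)).aestronglyMeasurable fun z => norm_inv_ofReal_sub_le _ hw
  have iZ : Integrable (fun z : DiscoIndex (m + 2) → ℝ =>
      normTrResol (zeroBorder (toepCirculant z)) w) (iidLaw _ p) := by
    simp only [normTrResol_zeroBorder _ hw]
    exact ((integrable_finsetSum _ fun k _ => ik k).add (integrable_const _)).const_mul _
  have iB : Integrable (fun z => normTrResol (blockSum (N := m + 2) 0 z) w) (iidLaw _ p) :=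
    integrable_of_bounded (continuous_normTrResol (continuous_blockSum 0) (blockSum_isHermitian 0)
      hw).aestronglyMeasurable fun z => norm_normTrResol_le (blockSum_isHermitian 0 z) hw
  have eZ : ∫ z : DiscoIndex (m + 2) → ℝ, normTrResol (zeroBorder (toepCirculant z)) w ∂(iidLaw _ p) =
      ((m + 2 : ℕ) : ℂ)⁻¹ *
        (∑ k : ZMod (m + 1), ∫ z, ((toepEig k z : ℂ) - w)⁻¹ ∂(iidLaw _ p) + (-w)⁻¹) := by
    simp only [normTrResol_zeroBorder _ hw]
    rw [integral_const_mul, integral_add (integrable_finsetSum _ fun k _ => ik k)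
      (integrable_const _), integral_finsetSum _ fun k _ => ik k]
    simp
  obtain ⟨ih, hh⟩ := integral_hsSq_zeroBorder_sub_le (m := m) hp
  rw [← eZ, meanTr, ← integral_sub iB iZ]
  set K := |w.im|⁻¹ ^ 2 * (Real.sqrt (m + 2 : ℕ))⁻¹ with hK
  have hK0 : 0 ≤ K := by positivity
  refine (norm_integral_le_of_norm_le (((integrable_const (1 : ℝ)).add ih).const_mul K)
    (Eventually.of_forall fun z => ?_)).trans ?_
  · refine (norm_normTrResol_sub_le (blockSum_isHermitian 0 z)
      (zeroBorder_isHermitian (toepCirculant_isHermitian z)) hw).trans ?_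
    rw [Fintype.card_fin]
    refine mul_le_mul_of_nonneg_left ?_ hK0
    set h := hsSq ((zeroBorder (toepCirculant z) - blockSum 0 z).map Complex.ofReal)
    have h0 : 0 ≤ h := hsSq_nonneg _
    have := Real.mul_self_sqrt h0
    simp only [Pi.add_apply]
    nlinarith [Real.sqrt_nonneg h, sq_nonneg (Real.sqrt h - 1)]
  · rw [integral_const_mul]
    simp only [Pi.add_apply]
    rw [integral_add (integrable_const _) ih]
    simp only [integral_const, probReal_univ, smul_eq_mul, mul_one]
    nlinarith

/-- The law of a uniformly chosen eigenvalue of the circulant part. -/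
def toepEigLaw (p : Measure ℝ) (m : ℕ) : Measure ℝ :=
  ((m + 1 : ℕ) : ℝ≥0∞)⁻¹ • ∑ k : ZMod (m + 1), (iidLaw (DiscoIndex (m + 2)) p).map (toepEig k)

theorem isProbabilityMeasure_toepEigLaw (p : Measure ℝ) [IsProbabilityMeasure p] (m : ℕ) :
    IsProbabilityMeasure (toepEigLaw p m) := by
  constructor
  have h : ∀ k : ZMod (m + 1), (iidLaw (DiscoIndex (m + 2)) p).map (toepEig k) Set.univ = 1 :=
    fun k => by
      rw [Measure.map_apply (continuous_toepEig k).measurable MeasurableSet.univ, Set.preimage_univ,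
        measure_univ]
  rw [toepEigLaw, Measure.smul_apply, Measure.finsetSum_apply, Finset.sum_congr rfl fun k _ => h k,
    Finset.sum_const, Finset.card_univ, ZMod.card, nsmul_eq_mul, mul_one, smul_eq_mul,
    ENNReal.inv_mul_cancel (by simp) (ENNReal.natCast_ne_top _)]

theorem integral_toepEigLaw {p : Measure ℝ} [IsProbabilityMeasure p] {f : ℝ → ℂ}
    (hf : Continuous f) {C : ℝ} (hC : ∀ x, ‖f x‖ ≤ C) :
    ∫ x, f x ∂(toepEigLaw p m) =
      ((m + 1 : ℕ) : ℂ)⁻¹ * ∑ k : ZMod (m + 1), ∫ z, f (toepEig k z) ∂(iidLaw _ p) := by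
  rw [toepEigLaw, integral_smul_measure, integral_finsetSum_measure]
  · rw [Finset.sum_congr rfl fun k _ => integral_map (continuous_toepEig k).aemeasurable
      hf.aestronglyMeasurable]
    rw [ENNReal.toReal_inv, ENNReal.toReal_natCast, Complex.real_smul]
    push_cast
    rfl
  · intro k _
    have : IsProbabilityMeasure ((iidLaw (DiscoIndex (m + 2)) p).map (toepEig k)) :=
      Measure.isProbabilityMeasure_map (continuous_toepEig k).aemeasurable
    exact integrable_of_bounded hf.aestronglyMeasurable hC

/-- Independence makes the characteristic function of an eigenvalue a product. Each factor is
replaced by a Gaussian one, which is legitimate because all coefficients are uniformly small; this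
costs ε t². The resulting variances are then compared with 1/2 on average over the frequencies, so
the exceptional ones do no harm. -/
theorem norm_charFun_toepEigLaw_sub_le {p : Measure ℝ} [IsProbabilityMeasure p] {t ε δ : ℝ}
    (hδ : ∀ u : ℝ, |u| < δ → ‖charFun p u - Complex.exp (-((u : ℂ) ^ 2 / 2))‖ ≤ ε * u ^ 2)
    (hε : 0 ≤ ε) (ht : 2 * |t| * (Real.sqrt (2 * (m + 2 : ℕ)))⁻¹ < δ) :
    ‖charFun (toepEigLaw p m) t - Complex.exp (-((t : ℂ) ^ 2 / 4))‖ ≤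
      ε * t ^ 2 + 5 * t ^ 2 / (4 * (m + 2 : ℕ)) := by
  set c := (Real.sqrt (2 * (m + 2 : ℕ)))⁻¹ with hc
  have hc0 : 0 ≤ c := by positivity
  have hN : (0 : ℝ) < ((m + 2 : ℕ) : ℝ) := by positivity
  have hc2 : c ^ 2 = (2 * ((m + 2 : ℕ) : ℝ))⁻¹ := inv_sqrt_sq (by omega)
  set v : ZMod (m + 1) → ℝ := fun k => ∑ α, eigCoeff k α ^ 2 with hv
  have e1 : charFun (toepEigLaw p m) t =
      ((m + 1 : ℕ) : ℂ)⁻¹ * ∑ k : ZMod (m + 1), ∏ α, charFun p (t * c * eigCoeff k α) := by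
    rw [charFun_apply_real, integral_toepEigLaw (C := 1) (by fun_prop)]
    · congr 1
      refine Finset.sum_congr rfl fun k _ => ?_
      rw [← integral_exp_linear]
      refine integral_congr_ae (Eventually.of_forall fun z => ?_)
      dsimp only
      congr 2
      rw [toepEig, ← hc, ← Complex.ofReal_mul, Finset.mul_sum, Finset.mul_sum]
      congr 1
      exact Finset.sum_congr rfl fun α _ => by ring
    · intro x
      rw [← Complex.ofReal_mul, Complex.norm_exp_ofReal_mul_I]
  have e2 : ∀ k, ‖∏ α, charFun p (t * c * eigCoeff k α) -
      Complex.exp (-((t : ℂ) ^ 2 / 4))‖ ≤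
      ε * t ^ 2 + t ^ 2 / (4 * (m + 2 : ℕ)) * |v k - (m + 2)| := fun k => by
    have a1 : ‖∏ α, charFun p (t * c * eigCoeff k α) -
        ∏ α, Complex.exp (-(((t * c * eigCoeff k α : ℝ) : ℂ) ^ 2 / 2))‖ ≤ ε * t ^ 2 := by
      refine (norm_prod_sub_prod_le _ _ _ (fun α => norm_charFun_le_one _)
        fun α => norm_exp_neg_sq_le _).trans ?_
      have : ∀ α ∈ Finset.univ, ‖charFun p (t * c * eigCoeff k α) -
          Complex.exp (-(((t * c * eigCoeff k α : ℝ) : ℂ) ^ 2 / 2))‖ ≤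
          ε * t ^ 2 * c ^ 2 * eigCoeff k α ^ 2 := fun α _ => by
        refine (hδ _ ?_).trans (le_of_eq (by ring))
        rw [abs_mul, abs_mul, abs_of_nonneg hc0]
        refine lt_of_le_of_lt ?_ ht
        have := abs_eigCoeff_le k α
        have h3 : 0 ≤ |t| * c := by positivity
        nlinarith
      refine (Finset.sum_le_sum this).trans ?_
      rw [← Finset.mul_sum, hc2]
      have h4 := sum_eigCoeff_sq_le k
      have h5 : (2 * ((m + 2 : ℕ) : ℝ))⁻¹ * ∑ α, eigCoeff k α ^ 2 ≤ 1 := by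
        rw [inv_mul_le_iff₀ (by positivity), mul_one]; push_cast; exact h4
      have h6 : 0 ≤ ε * t ^ 2 := by positivity
      rw [mul_assoc]
      exact mul_le_of_le_one_right h6 h5
    have a2 : ∏ α, Complex.exp (-(((t * c * eigCoeff k α : ℝ) : ℂ) ^ 2 / 2)) =
        ((Real.exp (-(t ^ 2 * c ^ 2 * v k / 2)) : ℝ) : ℂ) := by
      rw [← Complex.exp_sum]
      push_cast
      congr 1
      rw [hv, Finset.sum_neg_distrib, ← Finset.sum_div]
      push_cast
      rw [Finset.mul_sum]
      congr 2
      exact Finset.sum_congr rfl fun α _ => by ring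
    have a3 : Complex.exp (-((t : ℂ) ^ 2 / 4)) = ((Real.exp (-(t ^ 2 / 4)) : ℝ) : ℂ) := by
      push_cast; rfl
    have hv0 : 0 ≤ v k := Finset.sum_nonneg fun α _ => sq_nonneg _
    have a4 : ‖((Real.exp (-(t ^ 2 * c ^ 2 * v k / 2)) : ℝ) : ℂ) -
        ((Real.exp (-(t ^ 2 / 4)) : ℝ) : ℂ)‖ ≤ t ^ 2 / (4 * (m + 2 : ℕ)) * |v k - (m + 2)| := by
      rw [← Complex.ofReal_sub, Complex.norm_real, Real.norm_eq_abs]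
      refine (abs_exp_neg_sub_exp_neg_le (by positivity) (by positivity)).trans (le_of_eq ?_)
      have h7 : t ^ 2 * c ^ 2 * v k / 2 - t ^ 2 / 4 =
          t ^ 2 / (4 * (m + 2 : ℕ)) * (v k - (m + 2)) := by
        generalize v k = V
        rw [hc2, mul_inv]
        push_cast
        have : (m : ℝ) + 2 ≠ 0 := by positivity
        field_simp
        ring
      rw [h7, abs_mul, abs_of_nonneg (by positivity)]
    rw [a2] at a1
    rw [a3]
    refine (norm_sub_le_norm_sub_add_norm_sub _ _ _).trans (add_le_add a1 a4)
  have hm1 : ((m + 1 : ℕ) : ℂ) ≠ 0 := by exact_mod_cast Nat.succ_ne_zero m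
  have e3 : charFun (toepEigLaw p m) t - Complex.exp (-((t : ℂ) ^ 2 / 4)) =
      ((m + 1 : ℕ) : ℂ)⁻¹ * ∑ k : ZMod (m + 1), (∏ α, charFun p (t * c * eigCoeff k α) -
        Complex.exp (-((t : ℂ) ^ 2 / 4))) := by
    rw [Finset.sum_sub_distrib, Finset.sum_const, Finset.card_univ, ZMod.card, nsmul_eq_mul, mul_sub,
      ← mul_assoc, inv_mul_cancel₀ hm1, one_mul, e1]
  have hm1' : (0 : ℝ) < ((m + 1 : ℕ) : ℝ) := by positivity
  rw [e3, norm_mul, norm_inv, Complex.norm_natCast, inv_mul_le_iff₀ hm1']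
  refine (norm_sum_le _ _).trans ((Finset.sum_le_sum fun k _ => e2 k).trans ?_)
  rw [Finset.sum_add_distrib, Finset.sum_const, Finset.card_univ, ZMod.card, nsmul_eq_mul,
    ← Finset.mul_sum, mul_add]
  refine add_le_add_right ?_ _
  calc t ^ 2 / (4 * (m + 2 : ℕ)) * ∑ k, |v k - (m + 2)|
      ≤ t ^ 2 / (4 * (m + 2 : ℕ)) * (5 * (m + 1)) := by
        gcongr; exact sum_abs_sum_eigCoeff_sq_sub_le m
    _ = _ := by push_cast; ring

theorem tendsto_charFun_toepEigLaw {p : Measure ℝ} (hp : IsEntryLaw p) (t : ℝ) :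
    Tendsto (fun m => charFun (toepEigLaw p m) t) atTop (𝓝 (charFun (gaussianReal 0 (1 / 2)) t)) := by
  have := hp.isProbabilityMeasure
  have e : charFun (gaussianReal 0 (1 / 2)) t = Complex.exp (-((t : ℂ) ^ 2 / 4)) := by
    rw [charFun_gaussianReal]
    congr 1
    push_cast
    ring
  have hN : Tendsto (fun m : ℕ => ((m + 2 : ℕ) : ℝ)) atTop atTop :=
    tendsto_natCast_atTop_atTop.comp (tendsto_add_atTop_nat 2)
  have h1 : Tendsto (fun m : ℕ => 5 * t ^ 2 / (4 * ((m + 2 : ℕ) : ℝ))) atTop (𝓝 0) :=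
    tendsto_const_nhds.div_atTop (hN.const_mul_atTop (by norm_num))
  have h2 : Tendsto (fun m : ℕ => 2 * |t| * (Real.sqrt (2 * (m + 2 : ℕ)))⁻¹) atTop (𝓝 0) := by
    have : Tendsto (fun m : ℕ => (Real.sqrt (2 * (m + 2 : ℕ)))⁻¹) atTop (𝓝 0) :=
      (Real.tendsto_sqrt_atTop.comp (hN.const_mul_atTop (by norm_num))).inv_tendsto_atTop
    simpa using this.const_mul (2 * |t|)
  rw [e, Metric.tendsto_atTop']
  intro ε hε
  obtain ⟨δ, hδ, h3⟩ := exists_norm_charFun_sub_exp_le hp (ε := ε / (2 * (t ^ 2 + 1)))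
    (by positivity)
  obtain ⟨n, hn⟩ := eventually_atTop.1
    ((h1.eventually (gt_mem_nhds (half_pos hε))).and (h2.eventually (gt_mem_nhds hδ)))
  refine ⟨n, fun m hm => ?_⟩
  obtain ⟨h4, h5⟩ := hn m hm.le
  rw [dist_eq_norm]
  refine (norm_charFun_toepEigLaw_sub_le h3 (by positivity) h5).trans_lt ?_
  have h6 : ε / (2 * (t ^ 2 + 1)) * t ^ 2 ≤ ε / 2 := by
    rw [div_mul_eq_mul_div, div_le_div_iff₀ (by positivity) (by norm_num)]
    nlinarith
  linarith

/-- The Stieltjes transform of a measure on the line. -/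
def stieltjes (ν : Measure ℝ) (w : ℂ) : ℂ := ∫ x, ((x : ℂ) - w)⁻¹ ∂ν

/-- The function `x ↦ (x - w)⁻¹` as a bounded continuous function. -/
def cauchyKernel {w : ℂ} (hw : w.im ≠ 0) : ℝ →ᵇ ℂ :=
  BoundedContinuousFunction.ofNormedAddCommGroup (fun x : ℝ => ((x : ℂ) - w)⁻¹)
    (continuous_inv_ofReal_sub hw) |w.im|⁻¹ fun x => norm_inv_ofReal_sub_le x hw

@[simp] theorem cauchyKernel_apply {w : ℂ} (hw : w.im ≠ 0) (x : ℝ) :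
    cauchyKernel hw x = ((x : ℂ) - w)⁻¹ := rfl

theorem tendsto_stieltjes_toepEigLaw {p : Measure ℝ} (hp : IsEntryLaw p) {w : ℂ} (hw : w.im ≠ 0) :
    Tendsto (fun m => stieltjes (toepEigLaw p m) w) atTop
      (𝓝 (stieltjes (gaussianReal 0 (1 / 2)) w)) := by
  have := hp.isProbabilityMeasure
  have := fun m => isProbabilityMeasure_toepEigLaw p m
  have h := (ProbabilityMeasure.tendsto_iff_tendsto_charFun
    (μ := fun m => (⟨toepEigLaw p m, this m⟩ : ProbabilityMeasure ℝ))
    (μ₀ := ⟨gaussianReal 0 (1 / 2), inferInstance⟩)).2 fun t => tendsto_charFun_toepEigLaw hp t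
  exact (ProbabilityMeasure.tendsto_iff_forall_integral_rclike_tendsto ℂ).1 h (cauchyKernel hw)

/-- The limiting spectral law of palindromic Toeplitz matrices is Gaussian. -/
theorem tendsto_meanTr_zero {p : Measure ℝ} (hp : IsEntryLaw p) {w : ℂ} (hw : w.im ≠ 0) :
    Tendsto (fun N => meanTr 0 p N w) atTop (𝓝 (stieltjes (gaussianReal 0 (1 / 2)) w)) := by
  have := hp.isProbabilityMeasure
  rw [← tendsto_add_atTop_iff_nat 2]
  have hN : Tendsto (fun m : ℕ => ((m + 2 : ℕ) : ℝ)) atTop atTop :=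
    tendsto_natCast_atTop_atTop.comp (tendsto_add_atTop_nat 2)
  have hi : Tendsto (fun m : ℕ => ((m + 2 : ℕ) : ℂ)⁻¹) atTop (𝓝 0) := by
    have := (Complex.continuous_ofReal.tendsto 0).comp hN.inv_tendsto_atTop
    simpa [Function.comp_def] using this
  have h1 : Tendsto (fun m : ℕ => 2 * |w.im|⁻¹ ^ 2 * (Real.sqrt (m + 2 : ℕ))⁻¹) atTop (𝓝 0) := by
    have : Tendsto (fun m : ℕ => (Real.sqrt (m + 2 : ℕ))⁻¹) atTop (𝓝 0) :=
      (Real.tendsto_sqrt_atTop.comp hN).inv_tendsto_atTop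
    simpa only [mul_zero] using this.const_mul (2 * |w.im|⁻¹ ^ 2)
  have h2 := squeeze_zero_norm (fun m => norm_meanTr_zero_sub_le (m := m) hp hw) h1
  -- The circulant supplies m + 1 of the m + 2 eigenvalues; the remaining one is the 0 of the border
  -- and disappears in the limit.
  have h3 : ∀ m : ℕ, ((m + 2 : ℕ) : ℂ)⁻¹ *
        (∑ k : ZMod (m + 1), ∫ z, ((toepEig k z : ℂ) - w)⁻¹ ∂(iidLaw _ p) + (-w)⁻¹) =
      (1 - ((m + 2 : ℕ) : ℂ)⁻¹) * stieltjes (toepEigLaw p m) w + ((m + 2 : ℕ) : ℂ)⁻¹ * (-w)⁻¹ :=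
    fun m => by
      rw [stieltjes, integral_toepEigLaw (continuous_inv_ofReal_sub hw)
        fun x => norm_inv_ofReal_sub_le x hw]
      have a1 : ((m : ℂ) + 1) ≠ 0 := by exact_mod_cast Nat.succ_ne_zero m
      have a2 : ((m : ℂ) + 2) ≠ 0 := by exact_mod_cast Nat.succ_ne_zero (m + 1)
      push_cast
      field_simp
      ring
  have h4 := ((tendsto_const_nhds (x := (1 : ℂ))).sub hi).mul (tendsto_stieltjes_toepEigLaw hp hw)
  have h5 := h4.add (hi.mul_const (-w)⁻¹)
  simp only [← h3] at h5
  have h6 := h2.add h5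
  simpa using h6

end Toeplitz

/-! ### Stieltjes transforms, tightness and weak convergence -/

section Stieltjes

theorem norm_inv_sub_inv_le {w w' : ℂ} {η : ℝ} (hη : 0 < η) (hw : η ≤ |w.im|) (hw' : η ≤ |w'.im|)
    (x : ℝ) : ‖((x : ℂ) - w)⁻¹ - ((x : ℂ) - w')⁻¹‖ ≤ η⁻¹ ^ 2 * ‖w - w'‖ := by
  have h1 : w.im ≠ 0 := abs_pos.1 (hη.trans_le hw)
  have h2 : w'.im ≠ 0 := abs_pos.1 (hη.trans_le hw')
  rw [inv_sub_inv (ofReal_sub_ne_zero x h1) (ofReal_sub_ne_zero x h2), sub_sub_sub_cancel_left,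
    div_eq_mul_inv, mul_inv, norm_mul, norm_mul, mul_comm, sq]
  gcongr
  · exact (norm_inv_ofReal_sub_le x h1).trans (inv_anti₀ hη hw)
  · exact (norm_inv_ofReal_sub_le x h2).trans (inv_anti₀ hη hw')

variable {ν : Measure ℝ} [IsProbabilityMeasure ν]

theorem integrable_inv_ofReal_sub {w : ℂ} (hw : w.im ≠ 0) :
    Integrable (fun x : ℝ => ((x : ℂ) - w)⁻¹) ν :=
  integrable_of_bounded (continuous_inv_ofReal_sub hw).aestronglyMeasurable
    fun x => norm_inv_ofReal_sub_le x hw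

theorem norm_stieltjes_sub_le {w w' : ℂ} {η : ℝ} (hη : 0 < η) (hw : η ≤ |w.im|)
    (hw' : η ≤ |w'.im|) : ‖stieltjes ν w - stieltjes ν w'‖ ≤ η⁻¹ ^ 2 * ‖w - w'‖ := by
  have h1 : w.im ≠ 0 := abs_pos.1 (hη.trans_le hw)
  have h2 : w'.im ≠ 0 := abs_pos.1 (hη.trans_le hw')
  rw [stieltjes, stieltjes, ← integral_sub (integrable_inv_ofReal_sub h1)
    (integrable_inv_ofReal_sub h2)]
  refine (norm_integral_le_of_norm_le_const (Eventually.of_forall fun x =>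
    norm_inv_sub_inv_le hη hw hw' x)).trans ?_
  simp

theorem inv_ofReal_sub_im (x : ℝ) (w : ℂ) :
    (((x : ℂ) - w)⁻¹).im = w.im / ((x - w.re) ^ 2 + w.im ^ 2) := by
  rw [Complex.inv_im, Complex.normSq_apply]
  simp only [Complex.sub_im, Complex.ofReal_im, zero_sub, neg_neg, Complex.sub_re, Complex.ofReal_re]
  congr 1
  ring

theorem stieltjes_im {w : ℂ} (hw : w.im ≠ 0) :
    (stieltjes ν w).im = ∫ x, w.im / ((x - w.re) ^ 2 + w.im ^ 2) ∂ν := by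
  have := integral_im (integrable_inv_ofReal_sub (ν := ν) hw)
  rw [stieltjes]
  refine this.symm.trans (integral_congr_ae (Eventually.of_forall fun x => inv_ofReal_sub_im x w))

theorem stieltjes_im_nonneg {w : ℂ} (hw : 0 < w.im) : 0 ≤ (stieltjes ν w).im := by
  rw [stieltjes_im hw.ne']
  exact integral_nonneg fun x => by positivity

theorem integrable_im_kernel {w : ℂ} (hw : w.im ≠ 0) :
    Integrable (fun x : ℝ => w.im / ((x - w.re) ^ 2 + w.im ^ 2)) ν := by
  have := (integrable_inv_ofReal_sub (ν := ν) hw).im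
  refine this.congr (Eventually.of_forall fun x => inv_ofReal_sub_im x w)

/-- The product r Im S(ir) integrates r²/(x² + r²), and one minus this function is nonnegative
everywhere and at least 1/2 for |x| > r. -/
theorem measureReal_norm_gt_le {r : ℝ} (hr : 0 < r) :
    ν.real {x | r < ‖x‖} ≤ 2 * (1 - r * (stieltjes ν (r * Complex.I)).im) := by
  have hw : ((r : ℂ) * Complex.I).im = r := by simp
  have hw' : ((r : ℂ) * Complex.I).re = 0 := by simp
  have hi := integrable_im_kernel (ν := ν) (w := (r : ℂ) * Complex.I) (by rw [hw]; exact hr.ne')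
  rw [stieltjes_im (by rw [hw]; exact hr.ne')]
  simp only [hw, hw', sub_zero] at hi ⊢
  have hms : MeasurableSet {x : ℝ | r < ‖x‖} := measurableSet_lt measurable_const measurable_norm
  have h1 : 2 * (1 - r * ∫ x, r / (x ^ 2 + r ^ 2) ∂ν) =
      ∫ x, 2 * (1 - r * (r / (x ^ 2 + r ^ 2))) ∂ν := by
    rw [integral_const_mul, integral_sub (integrable_const _) (hi.const_mul r), integral_const_mul]
    simp
  rw [h1, ← integral_indicator_one hms]
  refine integral_mono ((integrable_const (1 : ℝ)).indicator hms)
    (((integrable_const (1 : ℝ)).sub (hi.const_mul r)).const_mul 2) fun x => ?_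
  have h2 : r * (r / (x ^ 2 + r ^ 2)) = r ^ 2 / (x ^ 2 + r ^ 2) := by ring
  have h3 : 0 < x ^ 2 + r ^ 2 := by positivity
  by_cases hx : x ∈ {x : ℝ | r < ‖x‖}
  · rw [Set.indicator_of_mem hx]
    simp only [Set.mem_ofPred_eq, Real.norm_eq_abs] at hx
    have h4 : r ^ 2 ≤ x ^ 2 := by rw [← sq_abs x]; gcongr
    have h5 : r ^ 2 / (x ^ 2 + r ^ 2) ≤ 1 / 2 := by
      rw [div_le_div_iff₀ h3 (by norm_num)]; linarith
    simp only [h2, Pi.one_apply]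
    linarith
  · rw [Set.indicator_of_notMem hx]
    have h5 : r ^ 2 / (x ^ 2 + r ^ 2) ≤ 1 := by
      rw [div_le_one h3]; nlinarith [sq_nonneg x]
    simp only [h2]
    linarith

theorem tendsto_mul_stieltjes_im (ν : Measure ℝ) [IsProbabilityMeasure ν] :
    Tendsto (fun r : ℝ => r * (stieltjes ν (r * Complex.I)).im) atTop (𝓝 1) := by
  have h1 : Tendsto (fun r : ℝ => ∫ x, r ^ 2 / (x ^ 2 + r ^ 2) ∂ν) atTop (𝓝 (∫ _, (1 : ℝ) ∂ν)) := by
    refine tendsto_integral_filter_of_dominated_convergence (fun _ => 1) ?_ ?_ (integrable_const _) ?_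
    · filter_upwards [eventually_gt_atTop 0] with r hr
      have : Continuous fun x : ℝ => r ^ 2 / (x ^ 2 + r ^ 2) :=
        continuous_const.div (by fun_prop) fun x => by positivity
      exact this.aestronglyMeasurable
    · filter_upwards [eventually_gt_atTop 0] with r hr
      refine Eventually.of_forall fun x => ?_
      rw [Real.norm_eq_abs, abs_of_nonneg (by positivity), div_le_one (by positivity)]
      nlinarith [sq_nonneg x]
    · refine Eventually.of_forall fun x => ?_
      have h2 : Tendsto (fun r : ℝ => 1 - x ^ 2 / (x ^ 2 + r ^ 2)) atTop (𝓝 (1 - 0)) :=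
        tendsto_const_nhds.sub (tendsto_const_nhds.div_atTop
          (tendsto_atTop_add_const_left _ _ (tendsto_pow_atTop two_ne_zero)))
      rw [sub_zero] at h2
      refine h2.congr' ?_
      filter_upwards [eventually_gt_atTop 0] with r hr
      have : x ^ 2 + r ^ 2 ≠ 0 := by positivity
      field_simp
      ring
  rw [integral_const, probReal_univ, one_smul] at h1
  refine h1.congr' ?_
  filter_upwards [eventually_gt_atTop 0] with r hr
  have hw : ((r : ℂ) * Complex.I).im = r := by simp
  have hw' : ((r : ℂ) * Complex.I).re = 0 := by simp
  rw [stieltjes_im (by rw [hw]; exact hr.ne'), ← integral_const_mul]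
  simp only [hw, hw', sub_zero]
  refine integral_congr_ae (Eventually.of_forall fun x => ?_)
  dsimp only
  ring

/-- A tightness criterion in terms of Stieltjes transforms. -/
theorem isTightMeasureSet_range_of_stieltjes {ν : ℕ → Measure ℝ} [∀ n, IsProbabilityMeasure (ν n)]
    {g : ℝ → ℝ} (hg : Tendsto g atTop (𝓝 1))
    (h : ∀ᶠ r in atTop, ∀ ε > 0, ∀ᶠ n in atTop,
      g r - ε ≤ r * (stieltjes (ν n) (r * Complex.I)).im) :
    IsTightMeasureSet (Set.range ν) := by
  refine isTightMeasureSet_range_of_tendsto_limsup_measure_norm_gt ?_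
  have h0 : Tendsto (fun r => ENNReal.ofReal (2 * (1 - g r))) atTop (𝓝 0) := by
    have : Tendsto (fun r => 2 * (1 - g r)) atTop (𝓝 (2 * (1 - 1))) :=
      (tendsto_const_nhds.sub hg).const_mul 2
    rw [sub_self, mul_zero] at this
    simpa using ENNReal.tendsto_ofReal this
  refine tendsto_of_tendsto_of_tendsto_of_le_of_le' tendsto_const_nhds h0
    (Eventually.of_forall fun _ => zero_le) ?_
  filter_upwards [h, eventually_gt_atTop 0] with r hr hr0
  refine ENNReal.le_of_forall_pos_le_add fun ε hε _ => ?_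
  have hε' : (0 : ℝ) < ε := hε
  refine limsup_le_of_le (by isBoundedDefault) ?_
  filter_upwards [hr (ε / 2) (by positivity)] with n hn
  have h1 := measureReal_norm_gt_le (ν := ν n) hr0
  have h2 : (ν n).real {x | r < ‖x‖} ≤ 2 * (1 - g r) + ε := by linarith
  have h3 : ν n {x | r < ‖x‖} ≤ ENNReal.ofReal (2 * (1 - g r) + ε) := by
    rw [← ofReal_measureReal]; exact ENNReal.ofReal_le_ofReal h2
  refine h3.trans (ENNReal.ofReal_add_le.trans ?_)
  gcongr
  exact ENNReal.ofReal_coe_nnreal.le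

/-- The closed span of the constants and the functions `x ↦ (x - w)⁻¹`, `2 ≤ |Im w|`. -/
def cauchySpan : Submodule ℂ (ℝ →ᵇ ℂ) :=
  (Submodule.span ℂ (insert 1 {f | ∃ (w : ℂ) (hw : w.im ≠ 0), 2 ≤ |w.im| ∧
    f = cauchyKernel hw})).topologicalClosure

theorem isClosed_cauchySpan : IsClosed (cauchySpan : Set (ℝ →ᵇ ℂ)) :=
  Submodule.isClosed_topologicalClosure _

theorem one_mem_cauchySpan : (1 : ℝ →ᵇ ℂ) ∈ cauchySpan :=
  Submodule.le_topologicalClosure _ (Submodule.subset_span (Set.mem_insert _ _))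

theorem cauchyKernel_mem_cauchySpan {w : ℂ} (hw : w.im ≠ 0) (h : 2 ≤ |w.im|) :
    cauchyKernel hw ∈ cauchySpan :=
  Submodule.le_topologicalClosure _ (Submodule.subset_span (Set.mem_insert_of_mem _ ⟨w, hw, h, rfl⟩))

theorem dist_cauchyKernel_le {w w' : ℂ} (hw : w.im ≠ 0) (hw' : w'.im ≠ 0) {η : ℝ} (hη : 0 < η)
    (h : η ≤ |w.im|) (h' : η ≤ |w'.im|) :
    dist (cauchyKernel hw) (cauchyKernel hw') ≤ η⁻¹ ^ 2 * ‖w - w'‖ :=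
  (BoundedContinuousFunction.dist_le (by positivity)).2 fun x => by
    rw [dist_eq_norm]; exact norm_inv_sub_inv_le hη h h' x

/-- Partial fractions. -/
theorem cauchyKernel_mul_mem_of_ne {w w' : ℂ} (hw : w.im ≠ 0) (hw' : w'.im ≠ 0) (h : 2 ≤ |w.im|)
    (h' : 2 ≤ |w'.im|) (hne : w ≠ w') : cauchyKernel hw * cauchyKernel hw' ∈ cauchySpan := by
  have : cauchyKernel hw * cauchyKernel hw' =
      (w - w')⁻¹ • (cauchyKernel hw - cauchyKernel hw') := by
    ext x
    have h1 := ofReal_sub_ne_zero x hw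
    have h2 := ofReal_sub_ne_zero x hw'
    have h3 : w - w' ≠ 0 := sub_ne_zero.2 hne
    simp only [BoundedContinuousFunction.mul_apply, BoundedContinuousFunction.smul_apply,
      BoundedContinuousFunction.sub_apply, cauchyKernel_apply, smul_eq_mul]
    field_simp
    ring
  rw [this]
  exact Submodule.smul_mem _ _ (Submodule.sub_mem _ (cauchyKernel_mem_cauchySpan hw h)
    (cauchyKernel_mem_cauchySpan hw' h'))

/-- The square of a kernel is a uniform limit of products at distinct points w + t and w with t
real, which keeps the imaginary part. This is why the span has to be closed. -/
theorem cauchyKernel_mul_mem {w w' : ℂ} (hw : w.im ≠ 0) (hw' : w'.im ≠ 0) (h : 2 ≤ |w.im|)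
    (h' : 2 ≤ |w'.im|) : cauchyKernel hw * cauchyKernel hw' ∈ cauchySpan := by
  by_cases hne : w = w'
  · subst hne
    have him : ∀ t : ℝ, (w + t).im = w.im := fun t => by simp
    have him0 : ∀ t : ℝ, (w + t).im ≠ 0 := fun t => by rwa [him]
    have ht : Tendsto (fun t : ℝ => cauchyKernel (him0 t)) (𝓝[≠] 0) (𝓝 (cauchyKernel hw)) := by
      rw [tendsto_iff_dist_tendsto_zero]
      have h0 : Tendsto (fun t : ℝ => (2 : ℝ)⁻¹ ^ 2 * |t|) (𝓝[≠] 0) (𝓝 0) := by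
        have : Tendsto (fun t : ℝ => (2 : ℝ)⁻¹ ^ 2 * |t|) (𝓝 0) (𝓝 ((2 : ℝ)⁻¹ ^ 2 * |0|)) :=
          (continuous_const.mul continuous_abs).tendsto 0
        rw [abs_zero, mul_zero] at this
        exact this.mono_left nhdsWithin_le_nhds
      refine squeeze_zero (fun _ => dist_nonneg) (fun t => ?_) h0
      refine (dist_cauchyKernel_le (him0 t) hw two_pos (by rwa [him]) h).trans (le_of_eq ?_)
      simp
    refine isClosed_cauchySpan.mem_of_tendsto (ht.mul_const (cauchyKernel hw)) ?_
    filter_upwards [self_mem_nhdsWithin] with t ht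
    exact cauchyKernel_mul_mem_of_ne _ _ (by rwa [him]) h (by simpa using ht)
  · exact cauchyKernel_mul_mem_of_ne hw hw' h h' hne

theorem mul_mem_cauchySpan {f g : ℝ →ᵇ ℂ} (hf : f ∈ cauchySpan) (hg : g ∈ cauchySpan) :
    f * g ∈ cauchySpan := by
  have key : ∀ f ∈ Submodule.span ℂ (insert 1 {f | ∃ (w : ℂ) (hw : w.im ≠ 0), 2 ≤ |w.im| ∧
      f = cauchyKernel hw}), ∀ g ∈ Submodule.span ℂ (insert 1 {f | ∃ (w : ℂ) (hw : w.im ≠ 0),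
      2 ≤ |w.im| ∧ f = cauchyKernel hw}), f * g ∈ cauchySpan := by
    intro f hf g hg
    induction hf using Submodule.span_induction with
    | mem f hf =>
      induction hg using Submodule.span_induction with
      | mem g hg =>
        rcases hf with rfl | ⟨w, hw, h, rfl⟩ <;> rcases hg with rfl | ⟨w', hw', h', rfl⟩
        · rw [mul_one]; exact one_mem_cauchySpan
        · rw [one_mul]; exact cauchyKernel_mem_cauchySpan _ h'
        · rw [mul_one]; exact cauchyKernel_mem_cauchySpan _ h
        · exact cauchyKernel_mul_mem hw hw' h h'
      | zero => rw [mul_zero]; exact zero_mem _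
      | add x y _ _ hx hy => rw [mul_add]; exact add_mem hx hy
      | smul a x _ hx => rw [mul_smul_comm]; exact Submodule.smul_mem _ _ hx
    | zero => rw [zero_mul]; exact zero_mem _
    | add x y _ _ hx hy => rw [add_mul]; exact add_mem hx hy
    | smul a x _ hx => rw [smul_mul_assoc]; exact Submodule.smul_mem _ _ hx
  have h := map_mem_closure₂ (f := fun f g : ℝ →ᵇ ℂ => f * g) continuous_mul hf hg
    (u := (cauchySpan : Set (ℝ →ᵇ ℂ))) key
  rwa [isClosed_cauchySpan.closure_eq] at h

theorem star_mem_cauchySpan {f : ℝ →ᵇ ℂ} (hf : f ∈ cauchySpan) : star f ∈ cauchySpan := by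
  have key : ∀ f ∈ Submodule.span ℂ (insert 1 {f | ∃ (w : ℂ) (hw : w.im ≠ 0), 2 ≤ |w.im| ∧
      f = cauchyKernel hw}), star f ∈ cauchySpan := by
    intro f hf
    induction hf using Submodule.span_induction with
    | mem f hf =>
      rcases hf with rfl | ⟨w, hw, h, rfl⟩
      · rw [star_one]; exact one_mem_cauchySpan
      · have hw' : ((starRingEnd ℂ) w).im ≠ 0 := by simpa using hw
        have : star (cauchyKernel hw) = cauchyKernel hw' := by
          ext x
          simp
        rw [this]
        exact cauchyKernel_mem_cauchySpan _ (by simpa using h)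
    | zero => rw [star_zero]; exact zero_mem _
    | add x y _ _ hx hy => rw [star_add]; exact add_mem hx hy
    | smul a x _ hx => rw [star_smul]; exact Submodule.smul_mem _ _ hx
  have h := map_mem_closure (f := fun f : ℝ →ᵇ ℂ => star f) continuous_star hf
    (t := (cauchySpan : Set (ℝ →ᵇ ℂ))) key
  rwa [isClosed_cauchySpan.closure_eq] at h

/-- `cauchySpan` as a star subalgebra. -/
def cauchyAlgebra : StarSubalgebra ℂ (ℝ →ᵇ ℂ) where
  carrier := cauchySpan
  mul_mem' := mul_mem_cauchySpan
  add_mem' := add_mem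
  algebraMap_mem' c := by
    rw [Algebra.algebraMap_eq_smul_one]
    exact Submodule.smul_mem _ _ one_mem_cauchySpan
  star_mem' := star_mem_cauchySpan

theorem separatesPoints_cauchyAlgebra :
    (cauchyAlgebra.map (BoundedContinuousFunction.toContinuousMapStarₐ ℂ)).SeparatesPoints := by
  intro x y hxy
  have h2 : (2 * Complex.I).im ≠ 0 := by simp
  refine ⟨cauchyKernel h2, ⟨_, ⟨cauchyKernel h2, cauchyKernel_mem_cauchySpan h2 (by simp), rfl⟩, rfl⟩,
    fun h => hxy ?_⟩
  have h3 : ((x : ℂ) - 2 * Complex.I)⁻¹ = ((y : ℂ) - 2 * Complex.I)⁻¹ := h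
  have h4 := inv_injective h3
  exact_mod_cast sub_left_injective h4

/-- Conjugation carries the hypothesis to the lower half-plane, linearity to the span, and uniform
approximation to its closure, since all the measures have mass one. -/
theorem tendsto_integral_of_mem_cauchySpan {ι : Type*} {l : Filter ι} {ν : ι → Measure ℝ}
    [∀ n, IsProbabilityMeasure (ν n)] {μ : Measure ℝ} [IsProbabilityMeasure μ]
    (h : ∀ w : ℂ, 2 ≤ w.im → Tendsto (fun n => stieltjes (ν n) w) l (𝓝 (stieltjes μ w)))
    {g : ℝ →ᵇ ℂ} (hg : g ∈ cauchySpan) :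
    Tendsto (fun n => ∫ x, g x ∂(ν n)) l (𝓝 (∫ x, g x ∂μ)) := by
  have ib : ∀ (μ : Measure ℝ) [IsProbabilityMeasure μ] (g : ℝ →ᵇ ℂ), Integrable g μ :=
    fun μ _ g => BoundedContinuousFunction.integrable μ g
  have key : ∀ f ∈ Submodule.span ℂ (insert 1 {f | ∃ (w : ℂ) (hw : w.im ≠ 0), 2 ≤ |w.im| ∧
      f = cauchyKernel hw}), Tendsto (fun n => ∫ x, f x ∂(ν n)) l (𝓝 (∫ x, f x ∂μ)) := by
    intro f hf
    induction hf using Submodule.span_induction with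
    | mem f hf =>
      rcases hf with rfl | ⟨w, hw, h2, rfl⟩
      · simpa using tendsto_const_nhds
      · rcases le_or_gt 0 w.im with h3 | h3
        · rw [abs_of_nonneg h3] at h2
          exact h w h2
        · rw [abs_of_neg h3] at h2
          have h4 := h ((starRingEnd ℂ) w) (by simpa using h2)
          have h5 : ∀ ν : Measure ℝ, (starRingEnd ℂ) (stieltjes ν ((starRingEnd ℂ) w)) =
              ∫ x, cauchyKernel hw x ∂ν := fun ν => by
            rw [stieltjes, ← integral_conj]
            refine integral_congr_ae (Eventually.of_forall fun x => ?_)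
            simp
          simp only [← h5]
          exact (Complex.continuous_conj.tendsto _).comp h4
    | zero => simpa using tendsto_const_nhds
    | add f g _ _ hf hg =>
      simp only [BoundedContinuousFunction.add_apply]
      have e : ∀ (μ : Measure ℝ) [IsProbabilityMeasure μ],
          ∫ x, f x + g x ∂μ = ∫ x, f x ∂μ + ∫ x, g x ∂μ := fun μ _ =>
        integral_add (ib μ f) (ib μ g)
      simp only [e]
      exact hf.add hg
    | smul a f _ hf =>
      simp only [BoundedContinuousFunction.smul_apply, integral_smul]
      exact hf.const_smul a
  rw [Metric.tendsto_nhds]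
  intro ε hε
  obtain ⟨f, hf, hfg⟩ := Metric.mem_closure_iff.1 hg (ε / 3) (by positivity)
  have hd : ∀ (μ : Measure ℝ) [IsProbabilityMeasure μ],
      dist (∫ x, g x ∂μ) (∫ x, f x ∂μ) ≤ dist g f := fun μ _ => by
    rw [dist_eq_norm, ← integral_sub (ib μ g) (ib μ f)]
    refine (norm_integral_le_of_norm_le_const (C := dist g f) (Eventually.of_forall fun x => ?_)).trans ?_
    · rw [← dist_eq_norm]; exact BoundedContinuousFunction.dist_coe_le_dist x
    · simp
  filter_upwards [Metric.tendsto_nhds.1 (key f hf) (ε / 3) (by positivity)] with n hn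
  have h1 := hd (ν n)
  have h2 := hd μ
  rw [dist_comm] at h2
  have h3 := dist_triangle4 (∫ x, g x ∂(ν n)) (∫ x, f x ∂(ν n)) (∫ x, f x ∂μ) (∫ x, g x ∂μ)
  linarith

/-- Convergence of Stieltjes transforms implies weak convergence. -/
theorem tendsto_integral_of_tendsto_stieltjes {ν : ℕ → Measure ℝ}
    [hν : ∀ n, IsProbabilityMeasure (ν n)] {μ : Measure ℝ} [hμ : IsProbabilityMeasure μ]
    (h : ∀ w : ℂ, 2 ≤ w.im → Tendsto (fun n => stieltjes (ν n) w) atTop (𝓝 (stieltjes μ w)))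
    (f : ℝ →ᵇ ℝ) : Tendsto (fun n => ∫ x, f x ∂(ν n)) atTop (𝓝 (∫ x, f x ∂μ)) := by
  have ht : IsTightMeasureSet (Set.range ν) := by
    refine isTightMeasureSet_range_of_stieltjes (tendsto_mul_stieltjes_im μ) ?_
    filter_upwards [eventually_ge_atTop 2] with r hr ε hε
    have h1 := (Complex.continuous_im.tendsto _).comp (h (r * Complex.I) (by simpa using hr))
    have h2 := h1.const_mul r
    filter_upwards [h2.eventually (lt_mem_nhds (sub_lt_self _ hε))] with n hn
    exact hn.le
  have hw := ProbabilityMeasure.tendsto_of_tight_of_separatesPoints ℂ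
    (μ := fun n => (⟨ν n, hν n⟩ : ProbabilityMeasure ℝ)) (μ₀ := ⟨μ, hμ⟩) ht (𝓕 := atTop)
    separatesPoints_cauchyAlgebra fun g hg => tendsto_integral_of_mem_cauchySpan h hg
  exact ProbabilityMeasure.tendsto_iff_forall_integral_tendsto.1 hw f

end Stieltjes

/-! ### Spectral measures and the block decomposition -/

section SpectralMeasure

variable {n : Type*} [Fintype n] [DecidableEq n] {M : Matrix n n ℝ}

/-- The empirical spectral measure of a real symmetric matrix. -/
def empSpectral (hM : M.IsHermitian) : Measure ℝ :=
  (Fintype.card n : ℝ≥0∞)⁻¹ • ∑ i, Measure.dirac (hM.eigenvalues i)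

theorem isProbabilityMeasure_average_dirac [Nonempty n] (a : n → ℝ) :
    IsProbabilityMeasure ((Fintype.card n : ℝ≥0∞)⁻¹ • ∑ i, Measure.dirac (a i)) := by
  constructor
  rw [Measure.smul_apply, Measure.finsetSum_apply]
  simp only [measure_univ, Finset.sum_const, Finset.card_univ, nsmul_eq_mul, mul_one, smul_eq_mul]
  exact ENNReal.inv_mul_cancel (by simp) (ENNReal.natCast_ne_top _)

theorem stieltjes_average_dirac (a : n → ℝ) {w : ℂ} (hw : w.im ≠ 0) :
    stieltjes ((Fintype.card n : ℝ≥0∞)⁻¹ • ∑ i, Measure.dirac (a i)) w =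
      (Fintype.card n : ℂ)⁻¹ * ∑ i, ((a i : ℂ) - w)⁻¹ := by
  rw [stieltjes, integral_smul_measure, integral_finsetSum_measure fun i _ =>
    integrable_inv_ofReal_sub hw, ENNReal.toReal_inv, ENNReal.toReal_natCast, Complex.real_smul]
  simp

theorem isProbabilityMeasure_empSpectral [Nonempty n] (hM : M.IsHermitian) :
    IsProbabilityMeasure (empSpectral hM) :=
  isProbabilityMeasure_average_dirac _

theorem stieltjes_empSpectral (hM : M.IsHermitian) {w : ℂ} (hw : w.im ≠ 0) :
    stieltjes (empSpectral hM) w = normTrResol M w := by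
  rw [empSpectral, stieltjes_average_dirac _ hw, normTrResol, trace_resol hM hw]

theorem norm_normTrResol_sub_normTrResol_le (hM : M.IsHermitian) {w w' : ℂ} {η : ℝ} (hη : 0 < η)
    (hw : η ≤ |w.im|) (hw' : η ≤ |w'.im|) :
    ‖normTrResol M w - normTrResol M w'‖ ≤ η⁻¹ ^ 2 * ‖w - w'‖ := by
  rcases isEmpty_or_nonempty n with h | h
  · simp only [normTrResol, Fintype.card_of_isEmpty, Nat.cast_zero, inv_zero, zero_mul, sub_zero,
      norm_zero]
    positivity
  · have := isProbabilityMeasure_empSpectral hM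
    rw [← stieltjes_empSpectral hM (abs_pos.1 (hη.trans_le hw)),
      ← stieltjes_empSpectral hM (abs_pos.1 (hη.trans_le hw'))]
    exact norm_stieltjes_sub_le hη hw hw'

/-- The resolvent of c M at w is c⁻¹ times that of M at w/c. In this way the eigenvalues of M are
rescaled without matching them to the sorted eigenvalues of c M. -/
theorem trace_resol_smul (hM : M.IsHermitian) {c : ℝ} (hc : c ≠ 0) {w : ℂ} (hw : w.im ≠ 0) :
    (resol (c • M) w).trace = ∑ i, (((c * hM.eigenvalues i : ℝ) : ℂ) - w)⁻¹ := by
  have hcC : (c : ℂ) ≠ 0 := by exact_mod_cast hc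
  have hw' : (w / c).im ≠ 0 := by
    rw [Complex.div_ofReal_im]; exact div_ne_zero hw hc
  have h1 : resol (c • M) w = (c : ℂ)⁻¹ • resol M (w / c) := by
    refine Matrix.inv_eq_right_inv ?_
    have h2 : (c • M).map Complex.ofReal - w • (1 : Matrix n n ℂ) =
        (c : ℂ) • (M.map Complex.ofReal - (w / c) • 1) := by
      rw [smul_sub, smul_smul, mul_div_cancel₀ _ hcC]
      congr 1
      ext i j
      simp
    rw [h2, smul_mul_smul_comm, mul_inv_cancel₀ hcC, one_smul, mul_resol hM hw']
  rw [h1, Matrix.trace_smul, trace_resol hM hw', smul_eq_mul, Finset.mul_sum]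
  refine Finset.sum_congr rfl fun i _ => ?_
  rw [← mul_inv]
  congr 1
  push_cast
  field_simp

theorem stieltjes_normalizedSpectralMeasure [Nonempty n] (hM : M.IsHermitian) {w : ℂ}
    (hw : w.im ≠ 0) : stieltjes (normalizedSpectralMeasure hM) w =
      normTrResol ((Real.sqrt (Fintype.card n))⁻¹ • M) w := by
  have hc : (Real.sqrt (Fintype.card n))⁻¹ ≠ 0 :=
    inv_ne_zero (Real.sqrt_pos.2 (by exact_mod_cast Fintype.card_pos)).ne'
  rw [normalizedSpectralMeasure, stieltjes_average_dirac _ hw, normTrResol,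
    trace_resol_smul hM hc hw]
  simp only [div_eq_inv_mul]

/-- On symmetric vectors (u, u) the block matrix acts as A + B, on antisymmetric vectors (u, -u) as
A - B. The resulting formula is checked by multiplication. -/
theorem resol_fromBlocks {A B : Matrix n n ℝ} (h1 : (A + B).IsHermitian) (h2 : (A - B).IsHermitian)
    {w : ℂ} (hw : w.im ≠ 0) : resol (Matrix.fromBlocks A B B A) w =
      Matrix.fromBlocks ((2 : ℂ)⁻¹ • (resol (A + B) w + resol (A - B) w))
        ((2 : ℂ)⁻¹ • (resol (A + B) w - resol (A - B) w))
        ((2 : ℂ)⁻¹ • (resol (A + B) w - resol (A - B) w))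
        ((2 : ℂ)⁻¹ • (resol (A + B) w + resol (A - B) w)) := by
  refine Matrix.inv_eq_right_inv ?_
  have e1 := mul_resol h1 hw
  have e2 := mul_resol h2 hw
  have m1 : (A + B).map Complex.ofReal = A.map Complex.ofReal + B.map Complex.ofReal := by
    ext i j; simp
  have m2 : (A - B).map Complex.ofReal = A.map Complex.ofReal - B.map Complex.ofReal := by
    ext i j; simp
  rw [m1] at e1
  rw [m2] at e2
  set a := A.map Complex.ofReal
  set b := B.map Complex.ofReal
  set R := resol (A + B) w
  set R' := resol (A - B) w
  have hb : (Matrix.fromBlocks A B B A).map Complex.ofReal - w • (1 : Matrix (n ⊕ n) (n ⊕ n) ℂ) =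
      Matrix.fromBlocks (a - w • 1) b b (a - w • 1) := by
    rw [Matrix.fromBlocks_map, ← Matrix.fromBlocks_one, Matrix.fromBlocks_smul,
      sub_eq_add_neg, Matrix.fromBlocks_neg, Matrix.fromBlocks_add]
    simp [a, b, sub_eq_add_neg]
  have d1 : (a - w • 1) * ((2 : ℂ)⁻¹ • (R + R')) + b * ((2 : ℂ)⁻¹ • (R - R')) = 1 := by
    calc _ = (2 : ℂ)⁻¹ • ((a + b - w • 1) * R + (a - b - w • 1) * R') := by
          rw [mul_smul_comm, mul_smul_comm, ← smul_add]; congr 1; noncomm_ring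
      _ = 1 := by rw [e1, e2, ← two_smul ℂ, smul_smul]; norm_num
  have d2 : (a - w • 1) * ((2 : ℂ)⁻¹ • (R - R')) + b * ((2 : ℂ)⁻¹ • (R + R')) = 0 := by
    calc _ = (2 : ℂ)⁻¹ • ((a + b - w • 1) * R - (a - b - w • 1) * R') := by
          rw [mul_smul_comm, mul_smul_comm, ← smul_add]; congr 1; noncomm_ring
      _ = 0 := by rw [e1, e2, sub_self, smul_zero]
  rw [hb, Matrix.fromBlocks_multiply, d1, d2, add_comm (b * _), add_comm (b * _), d1, d2,
    Matrix.fromBlocks_one]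

end SpectralMeasure

/-! ### The spectral measure of the disco matrix -/

section Disco

variable {N : ℕ}

theorem isProbabilityMeasure_discoSpectralMeasure [NeZero N] (z : DiscoIndex N → ℝ) :
    IsProbabilityMeasure (discoSpectralMeasure z) :=
  have : Nonempty (Fin N) := ⟨0⟩
  isProbabilityMeasure_average_dirac _

theorem stieltjes_discoSpectralMeasure [NeZero N] (z : DiscoIndex N → ℝ) {w : ℂ} (hw : w.im ≠ 0) :
    stieltjes (discoSpectralMeasure z) w =
      2⁻¹ * (normTrResol (blockSum 1 z) w + normTrResol (blockSum (-1) z) w) := by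
  have : Nonempty (Fin N) := ⟨0⟩
  rw [discoSpectralMeasure, stieltjes_normalizedSpectralMeasure _ hw]
  have hcard : (Fintype.card (Fin N ⊕ Fin N) : ℝ) = 2 * N := by
    rw [Fintype.card_sum, Fintype.card_fin]; push_cast; ring
  set c := (Real.sqrt (2 * N))⁻¹ with hc
  set A := pstMatrix fun k => z (Sum.inl k)
  set B := symMatrix fun q => z (Sum.inr q)
  have e1 : c • A + c • B = blockSum 1 z := by rw [blockSum, one_smul, smul_add]
  have e2 : c • A - c • B = blockSum (-1) z := by
    rw [blockSum, neg_one_smul, smul_add, smul_neg, sub_eq_add_neg]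
  have e3 : c • discoOfEntries z = Matrix.fromBlocks (c • A) (c • B) (c • B) (c • A) := by
    rw [discoOfEntries, disco, Matrix.fromBlocks_smul]
  rw [hcard, ← hc, e3, normTrResol, resol_fromBlocks (by rw [e1]; exact blockSum_isHermitian _ _)
    (by rw [e2]; exact blockSum_isHermitian _ _) hw, e1, e2, Matrix.trace,
    Fintype.sum_sum_type]
  change _ * (((2 : ℂ)⁻¹ • (resol (blockSum 1 z) w + resol (blockSum (-1) z) w)).trace +
    ((2 : ℂ)⁻¹ • (resol (blockSum 1 z) w + resol (blockSum (-1) z) w)).trace) = _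
  rw [Matrix.trace_smul, Matrix.trace_add, normTrResol, normTrResol, Fintype.card_sum,
    Fintype.card_fin]
  have : (N : ℂ) ≠ 0 := by exact_mod_cast NeZero.ne N
  push_cast
  rw [smul_eq_mul]
  field_simp

/-- This provides the measurability needed for convergence in probability. Continuity of the
resolvent traces, together with the fact that Stieltjes convergence implies weak convergence,
replaces an argument about individual eigenvalues. For N = 0 the spectral measure is zero. -/
theorem continuous_integral_discoSpectralMeasure (f : ℝ →ᵇ ℝ) :
    Continuous fun z : DiscoIndex N → ℝ => ∫ x, f x ∂(discoSpectralMeasure z) := by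
  rcases Nat.eq_zero_or_pos N with rfl | hN
  · have h : ∀ z : DiscoIndex 0 → ℝ, discoSpectralMeasure z = 0 := fun z => by
      simp [discoSpectralMeasure, normalizedSpectralMeasure]
    simp only [h]
    exact continuous_const
  · have : NeZero N := ⟨hN.ne'⟩
    refine continuous_iff_seqContinuous.2 fun z z₀ hz => ?_
    have := fun k => isProbabilityMeasure_discoSpectralMeasure (z k)
    have := isProbabilityMeasure_discoSpectralMeasure z₀
    refine tendsto_integral_of_tendsto_stieltjes
      (ν := fun k => discoSpectralMeasure (z k)) (fun w hw => ?_) f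
    have hw0 : w.im ≠ 0 := (two_pos.trans_le hw).ne'
    simp only [stieltjes_discoSpectralMeasure _ hw0]
    have hc : ∀ e : ℝ, Continuous fun z : DiscoIndex N → ℝ => normTrResol (blockSum e z) w :=
      fun e => continuous_normTrResol (continuous_blockSum e) (blockSum_isHermitian e) hw0
    exact ((continuous_const.mul ((hc 1).add (hc (-1)))).tendsto z₀).comp hz

theorem norm_meanTr_sub_le {p : Measure ℝ} [IsProbabilityMeasure p] (e : ℝ) {w w' : ℂ} {η : ℝ}
    (hη : 0 < η) (hw : η ≤ |w.im|) (hw' : η ≤ |w'.im|) :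
    ‖meanTr e p N w - meanTr e p N w'‖ ≤ η⁻¹ ^ 2 * ‖w - w'‖ := by
  have hi : ∀ {w : ℂ}, η ≤ |w.im| → Integrable (fun z => normTrResol (blockSum (N := N) e z) w)
      (iidLaw (DiscoIndex N) p) := fun {w} hw => by
    have hw0 : w.im ≠ 0 := abs_pos.1 (hη.trans_le hw)
    exact integrable_of_bounded (continuous_normTrResol (continuous_blockSum e)
      (blockSum_isHermitian e) hw0).aestronglyMeasurable
      fun z => norm_normTrResol_le (blockSum_isHermitian e z) hw0
  rw [meanTr, meanTr, ← integral_sub (hi hw) (hi hw')]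
  refine (norm_integral_le_of_norm_le_const (Eventually.of_forall fun z =>
    norm_normTrResol_sub_normTrResol_le (blockSum_isHermitian e z) hη hw hw')).trans ?_
  simp

end Disco

/-! ### Almost sure convergence of the transforms to their means -/

section AlmostSure

variable {Ω : Type*} [MeasurableSpace Ω] {P : Measure Ω} [IsProbabilityMeasure P]

/-- The sum of the g n has finite integral, hence is finite almost surely. No assumption on the
joint law of the g n enters. -/
theorem ae_tendsto_zero_of_summable_integral {g : ℕ → Ω → ℝ} (hg : ∀ n ω, 0 ≤ g n ω)
    (hi : ∀ n, Integrable (g n) P) (hs : Summable fun n => ∫ ω, g n ω ∂P) :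
    ∀ᵐ ω ∂P, Tendsto (fun n => g n ω) atTop (𝓝 0) := by
  have hm : ∀ n, AEMeasurable (fun ω => ENNReal.ofReal (g n ω)) P := fun n =>
    (hi n).aestronglyMeasurable.aemeasurable.ennreal_ofReal
  have h1 : ∫⁻ ω, ∑' n, ENNReal.ofReal (g n ω) ∂P ≠ ∞ := by
    rw [lintegral_tsum hm]
    simp only [← fun n => ofReal_integral_eq_lintegral_ofReal (hi n) (Eventually.of_forall (hg n))]
    exact hs.tsum_ofReal_ne_top
  filter_upwards [ae_lt_top' (AEMeasurable.tsum hm) h1] with ω hω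
  have h2 := ENNReal.tendsto_atTop_zero_of_tsum_ne_top hω.ne
  have h3 := (ENNReal.tendsto_toReal ENNReal.zero_ne_top).comp h2
  refine h3.congr fun n => ?_
  simp [ENNReal.toReal_ofReal (hg n ω)]

theorem summable_inv_mul_sqrt (C : ℝ) : Summable fun N : ℕ => C / (N * Real.sqrt N) := by
  have h : Summable fun N : ℕ => 1 / (N : ℝ) ^ (3 / 2 : ℝ) :=
    Real.summable_one_div_nat_rpow.2 (by norm_num)
  refine (h.mul_left C).congr fun N => ?_
  have : (N : ℝ) ^ (3 / 2 : ℝ) = N * Real.sqrt N := by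
    rw [show (3 / 2 : ℝ) = 1 + 1 / 2 by norm_num, Real.rpow_add_of_nonneg (by positivity) (by norm_num)
      (by norm_num), Real.rpow_one, Real.sqrt_eq_rpow]
  rw [this]
  ring

/-- Both families are equi-Lipschitz away from the real axis, so a countable dense set of points
suffices, and with it one null set for all w. -/
theorem tendsto_sub_of_denseRange {a b : ℕ → ℂ → ℂ} {u : ℕ → {w : ℂ // 0 < w.im}}
    (hu : DenseRange u)
    (ha : ∀ n w w' (η : ℝ), 0 < η → η ≤ |w.im| → η ≤ |w'.im| →
      ‖a n w - a n w'‖ ≤ η⁻¹ ^ 2 * ‖w - w'‖)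
    (hb : ∀ n w w' (η : ℝ), 0 < η → η ≤ |w.im| → η ≤ |w'.im| →
      ‖b n w - b n w'‖ ≤ η⁻¹ ^ 2 * ‖w - w'‖)
    (h : ∀ k, Tendsto (fun n => a n (u k) - b n (u k)) atTop (𝓝 0)) {w : ℂ} (hw : 0 < w.im) :
    Tendsto (fun n => a n w - b n w) atTop (𝓝 0) := by
  rw [Metric.tendsto_nhds]
  intro ε hε
  set η := w.im / 2 with hη
  have hη0 : 0 < η := half_pos hw
  obtain ⟨k, hk⟩ := hu.exists_dist_lt ⟨w, hw⟩ (ε := min η (ε / (3 * η⁻¹ ^ 2))) (by positivity)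
  have hk' : ‖w - u k‖ < min η (ε / (3 * η⁻¹ ^ 2)) := by
    rw [← dist_eq_norm]; exact hk
  have h1 : η ≤ |w.im| := by rw [abs_of_pos hw]; linarith
  have h2 : η ≤ |(u k : ℂ).im| := by
    have h3 := (Complex.abs_im_le_norm (w - u k)).trans (hk'.le.trans (min_le_left _ _))
    rw [Complex.sub_im] at h3
    have h4 := le_abs_self (u k : ℂ).im
    have h5 := le_abs_self (w.im - (u k : ℂ).im)
    linarith
  have h6 : η⁻¹ ^ 2 * ‖w - u k‖ < ε / 3 := by
    have := hk'.trans_le (min_le_right _ _)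
    rw [lt_div_iff₀ (by positivity)] at this
    linarith
  filter_upwards [Metric.tendsto_nhds.1 (h k) (ε / 3) (by positivity)] with n hn
  rw [dist_zero_right] at hn ⊢
  have h7 := ha n w (u k) η hη0 h1 h2
  have h8 := hb n w (u k) η hη0 h1 h2
  have h9 : a n w - b n w = (a n w - a n (u k)) + (a n (u k) - b n (u k)) - (b n w - b n (u k)) := by
    ring
  rw [h9]
  have h10 := norm_sub_le (a n w - a n (u k) + (a n (u k) - b n (u k))) (b n w - b n (u k))
  have h11 := norm_add_le (a n w - a n (u k)) (a n (u k) - b n (u k))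
  linarith

variable {Y : (N : ℕ) → Ω → DiscoIndex N → ℝ} {p : Measure ℝ}

theorem ae_tendsto_normTrResol_sub_meanTr (hp : IsEntryLaw p) (hY : ∀ N, AEMeasurable (Y N) P)
    (hYp : ∀ N, P.map (Y N) = iidLaw (DiscoIndex N) p) {e : ℝ} (he : e ^ 2 = 1) {w : ℂ}
    (hw : w.im ≠ 0) :
    ∀ᵐ ω ∂P, Tendsto (fun N => normTrResol (blockSum e (Y N ω)) w - meanTr e p N w) atTop (𝓝 0) := by
  have := hp.isProbabilityMeasure
  obtain ⟨C, hC0, hC⟩ := integral_normTrResol_blockSum_sub_pow_four_le hp he hw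
  set G : (N : ℕ) → (DiscoIndex N → ℝ) → ℝ := fun N z =>
    ‖normTrResol (blockSum e z) w - meanTr e p N w‖ ^ 4 with hG
  have hGc : ∀ N, Continuous (G N) := fun N =>
    (((continuous_normTrResol (continuous_blockSum e) (blockSum_isHermitian e) hw).sub
      continuous_const).norm).pow 4
  have hGi : ∀ N, Integrable (G N) (iidLaw (DiscoIndex N) p) := fun N =>
    integrable_of_bounded (hGc N).aestronglyMeasurable (C := (|w.im|⁻¹ + |w.im|⁻¹) ^ 4) fun z => by
      rw [hG, norm_pow, norm_norm]
      refine pow_le_pow_left₀ (norm_nonneg _) ((norm_sub_le _ _).trans (add_le_add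
        (norm_normTrResol_le (blockSum_isHermitian e z) hw) (norm_meanTr_le e hw))) 4
  have hint : ∀ N, ∫ ω, G N (Y N ω) ∂P = ∫ z, G N z ∂(iidLaw (DiscoIndex N) p) := fun N => by
    rw [← hYp, integral_map (hY N) (hGc N).aestronglyMeasurable]
  have hii : ∀ N, Integrable (fun ω => G N (Y N ω)) P := fun N =>
    (integrable_map_measure (hGc N).aestronglyMeasurable (hY N)).1 (by rw [hYp]; exact hGi N)
  have hsum : Summable fun N => ∫ ω, G N (Y N ω) ∂P := by
    rw [← summable_nat_add_iff 1]
    refine Summable.of_nonneg_of_le (fun N => integral_nonneg fun ω => by positivity)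
      (fun N => ?_) ((summable_nat_add_iff 1).2 (summable_inv_mul_sqrt C))
    rw [hint]
    exact hC (N + 1) (by omega)
  filter_upwards [ae_tendsto_zero_of_summable_integral (fun n ω => by positivity) hii hsum] with ω hω
  rw [tendsto_zero_iff_norm_tendsto_zero]
  have h1 := (Real.continuous_sqrt.tendsto _).comp ((Real.continuous_sqrt.tendsto _).comp hω)
  rw [Real.sqrt_zero, Real.sqrt_zero] at h1
  refine h1.congr fun N => ?_
  simp only [Function.comp_apply, hG]
  rw [show ∀ x : ℝ, x ^ 4 = (x ^ 2) ^ 2 from fun x => by ring, Real.sqrt_sq (by positivity),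
    Real.sqrt_sq (norm_nonneg _)]

/-- Almost surely, the Stieltjes transforms approach their means at all points of the upper
half-plane. -/
theorem ae_forall_tendsto_normTrResol_sub_meanTr (hp : IsEntryLaw p)
    (hY : ∀ N, AEMeasurable (Y N) P) (hYp : ∀ N, P.map (Y N) = iidLaw (DiscoIndex N) p) {e : ℝ}
    (he : e ^ 2 = 1) :
    ∀ᵐ ω ∂P, ∀ w : ℂ, 0 < w.im →
      Tendsto (fun N => normTrResol (blockSum e (Y N ω)) w - meanTr e p N w) atTop (𝓝 0) := by
  have := hp.isProbabilityMeasure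
  have : Nonempty {w : ℂ // 0 < w.im} := ⟨⟨Complex.I, by simp⟩⟩
  obtain ⟨u, hu⟩ := TopologicalSpace.exists_dense_seq {w : ℂ // 0 < w.im}
  have h := ae_all_iff.2 fun k => ae_tendsto_normTrResol_sub_meanTr hp hY hYp he (u k).2.ne'
  filter_upwards [h] with ω hω w hw
  exact tendsto_sub_of_denseRange (a := fun N w => normTrResol (blockSum e (Y N ω)) w)
    (b := fun N w => meanTr e p N w) hu
    (fun N w w' η hη h1 h2 => norm_normTrResol_sub_normTrResol_le (blockSum_isHermitian e _) hη h1 h2)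
    (fun N w w' η hη h1 h2 => norm_meanTr_sub_le e hη h1 h2) hω hw

end AlmostSure

/-! ### The limiting equation: existence, uniqueness and unbounded support -/

section SelfConsistentLimit

/-- Any entry law would do to construct the limit, because the limiting equation does not involve p.
-/
theorem isEntryLaw_gaussianReal : IsEntryLaw (gaussianReal 0 1) where
  isProbabilityMeasure := inferInstance
  integrable_pow k := by
    rcases Nat.eq_zero_or_pos k with rfl | hk
    · simp
    · have h := (memLp_id_gaussianReal (μ := 0) (v := 1) (k : NNReal)).integrable_norm_pow
        (p := k) hk.ne'
      refine h.mono' (by fun_prop) (Eventually.of_forall fun x => ?_)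
      simp
  mean_eq_zero := integral_id_gaussianReal
  variance_eq_one := by
    have h := variance_id_gaussianReal (μ := 0) (v := 1)
    rw [variance_eq_integral aemeasurable_id] at h
    simpa [integral_id_gaussianReal] using h

/-- The uniform Lipschitz bound allows the moving argument of the Toeplitz transform to be replaced
by its limit. A general filter is used so that the statement applies along an ultrafilter. -/
theorem meanTr_limit_selfConsistent {p : Measure ℝ} (hp : IsEntryLaw p) {e : ℝ} (he : e ^ 2 = 1)
    {w s : ℂ} (hw : 0 < w.im) (hs : 0 ≤ s.im) {ι : Type*} {l : Filter ι} [l.NeBot] {φ : ι → ℕ}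
    (hφ : Tendsto φ l atTop) (h : Tendsto (fun i => meanTr e p (φ i) w) l (𝓝 s)) :
    s = stieltjes (gaussianReal 0 (1 / 2)) (w + s / 2) := by
  have := hp.isProbabilityMeasure
  have him : ∀ a : ℂ, (w + a / 2).im = w.im + a.im / 2 := fun a => by
    rw [Complex.add_im, show (2 : ℂ) = ((2 : ℝ) : ℂ) by norm_num, Complex.div_ofReal_im]
  have hge : ∀ a : ℂ, 0 ≤ a.im → w.im ≤ |(w + a / 2).im| := fun a ha => by
    rw [him]; exact (by linarith : w.im ≤ w.im + a.im / 2).trans (le_abs_self _)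
  have h1 := (tendsto_meanTr_sub_meanTr_zero hp he hw).comp hφ
  have h2 : Tendsto (fun i => meanTr 0 p (φ i) (w + meanTr e p (φ i) w / 2) -
      meanTr 0 p (φ i) (w + s / 2)) l (𝓝 0) := by
    have h3 : Tendsto (fun i => w.im⁻¹ ^ 2 * ‖(w + meanTr e p (φ i) w / 2) - (w + s / 2)‖) l
        (𝓝 (w.im⁻¹ ^ 2 * ‖(w + s / 2) - (w + s / 2)‖)) :=
      ((((h.div_const 2).const_add w).sub_const _).norm).const_mul _
    rw [sub_self, norm_zero, mul_zero] at h3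
    exact squeeze_zero_norm (fun i => norm_meanTr_sub_le 0 hw (hge _ (meanTr_im_nonneg e hw))
      (hge s hs)) h3
  have h4 := (tendsto_meanTr_zero hp (w := w + s / 2) (by rw [him]; linarith)).comp hφ
  have h5 := (h1.add h2).add h4
  simp only [Function.comp_def, sub_add_sub_cancel, sub_add_cancel, add_zero, zero_add] at h5
  exact tendsto_nhds_unique h h5

/-- The self-consistent equation determines the limit of the mean Stieltjes transforms. -/
theorem tendsto_meanTr_of_selfConsistent {p : Measure ℝ} (hp : IsEntryLaw p) {e : ℝ}
    (he : e ^ 2 = 1) {w s : ℂ} (hw : 2 ≤ w.im) (hs : 0 ≤ s.im)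
    (h : s = stieltjes (gaussianReal 0 (1 / 2)) (w + s / 2)) :
    Tendsto (fun N => meanTr e p N w) atTop (𝓝 s) := by
  have := hp.isProbabilityMeasure
  have hw0 : 0 < w.im := two_pos.trans_le hw
  have him : ∀ a : ℂ, (w + a / 2).im = w.im + a.im / 2 := fun a => by
    rw [Complex.add_im, show (2 : ℂ) = ((2 : ℝ) : ℂ) by norm_num, Complex.div_ofReal_im]
  have hge : ∀ a : ℂ, 0 ≤ a.im → 2 ≤ |(w + a / 2).im| := fun a ha => by
    rw [him]; exact (by linarith : 2 ≤ w.im + a.im / 2).trans (le_abs_self _)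
  have h1 := (tendsto_meanTr_sub_meanTr_zero hp he hw0).norm
  have h2 := ((tendsto_meanTr_zero hp (w := w + s / 2) (by rw [him]; linarith)).sub_const s).norm
  rw [← h, sub_self] at h2
  have h3 := (h1.add h2).const_mul 2
  rw [norm_zero, add_zero, mul_zero] at h3
  rw [tendsto_iff_norm_sub_tendsto_zero]
  refine squeeze_zero (fun _ => norm_nonneg _) (fun N => ?_) h3
  set a := meanTr e p N w
  -- At height 2 the Lipschitz constant is 1/4, and with the factor 1/2 of the shift the map
  -- contracts by 1/8. Absorbing ‖a - s‖/8 costs 8/7 ≤ 2, the factor in `h3`.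
  have h4 : ‖meanTr 0 p N (w + a / 2) - meanTr 0 p N (w + s / 2)‖ ≤
      (2 : ℝ)⁻¹ ^ 2 * (‖a - s‖ / 2) := by
    refine (norm_meanTr_sub_le 0 two_pos (hge _ (meanTr_im_nonneg e hw0)) (hge s hs)).trans
      (le_of_eq ?_)
    rw [add_sub_add_left_eq_sub, ← sub_div, norm_div, Complex.norm_ofNat]
  have h5 : a - s = (a - meanTr 0 p N (w + a / 2)) + (meanTr 0 p N (w + a / 2) -
      meanTr 0 p N (w + s / 2)) + (meanTr 0 p N (w + s / 2) - s) := by ring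
  have h6 := norm_add₃_le (a := a - meanTr 0 p N (w + a / 2))
    (b := meanTr 0 p N (w + a / 2) - meanTr 0 p N (w + s / 2)) (c := meanTr 0 p N (w + s / 2) - s)
  rw [← h5] at h6
  linarith [norm_nonneg (a - s), norm_nonneg (a - meanTr 0 p N (w + a / 2)),
    norm_nonneg (meanTr 0 p N (w + s / 2) - s)]

/-- A crude comparison that ignores the shift, whose size is at most 1/(2 Im w). It is used high on
the imaginary axis, where the error remains negligible after multiplication by Im w, to obtain
tightness. -/
theorem eventually_norm_meanTr_sub_stieltjes_le {p : Measure ℝ} (hp : IsEntryLaw p) {e : ℝ}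
    (he : e ^ 2 = 1) {w : ℂ} (hw : 0 < w.im) {ε : ℝ} (hε : 0 < ε) :
    ∀ᶠ N in atTop, ‖meanTr e p N w - stieltjes (gaussianReal 0 (1 / 2)) w‖ ≤
      w.im⁻¹ ^ 3 / 2 + ε := by
  have := hp.isProbabilityMeasure
  have him : ∀ a : ℂ, (w + a / 2).im = w.im + a.im / 2 := fun a => by
    rw [Complex.add_im, show (2 : ℂ) = ((2 : ℝ) : ℂ) by norm_num, Complex.div_ofReal_im]
  have h1 := (tendsto_meanTr_sub_meanTr_zero hp he hw).norm
  have h2 := ((tendsto_meanTr_zero hp hw.ne').sub_const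
    (stieltjes (gaussianReal 0 (1 / 2)) w)).norm
  rw [sub_self] at h2
  have h3 := h1.add h2
  rw [norm_zero, add_zero] at h3
  filter_upwards [h3.eventually (gt_mem_nhds hε)] with N hN
  set a := meanTr e p N w
  have ha : 0 ≤ a.im := meanTr_im_nonneg e hw
  have h4 : ‖meanTr 0 p N (w + a / 2) - meanTr 0 p N w‖ ≤ w.im⁻¹ ^ 3 / 2 := by
    refine (norm_meanTr_sub_le 0 hw ?_ (le_abs_self _)).trans ?_
    · rw [him]; exact (by linarith : w.im ≤ w.im + a.im / 2).trans (le_abs_self _)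
    · rw [add_sub_cancel_left, norm_div, Complex.norm_ofNat]
      have h5 : ‖a‖ ≤ w.im⁻¹ := by
        have := norm_meanTr_le (N := N) (p := p) e hw.ne'
        rwa [abs_of_pos hw] at this
      calc _ ≤ w.im⁻¹ ^ 2 * (w.im⁻¹ / 2) := by gcongr
        _ = _ := by ring
  have h6 := norm_add₃_le (a := a - meanTr 0 p N (w + a / 2))
    (b := meanTr 0 p N (w + a / 2) - meanTr 0 p N w)
    (c := meanTr 0 p N w - stieltjes (gaussianReal 0 (1 / 2)) w)
  have h7 : (a - meanTr 0 p N (w + a / 2)) + (meanTr 0 p N (w + a / 2) - meanTr 0 p N w) +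
      (meanTr 0 p N w - stieltjes (gaussianReal 0 (1 / 2)) w) =
      a - stieltjes (gaussianReal 0 (1 / 2)) w := by ring
  rw [h7] at h6
  linarith

/-- An almost sure event on the infinite product space is nonempty. One realization yields
deterministic matrices whose spectral measures can be used for compactness. -/
theorem exists_forall_tendsto_normTrResol_sub_meanTr {p : Measure ℝ} (hp : IsEntryLaw p) {e : ℝ}
    (he : e ^ 2 = 1) : ∃ z : (N : ℕ) → DiscoIndex N → ℝ, ∀ w : ℂ, 0 < w.im →
      Tendsto (fun N => normTrResol (blockSum e (z N)) w - meanTr e p N w) atTop (𝓝 0) := by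
  have := hp.isProbabilityMeasure
  have h := fun N => measurePreserving_eval_infinitePi (fun N => iidLaw (DiscoIndex N) p) N
  have hae := ae_forall_tendsto_normTrResol_sub_meanTr
    (P := Measure.infinitePi fun N => iidLaw (DiscoIndex N) p) (Y := fun N ω => ω N) hp
    (fun N => (h N).aemeasurable) (fun N => (h N).map_eq) he
  exact hae.exists

/-- Existence of the limiting spectral measure. -/
theorem exists_selfConsistent_measure : ∃ μ : Measure ℝ, IsProbabilityMeasure μ ∧
    ∀ w : ℂ, 0 < w.im →
      stieltjes μ w = stieltjes (gaussianReal 0 (1 / 2)) (w + stieltjes μ w / 2) := by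
  have hp := isEntryLaw_gaussianReal
  have he : (1 : ℝ) ^ 2 = 1 := one_pow 2
  obtain ⟨z, hz⟩ := exists_forall_tendsto_normTrResol_sub_meanTr hp he
  set ν : ℕ → Measure ℝ := fun N => empSpectral (blockSum_isHermitian 1 (z (N + 1))) with hν
  have hνp : ∀ N, IsProbabilityMeasure (ν N) := fun N => isProbabilityMeasure_empSpectral _
  have hνs : ∀ w : ℂ, 0 < w.im → Tendsto (fun N => stieltjes (ν N) w -
      meanTr 1 (gaussianReal 0 1) (N + 1) w) atTop (𝓝 0) := fun w hw => by
    have h := (tendsto_add_atTop_iff_nat 1).2 (hz w hw)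
    refine h.congr fun N => ?_
    rw [hν, stieltjes_empSpectral _ hw.ne']
  have htight : IsTightMeasureSet (Set.range ν) := by
    -- The subtracted term is r times the error r⁻³/2 of the comparison with the Gaussian transform.
    refine isTightMeasureSet_range_of_stieltjes (g := fun r =>
      r * (stieltjes (gaussianReal 0 (1 / 2)) (r * Complex.I)).im - r⁻¹ ^ 2 / 2) ?_ ?_
    · have h1 : Tendsto (fun r : ℝ => r⁻¹ ^ 2 / 2) atTop (𝓝 (0 ^ 2 / 2)) :=
        (tendsto_inv_atTop_zero.pow 2).div_const 2
      have h2 := (tendsto_mul_stieltjes_im (gaussianReal 0 (1 / 2))).sub h1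
      simpa using h2
    · filter_upwards [eventually_gt_atTop 0] with r hr ε hε
      have hw : 0 < ((r : ℂ) * Complex.I).im := by simpa using hr
      have h1 := (tendsto_add_atTop_nat 1).eventually
        (eventually_norm_meanTr_sub_stieltjes_le hp he hw (ε := ε / (2 * r)) (by positivity))
      have h2 := ((hνs _ hw).norm).eventually (gt_mem_nhds (by
        rw [norm_zero]; positivity : ‖(0 : ℂ)‖ < ε / (2 * r)))
      filter_upwards [h1, h2] with N h3 h4
      have hw' : ((r : ℂ) * Complex.I).im = r := by simp
      rw [hw'] at h3
      set s := stieltjes (ν N) (r * Complex.I)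
      set F := stieltjes (gaussianReal 0 (1 / 2)) (r * Complex.I)
      have h5 := norm_sub_le_norm_sub_add_norm_sub s
        (meanTr 1 (gaussianReal 0 1) (N + 1) (r * Complex.I)) F
      have h6 := (Complex.abs_im_le_norm (s - F)).trans h5
      rw [Complex.sub_im] at h6
      have h7 : F.im - s.im ≤ r⁻¹ ^ 3 / 2 + ε / r := by
        have h8 := neg_abs_le (s.im - F.im)
        have h9 : ε / r = ε / (2 * r) + ε / (2 * r) := by field_simp; norm_num
        rw [h9]
        linarith
      have h10 := mul_le_mul_of_nonneg_left h7 hr.le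
      have h11 : r * (r⁻¹ ^ 3 / 2 + ε / r) = r⁻¹ ^ 2 / 2 + ε := by field_simp
      rw [h11] at h10
      linarith
  set S : ℕ → ProbabilityMeasure ℝ := fun N => ⟨ν N, hνp N⟩
  have hcomp : IsCompact (closure (Set.range S)) := by
    refine isCompact_closure_of_isTightMeasureSet ?_
    convert htight using 1
    ext m
    constructor
    · rintro ⟨_, ⟨N, rfl⟩, rfl⟩
      exact ⟨N, rfl⟩
    · rintro ⟨N, rfl⟩
      exact ⟨_, ⟨N, rfl⟩, rfl⟩
  -- Tightness gives a weak cluster point, and an ultrafilter makes it a limit for all w at once.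
  obtain ⟨μ, -, hμ⟩ := hcomp.exists_mapClusterPt (f := atTop) (u := S)
    (le_principal_iff.2 (mem_map.2 (Eventually.of_forall fun N => subset_closure ⟨N, rfl⟩)))
  obtain ⟨U, hU, hUμ⟩ := mapClusterPt_iff_ultrafilter.1 hμ
  refine ⟨μ, inferInstance, fun w hw => ?_⟩
  have h1 : Tendsto (fun N => stieltjes (ν N) w) U (𝓝 (stieltjes μ w)) :=
    (ProbabilityMeasure.tendsto_iff_forall_integral_rclike_tendsto ℂ).1 hUμ (cauchyKernel hw.ne')
  have h2 : Tendsto (fun N => meanTr 1 (gaussianReal 0 1) (N + 1) w) U (𝓝 (stieltjes μ w)) := by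
    have h3 := h1.sub ((hνs w hw).mono_left hU)
    simpa using h3
  exact meanTr_limit_selfConsistent hp he hw (stieltjes_im_nonneg hw)
    ((tendsto_add_atTop_nat 1).mono_left hU) h2

theorem gaussianPDFReal_mul_le_real_Icc {v : NNReal} (hv : v ≠ 0) {a b K : ℝ}
    (ha : |a| ≤ K) (hb : |b| ≤ K) :
    gaussianPDFReal 0 v K * (b - a) ≤ (gaussianReal 0 v).real (Set.Icc a b) := by
  have h0 := gaussianPDFReal_nonneg 0 v K
  rw [← ENNReal.ofReal_le_ofReal_iff measureReal_nonneg, ofReal_measureReal,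
    gaussianReal_apply 0 hv, ENNReal.ofReal_mul h0, ← Real.volume_Icc, ← setLIntegral_const]
  refine setLIntegral_mono (measurable_gaussianPDF 0 v) fun x hx => ?_
  rw [gaussianPDF]
  refine ENNReal.ofReal_le_ofReal ?_
  simp only [gaussianPDFReal, sub_zero]
  have h1 : x ^ 2 ≤ K ^ 2 := by
    rw [← sq_abs x]
    refine pow_le_pow_left₀ (abs_nonneg x) (abs_le.2 ⟨?_, ?_⟩) 2
    · linarith [neg_abs_le a, hx.1]
    · linarith [le_abs_self b, hx.2]
  gcongr

/-- On the interval of radius Im w around Re w, of length 2 Im w, the kernel is at least 1/(2 Im w)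
and the density at least its value at K. The lengths cancel, so the bound is uniform as w approaches
the real axis. -/
theorem gaussianPDFReal_le_stieltjes_im {v : NNReal} (hv : v ≠ 0) {w : ℂ} {K : ℝ} (hw : 0 < w.im)
    (hK : |w.re| + w.im ≤ K) : gaussianPDFReal 0 v K ≤ (stieltjes (gaussianReal 0 v) w).im := by
  have h1 := gaussianPDFReal_mul_le_real_Icc hv (a := w.re - w.im) (b := w.re + w.im) (K := K)
    (by
      refine (abs_sub _ _).trans ?_
      rwa [abs_of_pos hw]) (by
      refine (abs_add_le _ _).trans ?_
      rwa [abs_of_pos hw])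
  have h2 : (gaussianReal 0 v).real (Set.Icc (w.re - w.im) (w.re + w.im)) * (2 * w.im)⁻¹ ≤
      (stieltjes (gaussianReal 0 v) w).im := by
    rw [stieltjes_im hw.ne', ← smul_eq_mul, ← integral_indicator_const _ measurableSet_Icc]
    refine integral_mono ((integrable_const _).indicator measurableSet_Icc)
      (integrable_im_kernel hw.ne') fun x => ?_
    dsimp only
    by_cases hx : x ∈ Set.Icc (w.re - w.im) (w.re + w.im)
    · rw [Set.indicator_of_mem hx]
      have h3 : (x - w.re) ^ 2 ≤ w.im ^ 2 :=
        sq_le_sq' (by linarith [hx.1]) (by linarith [hx.2])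
      rw [inv_eq_one_div, div_le_div_iff₀ (by positivity) (by positivity)]
      nlinarith
    · rw [Set.indicator_of_notMem hx]
      positivity
  refine le_trans ?_ h2
  rw [← div_eq_mul_inv, le_div_iff₀ (by positivity)]
  linarith

theorem not_isBounded_support_of_selfConsistent {μ : Measure ℝ} [IsProbabilityMeasure μ]
    (h : ∀ w : ℂ, 0 < w.im →
      stieltjes μ w = stieltjes (gaussianReal 0 (1 / 2)) (w + stieltjes μ w / 2)) :
    ¬ Bornology.IsBounded μ.support := by
  intro hb
  obtain ⟨R, hR⟩ := hb.subset_closedBall 0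
  have hae : ∀ᵐ x ∂μ, x ≤ R := by
    have h0 : ∀ᵐ x ∂μ, x ∈ μ.support := Measure.support_mem_ae
    filter_upwards [h0] with x hx
    have := hR hx
    rw [mem_closedBall_zero_iff, Real.norm_eq_abs] at this
    exact (le_abs_self x).trans this
  -- At the point w = R + 1 + iη, at distance at least 1 from the support, ‖s‖ ≤ 1 and 0 ≤ Im s ≤ η
  -- ≤ 1. So w + s/2 stays in the region governed by K, and the equation forces κ ≤ Im s ≤ η ≤ κ/2,
  -- which is absurd.
  set K := |R + 1| + 4 with hK
  set κ := gaussianPDFReal 0 (1 / 2) K with hκ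
  have hκ0 : 0 < κ := gaussianPDFReal_pos _ _ _ (by norm_num)
  set η := min 1 (κ / 2) with hη
  have hη0 : 0 < η := by positivity
  have hη1 : η ≤ 1 := min_le_left _ _
  set w : ℂ := ⟨R + 1, η⟩ with hw
  have hwim : w.im = η := rfl
  have hwre : w.re = R + 1 := rfl
  have hw0 : 0 < w.im := hη0
  set s := stieltjes μ w with hs
  have hnorm : ‖s‖ ≤ 1 := by
    refine (norm_integral_le_of_norm_le_const (C := 1) ?_).trans (by simp)
    filter_upwards [hae] with x hx
    rw [norm_inv]
    refine inv_le_one_of_one_le₀ ?_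
    have h1 := Complex.abs_re_le_norm ((x : ℂ) - w)
    rw [Complex.sub_re, Complex.ofReal_re, hwre] at h1
    refine le_trans ?_ h1
    rw [abs_of_nonpos (by linarith)]
    linarith
  have him : s.im ≤ η := by
    rw [hs, stieltjes_im hw0.ne']
    have h2 : ∫ _, η ∂μ = η := by simp
    rw [← h2]
    refine integral_mono_ae (integrable_im_kernel hw0.ne') (integrable_const _) ?_
    filter_upwards [hae] with x hx
    rw [hwim, hwre]
    refine div_le_self hη0.le ?_
    nlinarith [sq_nonneg η]
  have hs0 : 0 ≤ s.im := stieltjes_im_nonneg hw0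
  have e1 : (w + s / 2).im = η + s.im / 2 := by
    rw [Complex.add_im, show (2 : ℂ) = ((2 : ℝ) : ℂ) by norm_num, Complex.div_ofReal_im]
  have e2 : (w + s / 2).re = R + 1 + s.re / 2 := by
    rw [Complex.add_re, show (2 : ℂ) = ((2 : ℝ) : ℂ) by norm_num, Complex.div_ofReal_re]
  have h3 := gaussianPDFReal_le_stieltjes_im (v := 1 / 2) (by norm_num) (w := w + s / 2) (K := K)
    (by rw [e1]; linarith) (by
      rw [e1, e2]
      have h4 := abs_add_le (R + 1) (s.re / 2)
      have h5 : |s.re / 2| ≤ 1 / 2 := by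
        rw [abs_div, abs_two]
        linarith [(Complex.abs_re_le_norm s).trans hnorm]
      linarith)
  rw [← h w hw0] at h3
  have h6 : η ≤ κ / 2 := min_le_right _ _
  linarith

end SelfConsistentLimit

end

/-! ### The main theorem -/

theorem mainTheorem2 :
    ∃ μ : Measure ℝ, IsProbabilityMeasure μ ∧ ¬ Bornology.IsBounded μ.support ∧
      ∀ p : Measure ℝ, IsEntryLaw p →
      ∀ (Ω : Type*) [MeasurableSpace Ω] (P : Measure Ω) [IsProbabilityMeasure P]
        (X : (N : ℕ) → DiscoIndex N → Ω → ℝ),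
        (∀ N, iIndepFun (X N) P) →
        (∀ N k, HasLaw (X N k) p P) →
        (∀ f : ℝ →ᵇ ℝ, TendstoInMeasure P
          (fun N ω => ∫ x, f x ∂(discoSpectralMeasure fun k => X N k ω))
          atTop (fun _ => ∫ x, f x ∂μ)) ∧
        (∀ᵐ ω ∂P, ∀ f : ℝ →ᵇ ℝ, Tendsto
          (fun N => ∫ x, f x ∂(discoSpectralMeasure fun k => X N k ω))
          atTop (𝓝 (∫ x, f x ∂μ))) := by
  obtain ⟨μ, hμ, hsc⟩ := exists_selfConsistent_measure
  refine ⟨μ, hμ, not_isBounded_support_of_selfConsistent hsc, ?_⟩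
  intro p hp Ω _ P _ X hX hXp
  have hY : ∀ N, AEMeasurable (fun ω k => X N k ω) P := fun N =>
    aemeasurable_pi_iff.2 fun k => (hXp N k).aemeasurable
  have hYp : ∀ N, P.map (fun ω k => X N k ω) = iidLaw (DiscoIndex N) p := fun N => by
    rw [(iIndepFun_iff_map_fun_eq_pi_map fun k => (hXp N k).aemeasurable).1 (hX N)]
    simp only [(hXp N _).map_eq]
  have hae : ∀ᵐ ω ∂P, ∀ f : ℝ →ᵇ ℝ, Tendsto
      (fun N => ∫ x, f x ∂(discoSpectralMeasure fun k => X N k ω)) atTop (𝓝 (∫ x, f x ∂μ)) := by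
    filter_upwards [ae_forall_tendsto_normTrResol_sub_meanTr hp hY hYp (e := 1) (by norm_num),
      ae_forall_tendsto_normTrResol_sub_meanTr hp hY hYp (e := -1) (by norm_num)] with ω h1 h2 f
    -- The index is shifted because the spectral measure is a probability measure only for N ≥ 1.
    rw [← tendsto_add_atTop_iff_nat 1]
    have := fun N => isProbabilityMeasure_discoSpectralMeasure (N := N + 1) fun k => X (N + 1) k ω
    refine tendsto_integral_of_tendsto_stieltjes
      (ν := fun N => discoSpectralMeasure fun k => X (N + 1) k ω) (fun w hw => ?_) f
    have hw0 : 0 < w.im := two_pos.trans_le hw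
    simp only [stieltjes_discoSpectralMeasure _ hw0.ne']
    have key : ∀ e : ℝ, e ^ 2 = 1 → Tendsto (fun N => normTrResol (blockSum e fun k => X N k ω) w -
        meanTr e p N w) atTop (𝓝 0) → Tendsto (fun N =>
          normTrResol (blockSum (N := N + 1) e fun k => X (N + 1) k ω) w) atTop
            (𝓝 (stieltjes μ w)) := fun e he h => by
      have h3 := h.add (tendsto_meanTr_of_selfConsistent hp he hw
        (stieltjes_im_nonneg (ν := μ) hw0) (hsc w hw0))
      simp only [sub_add_cancel, zero_add] at h3
      exact (tendsto_add_atTop_iff_nat 1).2 h3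
    have h4 := ((key 1 (by norm_num) (h1 w hw0)).add
      (key (-1) (by norm_num) (h2 w hw0))).const_mul (2⁻¹ : ℂ)
    have h5 : (2⁻¹ : ℂ) * (stieltjes μ w + stieltjes μ w) = stieltjes μ w := by ring
    rwa [h5] at h4
  -- On the given probability space, convergence in probability follows from almost sure
  -- convergence.
  refine ⟨fun f => tendstoInMeasure_of_tendsto_ae (fun N => ?_) ?_, hae⟩
  · exact ((continuous_integral_discoSpectralMeasure f).measurable.comp_aemeasurable
      (hY N)).aestronglyMeasurable
  · filter_upwards [hae] with ω hω
    exact hω f
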